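/- **Objects.** A *compatible pair* $(a,i)$ consists of two words $a=a_1\cdots a_n$, $i=i_1\cdots i_n$ of positive integers of the same length $n\ge 0$, such that $i$ is weakly decreasing and $i_j=i_{j+1}$ implies $a_j<a_{j+1}$. It is *bounded* if $i_j\le a_j$ for all $j$. Let $\mathcal C$ be the set of compatible pairs and $\mathcal C^b$ the set of bounded ones. A *decreasing tableau* is a filling of a partition shape by positive integers, strictly decreasing along rows (left to right) and columns (top to bottom). A *reverse semistandard tableau* (RSSYT) is weakly decreasing along rows and strictly decreasing along columns. A *reverse set-valued tableau* (RSVT) is a filling of a partition shape by nonempty finite sets of positive integers such that $\min T(s)\ge\max T(t)$ if box $t$ is immediately right of box $s$, and $\min T(s)>\max T(t)$ if $t$ is immediately below $s$; $L(T)$ is the RSSYT obtained by replacing each set by its maximum. Let $\mathcal T$ be the set of pairs $(P,Q)$ of tableaux of the same partition shape with $P$ decreasing and $Q$ an RSVT. **Hecke insertion.** To Hecke insert $x$ into a decreasing tableau $T$, insert $x$ into column 1; whenever a column outputs a number, insert that number into the next column (there is an empty column after the last one); stop when there is no output. Inserting $x$ into a column: (1) if $x$ is at most all entries of the column, there is no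 output; $x$ is appended at the bottom of the column if the result is a decreasing tableau, and then $c$ is the new box and $\alpha=1$; otherwise the column is unchanged, $c$ is the rightmost box in the row of the bottom entry of the column, and $\alpha=0$. (2) Otherwise let $y$ be the largest entry of the column with $y<x$; replace $y$ by $x$ if the result is a decreasing tableau (otherwise leave the column unchanged), and output $y$. The *reverse Hecke insertion* of $(P,c,\alpha)$, where $c$ is a box of $P$ at the end of its row and its column, starts with the number $y$ in $c$, removes the box $c$ if and only if $\alpha=1$, and reverse inserts $y$ into the column left of that of $c$; reverse inserting $y$ into a column finds the smallest entry $y'>y$ there, replaces $y'$ by $y$ if the result is a decreasing tableau, and in either case reverse inserts $y'$ into the preceding column; if there is no column on the left, the current number is the output $x$. **Insert and RevInsert.** $\mathrm{Insert}$ sends the pair of empty words to the pair of empty tableaux. If $(a,i)=(a'x,i'y)$ and $(P',Q')=\mathrm{Insert}(a',i')$, Hecke insert $x$ into $P'$, with result $(P,c,\alpha)$; $Q$ is obtained from $Q'$ by adding a new box $c$ with entry $\{y\}$ if $\alpha=1$, and by adding $y$ to the set in box $c$ if $\alpha=0$; $\mathrm{Insert}(a,i)=(P,Q)$. $\mathrm{RevInsert}$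 sends the pair of empty tableaux to the pair of empty words. If $P$ is nonempty, let $y$ be the smallest number in $Q$ and remove the rightmost $y$ from $Q$, together with its box if $y$ is the only number there ($\alpha=1$; otherwise $\alpha=0$), leaving $Q'$; reverse Hecke insertion at the corresponding box of $P$ with $\alpha$ gives $(P',x)$; if $(a',i')=\mathrm{RevInsert}(P',Q')$, then $\mathrm{RevInsert}(P,Q)=(a'x,i'y)$. **Keys.** For a finite set $S$ and a number $m$, let $S\star m$ be obtained from $S$ by replacing the smallest element $\ge m$ by $m$, or by adding $m$ if there is no such element; for a word, $S\star w_1\cdots w_n=(\cdots(S\star w_1)\star\cdots)\star w_n$. The right key $K_+(P)$ of a decreasing tableau $P$ is the tableau whose $j$-th column is the set $\emptyset\star w$, where $w$ is the word obtained by reading the columns $j,j+1,\dots$ of $P$ from left to right, each from bottom to top. For sets $C_1$ and $C_2=\{a_1<\dots<a_m\}$ forming two adjacent columns of an RSSYT, let $C_1\triangleleft C_2=\{b_1<\dots<b_m\}$, where $b_1$ is the smallest element of $C_1$ with $b_1\ge a_1$ and $b_{k}$ is the smallest element of $C_1$ with $b_k\ge a_k$ and $b_k>b_{k-1}$. The left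 key $K_-(T)$ of an RSSYT $T$ with columns $C_1,C_2,\dots$ is the tableau whose $k$-th column is $C_1\triangleleft(C_2\triangleleft(\cdots\triangleleft C_k))$. For two keys write $K\le K'$ if they have the same shape and $K$ is entrywise at most $K'$ (each column being sorted). Let $\mathcal T^b$ be the set of $(P,Q)\in\mathcal T$ with $K_+(P)\ge K_-(L(Q))$. **Theorem.** The maps $\mathrm{Insert}:\mathcal C\to\mathcal T$ and $\mathrm{RevInsert}:\mathcal T\to\mathcal C$ are mutually inverse bijections, and $\mathrm{Insert}$ restricts to a bijection $\mathcal C^b\cong\mathcal T^b$. Moreover, for every decreasing tableau $P$, let $\mathcal C_P$ be the set of $(a,i)\in\mathcal C^b$ such that Hecke inserting the letters of $a$ from left to right into the empty tableau gives $P$, and let $\mathcal T_P$ be the set of pairs in $\mathcal T^b$ with first component $P$. Then the restrictions of $\mathrm{Insert}$ to $\mathcal C_P$ and of $\mathrm{RevInsert}$ to $\mathcal T_P$ are mutually inverse bijections between $\mathcal C_P$ and $\mathcal T_P$. -/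

import Mathlib

namespace HeckeRSK

/-! ### Tableaux

A filling of a partition shape by elements of `α` is given by the list of its columns, from left to
right, each column being listed from top to bottom. The columns are nonempty and their lengths
weakly decrease, so that a filled partition shape is the same thing as such a list of lists; the
empty tableau is `[]`. Rows and columns are numbered from `0`. -/

/-- Fillings of partition shapes by elements satisfying `ok`, in which any entry `x` and the entry
`y` immediately to its right satisfy `row x y`, and any entry `x` and the entry `y` immediately below
it satisfy `col x y`. -/
def IsTableau {α : Type} (ok : α → Prop) (row col : α → α → Prop) (T : List (List α)) : Prop :=
  (∀ C ∈ T, C ≠ [] ∧ (∀ x ∈ C, ok x) ∧ C.IsChain col) ∧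
    T.IsChain (fun C D => D.length ≤ C.length ∧ List.Forall₂ row (C.take D.length) D)

/-- Decreasing tableaux: positive entries, strictly decreasing along rows and columns. -/
def IsDecreasing (P : List (List ℕ)) : Prop :=
  IsTableau (fun x => 0 < x) (fun x y => y < x) (fun x y => y < x) P

instance (P : List (List ℕ)) : Decidable (IsDecreasing P) := by
  unfold IsDecreasing IsTableau
  infer_instance

/-- Reverse set-valued tableaux (RSVT): the entries are nonempty finite sets of positive integers;
`min T(s) ≥ max T(t)` if `t` is immediately right of `s`, and `min T(s) > max T(t)` if `t` is
immediately below `s`. -/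
def IsRSVT (Q : List (List (Finset ℕ))) : Prop :=
  IsTableau (fun S => S.Nonempty ∧ ∀ x ∈ S, 0 < x)
    (fun S S' => ∀ x ∈ S, ∀ y ∈ S', y ≤ x) (fun S S' => ∀ x ∈ S, ∀ y ∈ S', y < x) Q

/-- The shape, as the list of column lengths. -/
def shape {α : Type} (T : List (List α)) : List ℕ := T.map List.length

/-- The tableau `L(Q)`: every entry of `Q` is replaced by its largest element. -/
def maxTableau (Q : List (List (Finset ℕ))) : List (List ℕ) :=
  Q.map (List.map (fun S => S.sup id))

/-- The column reading word: each column is read from bottom to top, columns from left to right. -/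
def word (T : List (List ℕ)) : List ℕ := (T.map List.reverse).flatten

/-! ### Keys

A key is given by the list of its columns, as sets. -/

/-- `S ⋆ m`: the smallest element of `S` that is at least `m` is replaced by `m`; if there is none,
`m` is added to `S`. -/
def star (S : Finset ℕ) (m : ℕ) : Finset ℕ :=
  if h : (S.filter (fun x => m ≤ x)).Nonempty then
    insert m (S.erase ((S.filter (fun x => m ≤ x)).min' h))
  else insert m S

/-- The right key `K₊(P)`: its `j`-th column is `∅ ⋆ word(P_{≥ j})`. -/
def rightKey (P : List (List ℕ)) : List (Finset ℕ) :=
  (List.range P.length).map (fun j => (word (P.drop j)).foldl star ∅)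

/-- Given a set `C` and the list `a₁ < a₂ < ⋯ < aₘ`, select the smallest `b₁ ∈ C` with `b₁ ≥ a₁`, then
the smallest `b₂ ∈ C` with `b₂ ≥ a₂` and `b₂ > b₁`, and so on; the result is `{b₁, …, bₘ}`. (If a
selection is impossible, which does not happen for adjacent columns of a reverse semistandard tableau,
stop.) -/
def selectAbove (C : Finset ℕ) : List ℕ → Finset ℕ
  | [] => ∅
  | a :: as =>
    if h : (C.filter (fun b => a ≤ b)).Nonempty then
      insert ((C.filter (fun b => a ≤ b)).min' h)
        (selectAbove (C.filter (fun b => (C.filter (fun b => a ≤ b)).min' h < b)) as)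
    else ∅

/-- `C₁ ◁ C₂`. -/
def tri (C₁ C₂ : Finset ℕ) : Finset ℕ := selectAbove C₁ (C₂.sort (· ≤ ·))

/-- `C₁ ◁ (C₂ ◁ (⋯ ◁ Cₖ))` for a list of columns. -/
def triAll : List (List ℕ) → Finset ℕ
  | [] => ∅
  | [C] => C.toFinset
  | C :: D :: rest => tri C.toFinset (triAll (D :: rest))

/-- The left key `K₋(T)` of a reverse semistandard tableau with columns `C₁, C₂, …`: its `k`-th column
is `C₁ ◁ ⋯ ◁ Cₖ`. -/
def leftKey (T : List (List ℕ)) : List (Finset ℕ) :=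
  (List.range T.length).map (fun j => triAll (T.take (j + 1)))

/-- `K ≤ K'` for keys: they have the same shape, and `K` is entrywise at most `K'`. -/
def KeyLE (K K' : List (Finset ℕ)) : Prop :=
  List.Forall₂ (fun C C' => List.Forall₂ (· ≤ ·) (C.sort (· ≤ ·)) (C'.sort (· ≤ ·))) K K'

/-! ### Hecke column insertion -/

/-- The column `C` with its entry `y` replaced by `x`. -/
def replaceEntry (C : List ℕ) (y x : ℕ) : List ℕ := C.map (fun z => if z = y then x else z)

/-- The number of boxes in row `r`. -/
def rowLength (T : List (List ℕ)) (r : ℕ) : ℕ := T.countP (fun C => r < C.length)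

/-- Insertion of `x` into the first column of `rest`, where `done` are the columns already treated; the
current tableau is `done ++ rest`. The result is the new tableau, the box (row, column) where the
algorithm ends, and whether this box is new (`true` is `α = 1`, `false` is `α = 0`).

If `x` is at most every entry of the column, it is appended to the bottom as long as the result is a
decreasing tableau; otherwise nothing changes and the algorithm ends at the rightmost box in the row
of the bottom entry of the column. If not, let `y` be the largest entry of the column with `y < x`; it is
replaced by `x` as long as the result is a decreasing tableau, and in either case `y` is inserted into
the next column. An empty column stands after the last one; there the first case applies, and the number is appended
(when one starts from a decreasing tableau, this always gives a decreasing tableau). -/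
def insertFrom (done : List (List ℕ)) : List (List ℕ) → ℕ → List (List ℕ) × (ℕ × ℕ) × Bool
  | [], x => (done ++ [[x]], (0, done.length), true)
  | C :: rest, x =>
    match (C.filter (fun z => z < x)).max? with
    | none =>
      if IsDecreasing (done ++ (C ++ [x]) :: rest) then
        (done ++ (C ++ [x]) :: rest, (C.length, done.length), true)
      else
        (done ++ C :: rest, (C.length - 1, rowLength (done ++ C :: rest) (C.length - 1) - 1), false)
    | some y =>
      if IsDecreasing (done ++ replaceEntry C y x :: rest) then
        insertFrom (done ++ [replaceEntry C y x]) rest y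
      else
        insertFrom (done ++ [C]) rest y

/-- Hecke insertion of `x` into `P`. -/
def heckeInsert (P : List (List ℕ)) (x : ℕ) : List (List ℕ) × (ℕ × ℕ) × Bool := insertFrom [] P x

/-- The tableau obtained by Hecke inserting the letters of a word, from left to right, into the empty
tableau. -/
def insertionTableau (a : List ℕ) : List (List ℕ) := a.foldl (fun P x => (heckeInsert P x).1) []

/-- Append the new box `{y}` at the bottom of column `c`. -/
def appendBox (Q : List (List (Finset ℕ))) (c y : ℕ) : List (List (Finset ℕ)) :=
  if c < Q.length then Q.modify c (fun C => C ++ [{y}]) else Q ++ [[{y}]]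

/-- Modify the entry in row `r` of column `c`. -/
def modifyEntry (Q : List (List (Finset ℕ))) (r c : ℕ) (f : Finset ℕ → Finset ℕ) :
    List (List (Finset ℕ)) :=
  Q.modify c (fun C => C.modify r f)

/-- One step of `Insert`: insert `x` into `P`, and record `y` in `Q`. -/
def insertStep (PQ : List (List ℕ) × List (List (Finset ℕ))) (xy : ℕ × ℕ) :
    List (List ℕ) × List (List (Finset ℕ)) :=
  match heckeInsert PQ.1 xy.1 with
  | (P, (_, c), true) => (P, appendBox PQ.2 c xy.2)
  | (P, (r, c), false) => (P, modifyEntry PQ.2 r c (fun S => insert xy.2 S))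

/-- The map `Insert` on pairs of words `(a, i)`. -/
def Insert (ai : List ℕ × List ℕ) : List (List ℕ) × List (List (Finset ℕ)) :=
  (ai.1.zip ai.2).foldl insertStep ([], [])

/-! ### Reverse Hecke column insertion -/

/-- Remove the bottom box of column `c`. -/
def removeBox {α : Type} (T : List (List α)) (c : ℕ) : List (List α) :=
  (T.modify c List.dropLast).filter (fun C => !C.isEmpty)

/-- `revInsertFrom k P y` reverse inserts `y` into column `k - 1`, then goes on to the left. Let `y'` be
the smallest entry of the column with `y' > y`; it is replaced by `y` as long as the result is a decreasing
tableau, and in either case `y'` is reverse inserted into the previous column. (There is always such a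
`y'` when one starts from a decreasing tableau.) -/
def revInsertFrom : ℕ → List (List ℕ) → ℕ → List (List ℕ) × ℕ
  | 0, P, y => (P, y)
  | k + 1, P, y =>
    match ((P.getD k []).filter (fun z => y < z)).min? with
    | none => (P, y)
    | some y' =>
      if IsDecreasing (P.modify k (fun C => replaceEntry C y' y)) then
        revInsertFrom k (P.modify k (fun C => replaceEntry C y' y)) y'
      else
        revInsertFrom k P y'

/-- Reverse Hecke insertion on a decreasing tableau `P` and the box in row `r` and column `c`, which is at
the end of its row and of its column; the box is removed first if `α` is `true` (`α = 1`), and kept if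
`α` is `false` (`α = 0`). -/
def heckeRevInsert (P : List (List ℕ)) (r c : ℕ) (α : Bool) : List (List ℕ) × ℕ :=
  let y := (P.getD c []).getD r 0
  if α then revInsertFrom c (removeBox P c) y else revInsertFrom c P y

/-- The boxes (row, column) of `Q` whose entry contains `y`. -/
def boxesWith (Q : List (List (Finset ℕ))) (y : ℕ) : List (ℕ × ℕ) :=
  (List.range Q.length).flatMap (fun c =>
    ((List.range (Q.getD c []).length).filter (fun r => y ∈ (Q.getD c []).getD r ∅)).map
      (fun r => (r, c)))

/-- The smallest number in `Q` (`0` if `Q` is empty). -/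
def minNumber (Q : List (List (Finset ℕ))) : ℕ :=
  (Q.flatten.foldr (fun S U => S ∪ U) ∅).min.untopD 0

/-- The total number of numbers in `Q`. -/
def size (Q : List (List (Finset ℕ))) : ℕ := (Q.map (fun C => (C.map Finset.card).sum)).sum

/-- The recursion defining `RevInsert`, with a bound on the number of steps. The smallest number `y` of
`Q` is removed from the rightmost box that contains it (together with this box, if `y` is the only number
there: `α = 1`; otherwise `α = 0`), reverse Hecke insertion at the corresponding box of `P` gives `P'` and
`x`, and `x`, `y` are the last letters of the two words. -/
def revInsertAux : ℕ → List (List ℕ) × List (List (Finset ℕ)) → List ℕ × List ℕ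
  | 0, _ => ([], [])
  | n + 1, (P, Q) =>
    match (boxesWith Q (minNumber Q)).getLast? with
    | none => ([], [])
    | some (r, c) =>
      let y := minNumber Q
      let α : Bool := decide ((Q.getD c []).getD r ∅ = {y})
      let Q' := if α then removeBox Q c else modifyEntry Q r c (fun S => S.erase y)
      let Px := heckeRevInsert P r c α
      let ai := revInsertAux n (Px.1, Q')
      (ai.1 ++ [Px.2], ai.2 ++ [y])

/-- The map `RevInsert`. Every step removes one number from `Q`, so `size Q` steps exhaust it. -/
def RevInsert (PQ : List (List ℕ) × List (List (Finset ℕ))) : List ℕ × List ℕ :=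
  revInsertAux (size PQ.2) PQ

/-! ### The sets in the bijections -/

/-- The set `𝒞` of compatible pairs `(a, i)`: words of positive numbers of the same length, with `i`
weakly decreasing and `a_j < a_{j+1}` whenever `i_j = i_{j+1}`. -/
def compatiblePairs : Set (List ℕ × List ℕ) :=
  {ai | ai.1.length = ai.2.length ∧ (∀ x ∈ ai.1, 0 < x) ∧ (∀ y ∈ ai.2, 0 < y) ∧
    (ai.1.zip ai.2).IsChain (fun p q => q.2 ≤ p.2 ∧ (p.2 = q.2 → p.1 < q.1))}

/-- The set `𝒞ᵇ` of bounded compatible pairs: `i_j ≤ a_j` for all `j`. -/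
def boundedPairs : Set (List ℕ × List ℕ) :=
  {ai | ai ∈ compatiblePairs ∧ ∀ p ∈ ai.1.zip ai.2, p.2 ≤ p.1}

/-- The set `𝒯` of pairs of a decreasing tableau and a reverse set-valued tableau of the same
partition shape. -/
def tableauPairs : Set (List (List ℕ) × List (List (Finset ℕ))) :=
  {PQ | IsDecreasing PQ.1 ∧ IsRSVT PQ.2 ∧ shape PQ.1 = shape PQ.2}

/-- The set `𝒯ᵇ` of those pairs with `K₊(P) ≥ K₋(L(Q))`. -/
def boundedTableauPairs : Set (List (List ℕ) × List (List (Finset ℕ))) :=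
  {PQ | PQ ∈ tableauPairs ∧ KeyLE (leftKey (maxTableau PQ.2)) (rightKey PQ.1)}

/-- The set `𝒞_P` of bounded compatible pairs `(a, i)` such that the insertion tableau of `a` is `P`. -/
def boundedPairsOf (P : List (List ℕ)) : Set (List ℕ × List ℕ) :=
  {ai | ai ∈ boundedPairs ∧ insertionTableau ai.1 = P}

/-- The set `𝒯_P` of the pairs in `𝒯ᵇ` whose first component is `P`. -/
def boundedTableauPairsOf (P : List (List ℕ)) : Set (List (List ℕ) × List (List (Finset ℕ))) :=
  {PQ | PQ ∈ boundedTableauPairs ∧ PQ.1 = P}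

end HeckeRSK

namespace HeckeRSK

/-! An insertion and its reverse are compared through a common certificate. A `Trace` records for
each column the number `o j` entering it, a row `q j`, and whether the entry in this row is replaced
or the column is kept. The row serves both directions: it is the row of the replaced entry, or, in a
kept column, the row just above the output, and in either case the reverse insertion finds its entry
there. The number passing from one column to the next is the same in both directions, with one
exception, `KeepsTwo`: two kept columns with the same row, where nothing changes in either
direction. Both algorithms leave a trace (`heckeInsert_trace`, `heckeRevInsert_trace`). A trace is
determined by the old tableau and the inserted number (`Trace.unique_forward`), and also by the new
tableau, the final box and `α` (`Trace.unique_reverse`). Hence single insertions and reverse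
insertions undo each other.

For words the key is `Trace.lt_iff`: of two consecutive insertions, the second ends in a column
strictly further right exactly if its number is larger. Equal letters of `i` are therefore recorded
further and further to the right, so the letter recorded last is the rightmost occurrence of the
smallest number. `Addable` expresses when a letter pair may be added to a pair of tableaux, and it
matches compatibility of the lengthened words (`Addable.next_iff`).

Boundedness is also treated one step at a time: after adding `(x, y)` the pair is bounded exactly if
it was bounded before and `y ≤ x` (`Addable.bounded_iff`). For `⋆`, inserting `x` into `P` amounts
to writing `x` in front of the word of `P` (`Trace.foldl_star_word`). So a column of the right key
gains at most one element, and by counting only the column `c` of a new box does. Dually, `◁` is a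
parking process whose outcome does not depend on the order of the requests, and the left key also
gains one element in column `c`. Let `z` and `d` be the elements gained by the right and the left
key. Below `z`, column `c` of the old right key is contained in column `c + 1`
(`Trace.rightKey_insert`); below `d`, column `c - 1` of the old left key is contained in column `c`
(`triChain_column_insert`). When keys are compared by counting the elements less than `t`, small `t`
are thus referred to a neighbouring column, where nothing has changed; for larger `t` the extra
elements balance. In the first column the condition `y ≤ x` takes the place of the missing
neighbour. -/

/-! ### Decreasing fillings of the quadrant -/

/-- A decreasing tableau as a function of the column and the row, with value `0` outside the shape. -/
structure IsDecFill (T : ℕ → ℕ → ℕ) : Prop where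
  row : ∀ j r, T (j + 1) r < T j r ∨ T (j + 1) r = 0
  col : ∀ j r, T j (r + 1) < T j r ∨ T j (r + 1) = 0

theorem IsDecFill.col_lt {T : ℕ → ℕ → ℕ} (h : IsDecFill T) (j : ℕ) {r s : ℕ} (hrs : r < s) :
    T j s < T j r ∨ T j s = 0 := by
  induction s, hrs using Nat.le_induction with
  | base => exact h.col j r
  | succ s _ ih => have := h.col j s; omega

theorem IsDecFill.col_le {T : ℕ → ℕ → ℕ} (h : IsDecFill T) (j : ℕ) {r s : ℕ} (hrs : r ≤ s) :
    T j s ≤ T j r := by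
  rcases hrs.eq_or_lt with rfl | hlt
  · exact le_rfl
  · have := h.col_lt j hlt; omega

theorem IsDecFill.row_le {T : ℕ → ℕ → ℕ} (h : IsDecFill T) (r : ℕ) {i j : ℕ} (hij : i ≤ j) :
    T j r ≤ T i r := by
  induction j, hij using Nat.le_induction with
  | base => exact le_rfl
  | succ s _ ih => have := h.row s r; omega

/-- Replace the entry in column `k` and row `s` by `v`. -/
def setFill {α : Type} (T : ℕ → ℕ → α) (k s : ℕ) (v : α) : ℕ → ℕ → α :=
  fun j r => if j = k ∧ r = s then v else T j r

theorem setFill_self {α : Type} (T : ℕ → ℕ → α) (k s : ℕ) (v : α) : setFill T k s v k s = v := by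
  simp [setFill]

theorem setFill_of_ne {α : Type} (T : ℕ → ℕ → α) {k s j r : ℕ} (v : α) (h : j ≠ k ∨ r ≠ s) :
    setFill T k s v j r = T j r := by
  simp only [setFill]; rw [if_neg]; omega

/-- Why an entry cannot be increased. -/
theorem IsDecFill.not_setFill_gt {U : ℕ → ℕ → ℕ} (h : IsDecFill U) {k s v : ℕ}
    (hs : U k s < v) (hn : ¬ IsDecFill (setFill U k s v)) :
    (∃ s', s = s' + 1 ∧ U k s' ≤ v) ∨ (∃ k', k = k' + 1 ∧ U k' s ≤ v) := by
  by_contra hcon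
  push Not at hcon
  obtain ⟨h1, h2⟩ := hcon
  refine hn ⟨fun j r => ?_, fun j r => ?_⟩
  · have := h.row j r
    simp only [setFill]
    split_ifs with ha hb hb
    · omega
    · have := h2 j (by omega); rw [← ha.2] at this; omega
    · obtain ⟨rfl, rfl⟩ := hb; omega
    · omega
  · have := h.col j r
    simp only [setFill]
    split_ifs with ha hb hb
    · omega
    · have := h1 r (by omega); rw [← ha.1] at this; omega
    · obtain ⟨rfl, rfl⟩ := hb; omega
    · omega

/-- Why an entry cannot be decreased. -/
theorem IsDecFill.not_setFill_lt {U : ℕ → ℕ → ℕ} (h : IsDecFill U) {k s v : ℕ}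
    (hs : v < U k s) (hv : 0 < v) (hn : ¬ IsDecFill (setFill U k s v)) :
    v ≤ U k (s + 1) ∨ v ≤ U (k + 1) s := by
  by_contra hcon
  push Not at hcon
  obtain ⟨h1, h2⟩ := hcon
  refine hn ⟨fun j r => ?_, fun j r => ?_⟩
  · have := h.row j r
    simp only [setFill]
    split_ifs with ha hb hb
    · omega
    · obtain ⟨rfl, rfl⟩ := ha; omega
    · obtain ⟨rfl, rfl⟩ := hb; omega
    · omega
  · have := h.col j r
    simp only [setFill]
    split_ifs with ha hb hb
    · omega
    · obtain ⟨rfl, rfl⟩ := ha; omega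
    · obtain ⟨rfl, rfl⟩ := hb; omega
    · omega

/-! ### Traces of Hecke insertions

In column `j` a Hecke insertion inserts `o j` and outputs `o (j + 1)`; the row `q j` is that of the
entry that is replaced, or the row above the entry that is output without being replaced. The
reverse insertion reads `T' (j + 1) (q (j + 1))` into column `j`. -/

/-- Column `j` changes in row `q j`. -/
def Replaces (T T' : ℕ → ℕ → ℕ) (q o : ℕ → ℕ) (j : ℕ) : Prop :=
  T j (q j) < T' j (q j) ∧ (∀ r, r ≠ q j → T' j r = T j r) ∧ o (j + 1) = T j (q j)

/-- Column `j` does not change, and the entry below row `q j` is output. -/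
def Keeps (T T' : ℕ → ℕ → ℕ) (q o : ℕ → ℕ) (j : ℕ) : Prop :=
  (∀ r, T' j r = T j r) ∧ 0 < T j (q j) ∧ o (j + 1) = T j (q j + 1)

/-- Columns `j` and `j + 1` do not change, and the numbers of the insertion and of the reverse
insertion passing between them differ. -/
def KeepsTwo (T T' : ℕ → ℕ → ℕ) (q o : ℕ → ℕ) (j : ℕ) : Prop :=
  Keeps T T' q o j ∧ Keeps T T' q o (j + 1) ∧ q (j + 1) = q j ∧ o (j + 1) < T (j + 1) (q (j + 1))

/-- The insertion of `x` into `T` with result `T'` and final box in row `q c` and column `c`. -/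
structure Trace (T T' : ℕ → ℕ → ℕ) (x : ℕ) (q o : ℕ → ℕ) (c : ℕ) : Prop where
  old : IsDecFill T
  new : IsDecFill T'
  start : o 0 = x
  start_eq : x = T' 0 (q 0)
  step : ∀ j ≤ c, Replaces T T' q o j ∨ Keeps T T' q o j
  link : ∀ j < c, o (j + 1) = T' (j + 1) (q (j + 1)) ∨ KeepsTwo T T' q o j
  last_eq_zero : o (c + 1) = 0
  corner : T' (c + 1) (q c) = 0
  beyond : ∀ j, c < j → ∀ r, T' j r = T j r

/-- The part of a trace in the columns before column `k`. -/
structure FwdTrace (T U : ℕ → ℕ → ℕ) (x : ℕ) (q o : ℕ → ℕ) (k : ℕ) : Prop where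
  old : IsDecFill T
  new : IsDecFill U
  start : o 0 = x
  start_eq : 0 < k → x = U 0 (q 0)
  step : ∀ j < k, Replaces T U q o j ∨ Keeps T U q o j
  link : ∀ j, j + 1 < k → o (j + 1) = U (j + 1) (q (j + 1)) ∨ KeepsTwo T U q o j
  beyond : ∀ j, k ≤ j → ∀ r, U j r = T j r

/-- The part of a trace in the columns from column `k` to column `c`. -/
structure RevTrace (U T' : ℕ → ℕ → ℕ) (q o : ℕ → ℕ) (k c : ℕ) : Prop where
  le : k ≤ c
  old : IsDecFill U
  new : IsDecFill T'
  step : ∀ j, k ≤ j → j ≤ c → Replaces U T' q o j ∨ Keeps U T' q o j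
  link : ∀ j, k ≤ j → j < c → o (j + 1) = T' (j + 1) (q (j + 1)) ∨ KeepsTwo U T' q o j
  last_eq_zero : o (c + 1) = 0
  corner : T' (c + 1) (q c) = 0
  beyond : ∀ j, c < j → ∀ r, T' j r = U j r
  before : ∀ j, j < k → ∀ r, U j r = T' j r

theorem Replaces.congr {T T' U U' : ℕ → ℕ → ℕ} {q o q' o' : ℕ → ℕ} {j : ℕ}
    (h : Replaces T T' q o j) (hU : ∀ r, U j r = T j r) (hU' : ∀ r, U' j r = T' j r)
    (hq : q' j = q j) (ho : o' (j + 1) = o (j + 1)) : Replaces U U' q' o' j := by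
  simp only [Replaces, hU, hU', hq, ho] at *; exact h

theorem Keeps.congr {T T' U U' : ℕ → ℕ → ℕ} {q o q' o' : ℕ → ℕ} {j : ℕ}
    (h : Keeps T T' q o j) (hU : ∀ r, U j r = T j r) (hU' : ∀ r, U' j r = T' j r)
    (hq : q' j = q j) (ho : o' (j + 1) = o (j + 1)) : Keeps U U' q' o' j := by
  simp only [Keeps, hU, hU', hq, ho] at *; exact h

theorem KeepsTwo.congr {T T' U U' : ℕ → ℕ → ℕ} {q o q' o' : ℕ → ℕ} {j : ℕ}
    (h : KeepsTwo T T' q o j) (hU : ∀ i r, i ≤ j + 1 → j ≤ i → U i r = T i r)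
    (hU' : ∀ i r, i ≤ j + 1 → j ≤ i → U' i r = T' i r)
    (hq : ∀ i, i ≤ j + 1 → j ≤ i → q' i = q i)
    (ho : o' (j + 1) = o (j + 1)) (ho2 : o' (j + 2) = o (j + 2)) : KeepsTwo U U' q' o' j := by
  obtain ⟨h1, h2, h3, h4⟩ := h
  refine ⟨h1.congr (fun r => hU _ r (by omega) (by omega)) (fun r => hU' _ r (by omega) (by omega))
    (hq _ (by omega) (by omega)) ho, h2.congr (fun r => hU _ r (by omega) (by omega))
    (fun r => hU' _ r (by omega) (by omega)) (hq _ (by omega) (by omega)) ho2, ?_, ?_⟩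
  · rw [hq _ (by omega) (by omega), hq _ (by omega) (by omega), h3]
  · rw [hq _ (by omega) (by omega), hU _ _ (by omega) (by omega), ho]; exact h4

/-! #### Forward steps -/

/-- The new entry in row `s` is `o k` itself, so the link to the previous column is of the first
kind. The value `U k s = 0` is allowed and means that a box is appended. -/
theorem FwdTrace.replace {T U : ℕ → ℕ → ℕ} {x : ℕ} {q o : ℕ → ℕ} {k s : ℕ}
    (h : FwdTrace T U x q o k) (hs : U k s < o k) (hd : IsDecFill (setFill U k s (o k))) :
    ∃ q' o', FwdTrace T (setFill U k s (o k)) x q' o' (k + 1) ∧ o' (k + 1) = U k s ∧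
      Replaces T (setFill U k s (o k)) q' o' k ∧ q' k = s := by
  have hne : ∀ j, j ≠ k → ∀ r, setFill U k s (o k) j r = U j r :=
    fun j hj r => setFill_of_ne _ _ (Or.inl hj)
  have hrep : Replaces T (setFill U k s (o k)) (Function.update q k s)
      (Function.update o (k + 1) (U k s)) k := by
    refine ⟨?_, fun r hr => ?_, ?_⟩
    · simp only [Function.update_self, setFill_self, ← h.beyond k le_rfl]; exact hs
    · simp only [Function.update_self] at hr
      rw [setFill_of_ne _ _ (Or.inr hr), h.beyond k le_rfl]
    · simp [h.beyond k le_rfl]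
  refine ⟨Function.update q k s, Function.update o (k + 1) (U k s),
    ⟨h.old, hd, ?_, fun _ => ?_, fun j hj => ?_, fun j hj => ?_, fun j hj r => ?_⟩,
    by simp, hrep, by simp⟩
  · rw [Function.update_of_ne (by omega), h.start]
  · rcases Nat.eq_zero_or_pos k with rfl | hk
    · simp [setFill_self, h.start]
    · rw [Function.update_of_ne (by omega), hne 0 (by omega)]; exact h.start_eq hk
  · rcases Nat.lt_succ_iff_lt_or_eq.1 hj with hj | rfl
    · rcases h.step j hj with hs | hs
      · exact Or.inl (hs.congr (fun _ => rfl) (hne j (by omega)) (Function.update_of_ne (by omega) _ _)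
          (Function.update_of_ne (by omega) _ _))
      · exact Or.inr (hs.congr (fun _ => rfl) (hne j (by omega)) (Function.update_of_ne (by omega) _ _)
          (Function.update_of_ne (by omega) _ _))
    · exact Or.inl hrep
  · rcases Nat.lt_succ_iff_lt_or_eq.1 hj with hj | rfl
    · rcases h.link j hj with hs | hs
      · left
        rw [Function.update_of_ne (by omega), Function.update_of_ne (by omega), hne _ (by omega)]
        exact hs
      · right
        exact hs.congr (fun _ _ _ _ => rfl) (fun i r _ _ => hne i (by omega) r)
          (fun i _ _ => Function.update_of_ne (by omega) _ _) (Function.update_of_ne (by omega) _ _)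
          (Function.update_of_ne (by omega) _ _)
    · left
      rw [Function.update_of_ne (by omega), Function.update_self, setFill_self]
  · rw [hne j (by omega), h.beyond j (by omega)]

/-- A replacement is blocked by the entry above, which then equals `o k`, or by the entry on the
left. In the second case, comparison with the row from which `o k` left the previous column shows
that this column was kept, with its row directly above `s`; unless `o k` equals the entry above,
this is `KeepsTwo`. -/
theorem FwdTrace.keep {T U : ℕ → ℕ → ℕ} {x : ℕ} {q o : ℕ → ℕ} {k s : ℕ}
    (h : FwdTrace T U x q o k) (hs : U k s < o k) (habove : ∀ r < s, o k ≤ U k r)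
    (hd : ¬ IsDecFill (setFill U k s (o k))) :
    ∃ q' o', FwdTrace T U x q' o' (k + 1) ∧ o' (k + 1) = U k s ∧
      Keeps T U q' o' k ∧ q' k + 1 = s := by
  have hpos : 0 < o k := by omega
  -- either the entry above equals `o k`, or the previous column is kept with the same row
  have key : ∃ s', s = s' + 1 ∧ (o k = U k s' ∨ ∃ k', k = k' + 1 ∧ Keeps T U q o k' ∧ s' = q k' ∧
      o k < U k s') := by
    rcases h.new.not_setFill_gt hs hd with ⟨s', rfl, hle⟩ | ⟨k', rfl, hle⟩
    · exact ⟨s', rfl, Or.inl (le_antisymm (habove s' (by omega)) hle)⟩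
    · have hs0 : q k' < s := by
        by_contra hcon
        push Not at hcon
        have h1 := h.new.col_le k' hcon
        rcases h.step k' (by omega) with ⟨ha, _, hb⟩ | ⟨ha, _, hb⟩
        · omega
        · have h2 := h.new.col_lt k' (Nat.lt_of_le_of_lt hcon (Nat.lt_succ_self (q k')))
          rw [ha (q k' + 1)] at h2
          omega
      obtain ⟨s', rfl⟩ : ∃ s', s = s' + 1 := ⟨s - 1, by omega⟩
      refine ⟨s', rfl, ?_⟩
      have h3 := habove s' (by omega)
      have h4 := h.new.row k' s'
      rcases h.step k' (by omega) with hr | hr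
      · exfalso
        obtain ⟨ha, hc, hb⟩ := hr
        rcases (Nat.lt_succ_iff.1 hs0).eq_or_lt with he | hlt
        · subst he
          have := h.old.row k' (q k')
          have := h.beyond (k' + 1) le_rfl (q k')
          omega
        · have h5 := h.old.col_le k' hlt.le
          rw [hc s' (by omega)] at h4
          omega
      · obtain ⟨ha, hc, hb⟩ := hr
        rcases (Nat.lt_succ_iff.1 hs0).eq_or_lt with he | hlt
        · rcases h3.eq_or_lt with h6 | h6
          · exact Or.inl h6
          · exact Or.inr ⟨k', rfl, ⟨ha, hc, hb⟩, he.symm, h6⟩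
        · have h5 := h.old.col_le k' (Nat.succ_le_of_lt hlt)
          rw [ha s'] at h4
          rw [Nat.succ_eq_add_one] at h5
          omega
  obtain ⟨s', rfl, hk⟩ := key
  have hUs : 0 < U k s' := by have := habove s' (by omega); omega
  have hkeep : Keeps T U (Function.update q k s') (Function.update o (k + 1) (U k (s' + 1))) k := by
    refine ⟨h.beyond k le_rfl, ?_, ?_⟩
    · simpa [← h.beyond k le_rfl] using hUs
    · simp [h.beyond k le_rfl]
  refine ⟨Function.update q k s', Function.update o (k + 1) (U k (s' + 1)),
    ⟨h.old, h.new, ?_, fun _ => ?_, fun j hj => ?_, fun j hj => ?_,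
      fun j hj r => h.beyond j (by omega) r⟩, by simp, hkeep, by simp⟩
  · rw [Function.update_of_ne (by omega), h.start]
  · rcases Nat.eq_zero_or_pos k with rfl | hk0
    · rcases hk with hk | ⟨k', hk', _⟩
      · simp [← hk, h.start]
      · omega
    · rw [Function.update_of_ne (by omega)]; exact h.start_eq hk0
  · rcases Nat.lt_succ_iff_lt_or_eq.1 hj with hj | rfl
    · rcases h.step j hj with hs | hs
      · exact Or.inl (hs.congr (fun _ => rfl) (fun _ => rfl) (Function.update_of_ne (by omega) _ _)
          (Function.update_of_ne (by omega) _ _))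
      · exact Or.inr (hs.congr (fun _ => rfl) (fun _ => rfl) (Function.update_of_ne (by omega) _ _)
          (Function.update_of_ne (by omega) _ _))
    · exact Or.inr hkeep
  · rcases Nat.lt_succ_iff_lt_or_eq.1 hj with hj | rfl
    · rcases h.link j hj with hs | hs
      · left
        rw [Function.update_of_ne (by omega), Function.update_of_ne (by omega)]
        exact hs
      · right
        exact hs.congr (fun _ _ _ _ => rfl) (fun _ _ _ _ => rfl)
          (fun i _ _ => Function.update_of_ne (by omega) _ _) (Function.update_of_ne (by omega) _ _)
          (Function.update_of_ne (by omega) _ _)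
    · rcases hk with hk | ⟨k', hk', hkk, hq, hlt⟩
      · left
        rw [Function.update_of_ne (by omega), Function.update_self]; exact hk
      · obtain rfl : k' = j := by omega
        right
        refine ⟨hkk.congr (fun _ => rfl) (fun _ => rfl) (Function.update_of_ne (by omega) _ _)
          (Function.update_of_ne (by omega) _ _), hkeep, ?_, ?_⟩
        · rw [Function.update_self, Function.update_of_ne (by omega), hq]
        · rw [Function.update_self, Function.update_of_ne (by omega), ← h.beyond _ le_rfl]; exact hlt

theorem FwdTrace.finish_replace {T U : ℕ → ℕ → ℕ} {x : ℕ} {q o : ℕ → ℕ} {k : ℕ}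
    (h : FwdTrace T U x q o (k + 1)) (ho : o (k + 1) = 0) (hk : Replaces T U q o k) :
    Trace T U x q o k where
  old := h.old
  new := h.new
  start := h.start
  start_eq := h.start_eq (by omega)
  step j hj := h.step j (by omega)
  link j hj := h.link j (by omega)
  last_eq_zero := ho
  corner := by
    have h1 := h.old.row k (q k)
    have h2 := h.beyond (k + 1) le_rfl (q k)
    have h3 := hk.2.2
    omega
  beyond j hj r := h.beyond j (by omega) r

/-- The insertion stops in column `k`, but its final box is the rightmost one in row `q k`. The
trace is prolonged along this row by kept columns with number `0` and links `KeepsTwo`; the reverse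
insertion from the final box runs back along the same row. -/
theorem FwdTrace.finish_keep {T U : ℕ → ℕ → ℕ} {x : ℕ} {q o : ℕ → ℕ} {k c : ℕ}
    (h : FwdTrace T U x q o (k + 1)) (ho : o (k + 1) = 0) (hk : Keeps T U q o k) (hkc : k ≤ c)
    (hc : 0 < U c (q k)) (hc' : U (c + 1) (q k) = 0) :
    Trace T U x (fun j => if j ≤ k then q j else q k) (fun j => if j ≤ k + 1 then o j else 0) c := by
  have hzero : ∀ j, k ≤ j → T j (q k + 1) = 0 := fun j hj => by
    have h1 := h.old.row_le (q k + 1) hj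
    have h2 := hk.2.2
    omega
  have hkeep : ∀ j, k ≤ j → j ≤ c → Keeps T U (fun j => if j ≤ k then q j else q k)
      (fun j => if j ≤ k + 1 then o j else 0) j := by
    intro j hj hjc
    rcases hj.eq_or_lt with rfl | hj'
    · exact hk.congr (fun _ => rfl) (fun _ => rfl) (by simp) (by simp)
    · refine ⟨h.beyond j hj', ?_, ?_⟩
      · have h1 := h.new.row_le (q k) hjc
        have h2 := h.beyond j hj' (q k)
        simp only [show ¬ j ≤ k by omega, if_false]
        omega
      · simp [show ¬ j ≤ k by omega, hzero j hj]
  refine ⟨h.old, h.new, by simp [h.start], ?_, fun j hj => ?_, fun j hj => ?_, ?_, ?_,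
    fun j hj r => h.beyond j (by omega) r⟩
  · simpa using h.start_eq (by omega)
  · by_cases hjk : k ≤ j
    · exact Or.inr (hkeep j hjk hj)
    · rcases h.step j (by omega) with hs | hs
      · exact Or.inl (hs.congr (fun _ => rfl) (fun _ => rfl) (by simp; omega) (by simp; omega))
      · exact Or.inr (hs.congr (fun _ => rfl) (fun _ => rfl) (by simp; omega) (by simp; omega))
  · by_cases hjk : k ≤ j
    · right
      refine ⟨hkeep j hjk (by omega), hkeep (j + 1) (by omega) (by omega), ?_, ?_⟩
      · simp only [show ¬ j + 1 ≤ k by omega, if_false]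
        split_ifs with h1
        · rw [show j = k by omega]
        · rfl
      · have := (hkeep (j + 1) (by omega) (by omega)).2.1
        refine lt_of_eq_of_lt ?_ this
        dsimp only
        split_ifs with h1
        · rw [show j = k by omega]; exact ho
        · rfl
    · rcases h.link j (by omega) with hs | hs
      · left
        simp only [show j + 1 ≤ k by omega, show j + 1 ≤ k + 1 by omega, if_true]
        exact hs
      · right
        refine hs.congr (fun _ _ _ _ => rfl) (fun _ _ _ _ => rfl) (fun i hi _ => ?_) ?_ ?_
        · rw [if_pos (by omega)]
        · rw [if_pos (by omega)]
        · rw [if_pos (by omega)]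
  · split_ifs with h1
    · rw [show c = k by omega]; exact ho
    · rfl
  · split_ifs with h1
    · rw [show c = k by omega] at hc' ⊢; exact hc'
    · exact hc'

/-! #### Reverse steps -/

theorem RevTrace.init_keep {T : ℕ → ℕ → ℕ} {r c : ℕ} (h : IsDecFill T) (hr : 0 < T c r)
    (hc : T (c + 1) r = 0) (hb : T c (r + 1) = 0) :
    RevTrace T T (fun _ => r) (fun _ => 0) c c :=
  ⟨le_rfl, h, h, fun j h1 h2 => Or.inr ⟨fun _ => rfl, by rwa [le_antisymm h2 h1],
    by rw [le_antisymm h2 h1, hb]⟩, fun j h1 h2 => by omega, rfl, hc, fun _ _ _ => rfl,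
    fun _ _ _ => rfl⟩

theorem IsDecFill.remove {T : ℕ → ℕ → ℕ} {r c : ℕ} (h : IsDecFill T)
    (hc : T (c + 1) r = 0) (hb : T c (r + 1) = 0) : IsDecFill (setFill T c r 0) := by
  refine ⟨fun j s => ?_, fun j s => ?_⟩
  · have := h.row j s
    simp only [setFill]
    split_ifs with ha hb hb
    · omega
    · omega
    · obtain ⟨rfl, rfl⟩ := hb; omega
    · omega
  · have := h.col j s
    simp only [setFill]
    split_ifs with ha hb hb
    · omega
    · omega
    · obtain ⟨rfl, rfl⟩ := hb; omega
    · omega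

/-- Removing the box is read as undoing the replacement of the value `0`. -/
theorem RevTrace.init_replace {T : ℕ → ℕ → ℕ} {r c : ℕ} (h : IsDecFill T) (hr : 0 < T c r)
    (hc : T (c + 1) r = 0) (hb : T c (r + 1) = 0) :
    RevTrace (setFill T c r 0) T (fun _ => r) (fun _ => 0) c c :=
  ⟨le_rfl, h.remove hc hb, h, fun j h1 h2 => Or.inl (by
      rw [le_antisymm h2 h1]
      exact ⟨by simpa [setFill_self] using hr, fun s hs => (setFill_of_ne _ _ (Or.inr hs)).symm,
        by simp [setFill_self]⟩),
    fun j h1 h2 => by omega, rfl, hc, fun _ hj _ => (setFill_of_ne _ _ (Or.inl hj.ne')).symm,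
    fun _ hj _ => setFill_of_ne _ _ (Or.inl hj.ne)⟩

theorem RevTrace.replace {U T' : ℕ → ℕ → ℕ} {q o : ℕ → ℕ} {k c s : ℕ}
    (h : RevTrace U T' q o (k + 1) c) (hs : T' (k + 1) (q (k + 1)) < U k s)
    (hd : IsDecFill (setFill U k s (T' (k + 1) (q (k + 1))))) :
    ∃ q' o', RevTrace (setFill U k s (T' (k + 1) (q (k + 1)))) T' q' o' k c ∧ q' k = s ∧
      q' c = q c ∧
      (Replaces U T' q o c ↔ Replaces (setFill U k s (T' (k + 1) (q (k + 1)))) T' q' o' c) := by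
  set y := T' (k + 1) (q (k + 1)) with hy
  have hle := h.le
  have hne : ∀ j, j ≠ k → ∀ r, setFill U k s y j r = U j r :=
    fun j hj r => setFill_of_ne _ _ (Or.inl hj)
  have hrep : Replaces (setFill U k s y) T' (Function.update q k s) (Function.update o (k + 1) y) k := by
    refine ⟨?_, fun r hr => ?_, ?_⟩
    · simpa [setFill_self, ← h.before k (Nat.lt_succ_self k)] using hs
    · simp only [Function.update_self] at hr
      rw [setFill_of_ne _ _ (Or.inr hr), h.before k (by omega)]
    · simp [setFill_self]
  refine ⟨Function.update q k s, Function.update o (k + 1) y,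
    ⟨by omega, hd, h.new, fun j hj hjc => ?_, fun j hj hjc => ?_, ?_, ?_, fun j hj r => ?_,
      fun j hj r => ?_⟩, by simp, Function.update_of_ne (by omega) _ _, ?_⟩
  · rcases hj.eq_or_lt with rfl | hj
    · exact Or.inl hrep
    · rcases h.step j (by omega) hjc with hs | hs
      · exact Or.inl (hs.congr (hne j (by omega)) (fun _ => rfl) (Function.update_of_ne (by omega) _ _)
          (Function.update_of_ne (by omega) _ _))
      · exact Or.inr (hs.congr (hne j (by omega)) (fun _ => rfl) (Function.update_of_ne (by omega) _ _)
          (Function.update_of_ne (by omega) _ _))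
  · rcases hj.eq_or_lt with rfl | hj
    · left
      rw [Function.update_self, Function.update_of_ne (by omega)]
    · rcases h.link j (by omega) hjc with hs | hs
      · left
        rw [Function.update_of_ne (by omega), Function.update_of_ne (by omega)]
        exact hs
      · right
        exact hs.congr (fun i r _ _ => hne i (by omega) r) (fun _ _ _ _ => rfl)
          (fun i _ _ => Function.update_of_ne (by omega) _ _) (Function.update_of_ne (by omega) _ _)
          (Function.update_of_ne (by omega) _ _)
  · rw [Function.update_of_ne (by omega), h.last_eq_zero]
  · rw [Function.update_of_ne (by omega), h.corner]
  · rw [hne j (by omega), h.beyond j hj]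
  · rw [hne j (by omega), h.before j (by omega)]
  · constructor
    · exact fun hs => hs.congr (hne c (by omega)) (fun _ => rfl) (Function.update_of_ne (by omega) _ _)
          (Function.update_of_ne (by omega) _ _)
    · exact fun hs => hs.congr (fun r => (hne c (by omega) r).symm) (fun _ => rfl)
          (Function.update_of_ne (by omega) _ _).symm (Function.update_of_ne (by omega) _ _).symm

/-- The mirror image of `FwdTrace.keep`: a decrease is blocked by the entry below, which then equals
the number read from column `k + 1`, or by the right neighbour, and this forces column `k + 1` to be
kept with the same row `s`. -/
theorem RevTrace.keep {U T' : ℕ → ℕ → ℕ} {q o : ℕ → ℕ} {k c s : ℕ}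
    (h : RevTrace U T' q o (k + 1) c) (hs : T' (k + 1) (q (k + 1)) < U k s)
    (hbelow : U k (s + 1) ≤ T' (k + 1) (q (k + 1)))
    (hd : ¬ IsDecFill (setFill U k s (T' (k + 1) (q (k + 1))))) :
    ∃ q' o', RevTrace U T' q' o' k c ∧ q' k = s ∧ q' c = q c ∧
      (Replaces U T' q o c ↔ Replaces U T' q' o' c) := by
  have hpos : 0 < T' (k + 1) (q (k + 1)) := by
    rcases h.step (k + 1) le_rfl h.le with hr | hr
    · have := hr.1; omega
    · rw [hr.1]; exact hr.2.1
  set y := T' (k + 1) (q (k + 1)) with hy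
  have hle := h.le
  have key : U k (s + 1) = y ∨ (U k (s + 1) < y ∧ Keeps U T' q o (k + 1) ∧ q (k + 1) = s) := by
    rcases hbelow.eq_or_lt with he | hlt
    · exact Or.inl he
    · right
      rcases h.old.not_setFill_lt hs hpos hd with h1 | h1
      · omega
      · refine ⟨hlt, ?_⟩
        have hq : q (k + 1) ≤ s := by
          by_contra hcon
          push Not at hcon
          have h2 := h.new.row k (q (k + 1))
          have h3 := h.new.col_le k (Nat.succ_le_of_lt hcon)
          have h4 := h.before k (by omega) (s + 1)
          rw [Nat.succ_eq_add_one] at h3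
          omega
        rcases h.step (k + 1) le_rfl h.le with hr | hr
        · exfalso
          have h2 := h.old.col_le (k + 1) hq
          have := hr.1
          omega
        · refine ⟨hr, ?_⟩
          by_contra hcon
          have h2 := h.old.col_lt (k + 1) (lt_of_le_of_ne hq hcon)
          have := hr.1 (q (k + 1))
          omega
  have hUs : 0 < U k s := by omega
  have hkeep : Keeps U T' (Function.update q k s) (Function.update o (k + 1) (U k (s + 1))) k := by
    refine ⟨fun r => (h.before k (by omega) r).symm, ?_, ?_⟩
    · simpa using hUs
    · simp
  refine ⟨Function.update q k s, Function.update o (k + 1) (U k (s + 1)),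
    ⟨by omega, h.old, h.new, fun j hj hjc => ?_, fun j hj hjc => ?_, ?_, ?_, h.beyond,
      fun j hj r => h.before j (by omega) r⟩, by simp, Function.update_of_ne (by omega) _ _, ?_⟩
  · rcases hj.eq_or_lt with rfl | hj
    · exact Or.inr hkeep
    · rcases h.step j (by omega) hjc with hs | hs
      · exact Or.inl (hs.congr (fun _ => rfl) (fun _ => rfl) (Function.update_of_ne (by omega) _ _)
          (Function.update_of_ne (by omega) _ _))
      · exact Or.inr (hs.congr (fun _ => rfl) (fun _ => rfl) (Function.update_of_ne (by omega) _ _)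
          (Function.update_of_ne (by omega) _ _))
  · rcases hj.eq_or_lt with rfl | hj
    · rcases key with hk | ⟨hlt, hkk, hq⟩
      · left
        rw [Function.update_self, Function.update_of_ne (by omega)]; exact hk
      · right
        refine ⟨hkeep, hkk.congr (fun _ => rfl) (fun _ => rfl) (Function.update_of_ne (by omega) _ _)
          (Function.update_of_ne (by omega) _ _), ?_, ?_⟩
        · rw [Function.update_self, Function.update_of_ne (by omega), hq]
        · rw [Function.update_self, Function.update_of_ne (by omega), ← hkk.1]; exact hlt
    · rcases h.link j (by omega) hjc with hs | hs
      · left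
        rw [Function.update_of_ne (by omega), Function.update_of_ne (by omega)]
        exact hs
      · right
        exact hs.congr (fun _ _ _ _ => rfl) (fun _ _ _ _ => rfl)
          (fun i _ _ => Function.update_of_ne (by omega) _ _) (Function.update_of_ne (by omega) _ _)
          (Function.update_of_ne (by omega) _ _)
  · rw [Function.update_of_ne (by omega), h.last_eq_zero]
  · rw [Function.update_of_ne (by omega), h.corner]
  · constructor
    · exact fun hs => hs.congr (fun _ => rfl) (fun _ => rfl) (Function.update_of_ne (by omega) _ _)
          (Function.update_of_ne (by omega) _ _)
    · exact fun hs => hs.congr (fun _ => rfl) (fun _ => rfl)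
          (Function.update_of_ne (by omega) _ _).symm (Function.update_of_ne (by omega) _ _).symm

/-- A `RevTrace` does not constrain the number entering column `0`, so it can be set to the output
of the reverse insertion. -/
theorem RevTrace.finish {U T' : ℕ → ℕ → ℕ} {q o : ℕ → ℕ} {c : ℕ} (h : RevTrace U T' q o 0 c) :
    Trace U T' (T' 0 (q 0)) q (Function.update o 0 (T' 0 (q 0))) c where
  old := h.old
  new := h.new
  start := by simp
  start_eq := rfl
  step j hj := by
    rcases h.step j (by omega) hj with hs | hs
    · exact Or.inl (hs.congr (fun _ => rfl) (fun _ => rfl) rfl (Function.update_of_ne (by omega) _ _))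
    · exact Or.inr (hs.congr (fun _ => rfl) (fun _ => rfl) rfl (Function.update_of_ne (by omega) _ _))
  link j hj := by
    rcases h.link j (by omega) hj with hs | hs
    · left
      rw [Function.update_of_ne (by omega)]; exact hs
    · exact Or.inr (hs.congr (fun _ _ _ _ => rfl) (fun _ _ _ _ => rfl) (fun _ _ _ => rfl)
        (Function.update_of_ne (by omega) _ _) (Function.update_of_ne (by omega) _ _))
  last_eq_zero := by rw [Function.update_of_ne (by omega)]; exact h.last_eq_zero
  corner := h.corner
  beyond := h.beyond

/-! #### Uniqueness of traces -/

/-- The numbers of an insertion are at most those of the reverse insertion. -/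
theorem Trace.le {T T' : ℕ → ℕ → ℕ} {x : ℕ} {q o : ℕ → ℕ} {c : ℕ} (h : Trace T T' x q o c)
    {j : ℕ} (hj : j ≤ c) : o j ≤ T' j (q j) := by
  rcases j with _ | j
  · rw [h.start, h.start_eq]
  · rcases h.link j (by omega) with h1 | ⟨h1, h2, h3, h4⟩
    · exact h1.le
    · rw [h2.1]; exact h4.le

/-- An unequal pair of numbers of the insertion and of the reverse insertion. -/
theorem Trace.keepsTwo {T T' : ℕ → ℕ → ℕ} {x : ℕ} {q o : ℕ → ℕ} {c : ℕ} (h : Trace T T' x q o c)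
    {j : ℕ} (hj : j ≤ c) (hne : o j ≠ T' j (q j)) : ∃ i, j = i + 1 ∧ KeepsTwo T T' q o i := by
  rcases j with _ | j
  · exact absurd (h.start.trans h.start_eq) hne
  · rcases h.link j (by omega) with h1 | h1
    · exact absurd h1 hne
    · exact ⟨j, rfl, h1⟩

/-- Unequal numbers occur only in front of the second of two kept columns. -/
theorem Trace.eq_of_replaces {T T' : ℕ → ℕ → ℕ} {x : ℕ} {q o : ℕ → ℕ} {c : ℕ}
    (h : Trace T T' x q o c) {j : ℕ} (hj : j ≤ c) (hr : Replaces T T' q o j) :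
    o j = T' j (q j) := by
  by_contra hne
  obtain ⟨i, rfl, hk⟩ := h.keepsTwo hj hne
  have := hk.2.1.1 (q (i + 1))
  have := hr.1
  omega

theorem Trace.pos {T T' : ℕ → ℕ → ℕ} {x : ℕ} {q o : ℕ → ℕ} {c : ℕ} (h : Trace T T' x q o c)
    {j : ℕ} (hj : j ≤ c) : 0 < T' j (q j) := by
  rcases h.step j hj with hr | hr
  · have := hr.1; omega
  · rw [hr.1]; exact hr.2.1

/-- The output of a column is an entry of this column, less than the number inserted. -/
theorem Trace.next_lt {T T' : ℕ → ℕ → ℕ} {x : ℕ} {q o : ℕ → ℕ} {c : ℕ} (h : Trace T T' x q o c)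
    {j : ℕ} (hj : j ≤ c) : o (j + 1) < o j ∨ o (j + 1) = 0 := by
  rcases h.step j hj with hr | hr
  · have h1 := h.eq_of_replaces hj hr
    have h2 := hr.1
    have h3 := hr.2.2
    omega
  · by_cases he : o j = T' j (q j)
    · have h2 := h.old.col j (q j)
      have h3 := hr.1 (q j)
      have h4 := hr.2.2
      omega
    · obtain ⟨i, rfl, hk⟩ := h.keepsTwo hj he
      obtain ⟨h1, h2, h3, h4⟩ := hk
      have h5 := h.old.row i (q i + 1)
      have h6 := hr.2.2
      have h7 := h1.2.2
      rw [h3] at h6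
      omega

/-- An insertion determines its result. -/
theorem Trace.unique_forward {T T₁ T₂ : ℕ → ℕ → ℕ} {x : ℕ} {q₁ o₁ q₂ o₂ : ℕ → ℕ} {c₁ c₂ : ℕ}
    (h₁ : Trace T T₁ x q₁ o₁ c₁) (h₂ : Trace T T₂ x q₂ o₂ c₂) :
    T₁ = T₂ ∧ c₁ = c₂ ∧ q₁ c₁ = q₂ c₂ := by
  -- With equal inputs and equal results on the left, one trace cannot replace where the other
  -- keeps. Keeping needs either the input as an entry of the column above row `q₁ j`, or an entry
  -- on the left that blocks; both contradict that `T₁` is decreasing.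
  have aux : ∀ {T T₁ T₂ : ℕ → ℕ → ℕ} {x : ℕ} {q₁ o₁ q₂ o₂ : ℕ → ℕ} {c₁ c₂ : ℕ}
      (_ : Trace T T₁ x q₁ o₁ c₁) (_ : Trace T T₂ x q₂ o₂ c₂) (j : ℕ), j ≤ c₁ → j ≤ c₂ →
      0 < o₁ j → o₁ j = o₂ j → (∀ i < j, ∀ r, T₁ i r = T₂ i r) → Replaces T T₁ q₁ o₁ j →
      Keeps T T₂ q₂ o₂ j → False := by
    intro T T₁ T₂ x q₁ o₁ q₂ o₂ c₁ c₂ h₁ h₂ j hj1 hj2 hpos ho hlt hr hk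
    have e1 := h₁.eq_of_replaces hj1 hr
    have e2 := h₂.le hj2
    rw [hk.1] at e2
    have hq : q₂ j < q₁ j := by
      by_contra hcon
      push Not at hcon
      have := h₁.old.col_le j hcon
      have := hr.1
      omega
    have h3 := hr.2.1 (q₂ j) hq.ne
    have h4 := h₁.new.col_lt j hq
    by_cases he : o₂ j = T₂ j (q₂ j)
    · rw [hk.1] at he; omega
    · obtain ⟨i, rfl, hk1, hk2, hqq, hll⟩ := h₂.keepsTwo hj2 he
      have h5 := h₁.new.row_le (q₁ (i + 1)) (Nat.le_succ i)
      have h6 := h₁.new.row i (q₁ (i + 1))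
      have h7 := h₁.new.col_le i (Nat.succ_le_of_lt hq)
      rw [Nat.succ_eq_add_one, hlt i (by omega), hlt i (by omega), hqq, hk1.1 (q₂ i + 1)] at h7
      have h8 := hk1.2.2
      rw [hlt i (by omega)] at h6
      omega
  -- The output is the first entry from the top that is less than the input: it is in row `q j` if
  -- replaced, in row `q j + 1` if the column is kept.
  have keyq : ∀ {T T' : ℕ → ℕ → ℕ} {x : ℕ} {q o : ℕ → ℕ} {c : ℕ} (_ : Trace T T' x q o c)
      (j : ℕ), j ≤ c → 0 < o j → (Replaces T T' q o j → T j (q j) < o j ∧ ∀ r < q j, o j ≤ T j r) ∧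
      (Keeps T T' q o j → T j (q j + 1) < o j ∧ ∀ r < q j + 1, o j ≤ T j r) := by
    intro T T' x q o c h j hj hpos
    refine ⟨fun hr => ⟨by rw [h.eq_of_replaces hj hr]; exact hr.1, fun r hrq => ?_⟩,
      fun hk => ⟨?_, fun r hrq => ?_⟩⟩
    · rw [← hr.2.1 r hrq.ne]; exact (h.le hj).trans (h.new.col_le j hrq.le)
    · have := h.next_lt hj
      have := hk.2.2
      omega
    · rw [← hk.1 r]; exact (h.le hj).trans (h.new.col_le j (Nat.lt_succ_iff.1 hrq))
  have claim : ∀ j, j ≤ c₁ + 1 → j ≤ c₂ + 1 →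
      o₁ j = o₂ j ∧ ∀ i < j, (∀ r, T₁ i r = T₂ i r) ∧ q₁ i = q₂ i := by
    intro j
    induction j with
    | zero => intro _ _; exact ⟨h₁.start.trans h₂.start.symm, by simp⟩
    | succ j ih =>
      intro hj1 hj2
      obtain ⟨ho, hi⟩ := ih (by omega) (by omega)
      have hj1' : j ≤ c₁ := by omega
      have hj2' : j ≤ c₂ := by omega
      suffices hh : o₁ (j + 1) = o₂ (j + 1) ∧ (∀ r, T₁ j r = T₂ j r) ∧ q₁ j = q₂ j by
        refine ⟨hh.1, fun i hij => ?_⟩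
        rcases Nat.lt_succ_iff_lt_or_eq.1 hij with h | rfl
        · exact hi i h
        · exact hh.2
      -- Input `0` is less than the number read backwards, so the link is `KeepsTwo`: the column
      -- does not change and its row is that of the previous column.
      rcases Nat.eq_zero_or_pos (o₁ j) with hz | hpos
      · have hz2 : o₂ j = 0 := by omega
        have p1 := h₁.pos hj1'
        have p2 := h₂.pos hj2'
        obtain ⟨i, rfl, k1, k2, k3, k4⟩ := h₁.keepsTwo hj1' (by omega)
        obtain ⟨i', hi', l1, l2, l3, l4⟩ := h₂.keepsTwo hj2' (by omega)
        obtain rfl : i = i' := by omega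
        have n1 := h₁.next_lt hj1'
        have n2 := h₂.next_lt hj2'
        refine ⟨by omega, fun r => (k2.1 r).trans (l2.1 r).symm, ?_⟩
        rw [k3, l3]; exact (hi i (by omega)).2
      · have g1 := keyq h₁ j hj1' hpos
        have g2 := keyq h₂ j hj2' (by omega)
        have e1 := h₁.step j hj1'
        have e2 := h₂.step j hj2'
        have uniq : ∀ s t, T j s < o₁ j → (∀ r < s, o₁ j ≤ T j r) → T j t < o₁ j →
            (∀ r < t, o₁ j ≤ T j r) → s = t := by
          intro s t a1 a2 b1 b2
          rcases lt_trichotomy s t with h | h | h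
          · have := b2 s h; omega
          · exact h
          · have := a2 t h; omega
        rw [← ho] at g2
        rcases e1 with e1 | e1 <;> rcases e2 with e2 | e2
        · have hq := uniq _ _ (g1.1 e1).1 (g1.1 e1).2 (g2.1 e2).1 (g2.1 e2).2
          refine ⟨by rw [e1.2.2, e2.2.2, hq], fun r => ?_, hq⟩
          by_cases hrq : r = q₁ j
          · have := h₁.eq_of_replaces hj1' e1
            have := h₂.eq_of_replaces hj2' e2
            rw [hrq]; rw [← hq] at this; omega
          · rw [e1.2.1 r hrq, e2.2.1 r (by omega)]
        · exact (aux h₁ h₂ j hj1' hj2' hpos ho (fun i hij => (hi i hij).1) e1 e2).elim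
        · exact (aux h₂ h₁ j hj2' hj1' (by omega) ho.symm
            (fun i hij r => ((hi i hij).1 r).symm) e2 e1).elim
        · have hq := uniq _ _ (g1.2 e1).1 (g1.2 e1).2 (g2.2 e2).1 (g2.2 e2).2
          refine ⟨by rw [e1.2.2, e2.2.2, hq], fun r => ?_, by omega⟩
          rw [e1.1, e2.1]
  -- If one trace stopped earlier, the other would continue with number `0` along the row of its
  -- final box, through a box that is absent by `corner`.
  have hc : ∀ {T₁ T₂ : ℕ → ℕ → ℕ} {q₁ o₁ q₂ o₂ : ℕ → ℕ} {c₁ c₂ : ℕ}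
      (_ : Trace T T₁ x q₁ o₁ c₁) (_ : Trace T T₂ x q₂ o₂ c₂)
      (_ : ∀ j, j ≤ c₁ + 1 → j ≤ c₂ + 1 →
      o₁ j = o₂ j ∧ ∀ i < j, (∀ r, T₁ i r = T₂ i r) ∧ q₁ i = q₂ i), ¬ c₁ < c₂ := by
    intro T₁ T₂ q₁ o₁ q₂ o₂ c₁ c₂ h₁ h₂ cl hlt
    have h3 := cl (c₁ + 1) le_rfl (by omega)
    have h4 := h₁.last_eq_zero
    have h5 := h₂.pos (j := c₁ + 1) (by omega)
    obtain ⟨i, hi, k1, k2, k3, k4⟩ := h₂.keepsTwo (j := c₁ + 1) (by omega) (by omega)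
    obtain rfl : c₁ = i := by omega
    have h6 := h₁.corner
    have h7 := h₁.beyond (c₁ + 1) (by omega) (q₁ c₁)
    have h8 := (h3.2 c₁ (by omega)).2
    rw [k3, ← h8, k2.1] at h5
    omega
  have hcc : c₁ = c₂ := by
    rcases lt_trichotomy c₁ c₂ with h | h | h
    · exact (hc h₁ h₂ claim h).elim
    · exact h
    · exact (hc h₂ h₁ (fun j a b => ⟨(claim j b a).1.symm, fun i hi =>
        ⟨fun r => (((claim j b a).2 i hi).1 r).symm, ((claim j b a).2 i hi).2.symm⟩⟩) h).elim
  subst hcc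
  refine ⟨?_, rfl, ((claim (c₁ + 1) le_rfl le_rfl).2 c₁ (by omega)).2⟩
  funext j r
  by_cases hj : j ≤ c₁
  · exact ((claim (c₁ + 1) le_rfl le_rfl).2 j (by omega)).1 r
  · rw [h₁.beyond j (by omega), h₂.beyond j (by omega)]

/-- A reverse insertion determines its result. -/
theorem Trace.unique_reverse {T₁ T₂ T' : ℕ → ℕ → ℕ} {x₁ x₂ : ℕ} {q₁ o₁ q₂ o₂ : ℕ → ℕ} {c : ℕ}
    (h₁ : Trace T₁ T' x₁ q₁ o₁ c) (h₂ : Trace T₂ T' x₂ q₂ o₂ c) (hq : q₁ c = q₂ c)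
    (hα : Replaces T₁ T' q₁ o₁ c ↔ Replaces T₂ T' q₂ o₂ c) : T₁ = T₂ ∧ x₁ = x₂ := by
  have excl : ∀ {T T' : ℕ → ℕ → ℕ} {q o : ℕ → ℕ} {j : ℕ}, Replaces T T' q o j →
      Keeps T T' q o j → False := by
    intro T T' q o j hr hk
    have := hr.1
    have := hk.1 (q j)
    omega
  -- If column `j` is replaced, the number read backwards is the old entry `T₁ j (q₁ j)`. It exceeds
  -- the entry below and the right neighbour in `T₁`, whereas a kept column needs equality with one
  -- of these two.
  have aux : ∀ {T₁ T₂ T' : ℕ → ℕ → ℕ} {x₁ x₂ : ℕ} {q₁ o₁ q₂ o₂ : ℕ → ℕ} {c : ℕ}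
      (_ : Trace T₁ T' x₁ q₁ o₁ c) (_ : Trace T₂ T' x₂ q₂ o₂ c) (j : ℕ), j < c →
      q₁ j = q₂ j → q₁ (j + 1) = q₂ (j + 1) → (∀ r, T₁ (j + 1) r = T₂ (j + 1) r) →
      Replaces T₁ T' q₁ o₁ j → Keeps T₂ T' q₂ o₂ j → False := by
    intro T₁ T₂ T' x₁ x₂ q₁ o₁ q₂ o₂ c h₁ h₂ j hj hq0 hq1 hT hr hk
    have e1 : o₁ (j + 1) = T' (j + 1) (q₁ (j + 1)) := by
      rcases h₁.link j hj with e | e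
      · exact e
      · exact (excl hr e.1).elim
    have p := h₂.pos (j := j + 1) (by omega)
    have a1 := h₁.old.row j (q₁ j)
    have a2 := h₁.old.col j (q₁ j)
    have a3 := hr.2.1 (q₁ j + 1) (by omega)
    have a4 := hr.2.2
    have a5 := hk.1 (q₁ j + 1)
    have a6 := hk.2.2
    rw [← hq0] at a6
    rcases h₂.link j hj with e | e
    · rw [← hq1] at e p
      omega
    · obtain ⟨-, k2, k3, k4⟩ := e
      rw [← hT, k3, ← hq0] at k4
      have b1 := k2.1 (q₂ (j + 1))
      rw [← hT, k3, ← hq0] at b1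
      rw [hq1, k3, ← hq0] at e1
      omega
  have claim : ∀ d, d ≤ c → q₁ (c - d) = q₂ (c - d) ∧ ∀ r, T₁ (c - d) r = T₂ (c - d) r := by
    intro d
    induction d with
    | zero =>
      intro _
      refine ⟨hq, ?_⟩
      rw [Nat.sub_zero]
      rcases h₁.step c le_rfl with e1 | e1 <;> rcases h₂.step c le_rfl with e2 | e2
      · intro r
        by_cases hr : r = q₁ c
        · have a1 := e1.2.2
          have a2 := e2.2.2
          rw [h₁.last_eq_zero] at a1
          rw [h₂.last_eq_zero] at a2
          rw [hr, ← a1, hq, ← a2]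
        · rw [← e1.2.1 r hr, ← e2.2.1 r (by omega)]
      · exact (excl (hα.1 e1) e2).elim
      · exact (excl (hα.2 e2) e1).elim
      · intro r
        rw [← e1.1, ← e2.1]
    | succ d ih =>
      intro hd
      obtain ⟨ih1, ih2⟩ := ih (by omega)
      set j := c - (d + 1) with hj
      have hjc : c - d = j + 1 := by omega
      rw [hjc] at ih1 ih2
      -- Row `q j` is that of the smallest entry of `T'` in column `j` greater than the number read
      -- from column `j + 1`, so the rows are found from `T'` alone, going left.
      have g : ∀ {T T' : ℕ → ℕ → ℕ} {x : ℕ} {q o : ℕ → ℕ} {c : ℕ} (_ : Trace T T' x q o c),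
          j < c → T' (j + 1) (q (j + 1)) < T' j (q j) ∧
            T' j (q j + 1) ≤ T' (j + 1) (q (j + 1)) := by
        intro T T' x q o c h hj
        have p := h.pos (j := j + 1) (by omega)
        rcases h.link j hj with e | ⟨k1, k2, k3, k4⟩
        · rcases h.step j hj.le with s | s
          · have a1 := s.1
            have a2 := s.2.2
            have a3 := s.2.1 (q j + 1) (by omega)
            have a4 := h.old.col j (q j)
            omega
          · have a1 := s.1 (q j)
            have a2 := s.2.2
            have a3 := s.1 (q j + 1)
            have a4 := h.old.col j (q j)
            omega
        · have a1 := h.new.row j (q j)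
          have a2 := k1.2.2
          have a3 := k1.1 (q j + 1)
          have a4 := k2.1 (q (j + 1))
          rw [k3] at p a4 k4 ⊢
          omega
      have g1 := g h₁ (by omega)
      have g2 := g h₂ (by omega)
      rw [← ih1] at g2
      have hqj : q₁ j = q₂ j := by
        rcases lt_trichotomy (q₁ j) (q₂ j) with h | h | h
        · have := h₁.new.col_le j (Nat.succ_le_of_lt h); rw [Nat.succ_eq_add_one] at this; omega
        · exact h
        · have := h₁.new.col_le j (Nat.succ_le_of_lt h); rw [Nat.succ_eq_add_one] at this; omega
      refine ⟨hqj, ?_⟩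
      rcases h₁.step j (by omega) with e1 | e1 <;> rcases h₂.step j (by omega) with e2 | e2
      · intro r
        by_cases hr : r = q₁ j
        · have a1 := e1.2.2
          have a2 := e2.2.2
          have b1 : o₁ (j + 1) = T' (j + 1) (q₁ (j + 1)) := by
            rcases h₁.link j (by omega) with e | e
            · exact e
            · exact (excl e1 e.1).elim
          have b2 : o₂ (j + 1) = T' (j + 1) (q₂ (j + 1)) := by
            rcases h₂.link j (by omega) with e | e
            · exact e
            · exact (excl e2 e.1).elim
          rw [hr, ← a1, hqj, ← a2, b1, b2, ih1]
        · rw [← e1.2.1 r hr, ← e2.2.1 r (by omega)]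
      · exact (aux h₁ h₂ j (by omega) hqj ih1 ih2 e1 e2).elim
      · exact (aux h₂ h₁ j (by omega) hqj.symm ih1.symm (fun r => (ih2 r).symm) e2 e1).elim
      · intro r
        rw [← e1.1, ← e2.1]
  refine ⟨?_, ?_⟩
  · funext j r
    by_cases hj : j ≤ c
    · have := (claim (c - j) (by omega)).2 r
      rwa [show c - (c - j) = j by omega] at this
    · rw [← h₁.beyond j (by omega), ← h₂.beyond j (by omega)]
  · have := (claim c le_rfl).1
    rw [Nat.sub_self] at this
    rw [h₁.start_eq, h₂.start_eq, this]

/-! #### Consecutive insertions -/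

/-- The output of a column, as an entry of this column. -/
theorem Trace.next_eq {T T' : ℕ → ℕ → ℕ} {x : ℕ} {q o : ℕ → ℕ} {c : ℕ} (h : Trace T T' x q o c)
    {j : ℕ} (hj : j ≤ c) : ∃ s, o (j + 1) = T j s := by
  rcases h.step j hj with hr | hr
  · exact ⟨_, hr.2.2⟩
  · exact ⟨_, hr.2.2⟩

/-- The entry `T' j (q j)` left by the first insertion separates the outputs: it exceeds `o (j +
1)`, and it is less than `o₂ j`, so that the second output is at least this entry. -/
theorem Trace.lt_next {T T' T'' : ℕ → ℕ → ℕ} {x y : ℕ} {q o q₂ o₂ : ℕ → ℕ} {c c₂ : ℕ}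
    (h₁ : Trace T T' x q o c) (h₂ : Trace T' T'' y q₂ o₂ c₂) {j : ℕ} (hj : j ≤ c) (hj₂ : j ≤ c₂)
    (hlt : o j < o₂ j) : o (j + 1) < o₂ (j + 1) := by
  have z2 := h₂.le hj₂
  -- the case in which the first insertion and its reverse differ
  have diff : ∀ i, j = i + 1 → KeepsTwo T T' q o i → T' j (q j) < o₂ j := by
    rintro i rfl ⟨k1, k2, k3, k4⟩
    obtain ⟨s, hs⟩ := h₂.next_eq (j := i) (by omega)
    have a1 := k1.2.2
    have a2 := k1.1 (q i + 1)
    have hsq : s < q i + 1 := by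
      by_contra hcon
      push Not at hcon
      have := h₁.new.col_le i hcon
      omega
    have a3 := h₁.new.col_le i (Nat.lt_succ_iff.1 hsq)
    have a4 := h₁.new.row i (q i)
    have a5 := h₁.pos hj
    rw [k3] at a5 ⊢
    omega
  have hz : T' j (q j) < o₂ j := by
    by_cases he : o j = T' j (q j)
    · omega
    · obtain ⟨i, hi, hk⟩ := h₁.keepsTwo hj he
      exact diff i hi hk
  have p := h₁.pos hj
  have n1 : o (j + 1) < T' j (q j) := by
    rcases h₁.step j hj with hr | hr
    · rw [hr.2.2]; exact hr.1
    · have a1 := h₁.old.col j (q j)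
      have a2 := hr.1 (q j)
      have a3 := hr.2.1
      have a4 := hr.2.2
      omega
  refine n1.trans_le ?_
  rcases h₂.step j hj₂ with hr | hr
  · rw [hr.2.2]
    refine h₁.new.col_le j ?_
    by_contra hcon
    push Not at hcon
    have a1 := hr.2.1 _ hcon.ne
    have a2 := h₂.new.col_le j hcon.le
    omega
  · rw [hr.2.2]
    refine h₁.new.col_le j ?_
    by_contra hcon
    push Not at hcon
    have a1 := hr.1 (q₂ j)
    have a2 := h₁.new.col_le j (Nat.lt_succ_iff.1 hcon)
    omega

/-- The second output, if positive, is an entry of `T'` less than `T' j (q j)`. So it lies strictly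
below row `q j`, where the entries are at most `o (j + 1)`. -/
theorem Trace.next_le {T T' T'' : ℕ → ℕ → ℕ} {x y : ℕ} {q o q₂ o₂ : ℕ → ℕ} {c c₂ : ℕ}
    (h₁ : Trace T T' x q o c) (h₂ : Trace T' T'' y q₂ o₂ c₂) {j : ℕ} (hj : j ≤ c) (hj₂ : j ≤ c₂)
    (hle : o₂ j ≤ o j) : o₂ (j + 1) ≤ o (j + 1) := by
  have n2 := h₂.next_lt hj₂
  obtain ⟨s, hs⟩ := h₂.next_eq hj₂
  have z1 := h₁.le hj
  rcases n2 with n2 | n2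
  · have hsq : q j < s := by
      by_contra hcon
      push Not at hcon
      have := h₁.new.col_le j hcon
      omega
    rcases h₁.step j hj with hr | hr
    · rw [hs, hr.2.2, hr.2.1 s hsq.ne']
      exact h₁.old.col_le j hsq.le
    · rw [hs, hr.2.2, hr.1]
      exact h₁.old.col_le j hsq
  · omega

theorem Trace.bottom {T T' : ℕ → ℕ → ℕ} {x : ℕ} {q o : ℕ → ℕ} {c : ℕ} (h : Trace T T' x q o c) :
    T' c (q c + 1) = 0 := by
  have h0 := h.last_eq_zero
  rcases h.step c le_rfl with hr | hr
  · rw [hr.2.1 _ (by omega)]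
    have := h.old.col c (q c)
    have := hr.2.2
    omega
  · rw [hr.1, ← hr.2.2, h0]

/-- The final box of the second of two consecutive insertions is in a column strictly to the right
of that of the first one if and only if the second number is larger. -/
theorem Trace.lt_iff {T T' T'' : ℕ → ℕ → ℕ} {x y : ℕ} {q o q₂ o₂ : ℕ → ℕ} {c c₂ : ℕ}
    (h₁ : Trace T T' x q o c) (h₂ : Trace T' T'' y q₂ o₂ c₂) : c < c₂ ↔ x < y := by
  constructor
  · intro hc
    by_contra hxy
    push Not at hxy
    have key : ∀ j, j ≤ c + 1 → o₂ j ≤ o j := by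
      intro j
      induction j with
      | zero => intro _; rw [h₁.start, h₂.start]; exact hxy
      | succ j ih => intro hj; exact h₁.next_le h₂ (by omega) (by omega) (ih (by omega))
    have h3 := key (c + 1) le_rfl
    rw [h₁.last_eq_zero] at h3
    have p := h₂.pos (j := c + 1) hc
    -- With number `0` the second trace can leave column `c` only along the row of its bottom box.
    -- This is row `q c`, which by `corner` does not reach column `c + 1`.
    obtain ⟨i, hi, k1, k2, k3, k4⟩ := h₂.keepsTwo (j := c + 1) hc (by omega)
    obtain rfl : c = i := by omega
    have a1 := h₁.bottom
    have a2 := h₁.corner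
    have a3 := h₁.pos le_rfl
    have a4 := k1.2.2
    have a5 := k1.2.1
    have hq : q c = q₂ c := by
      rcases lt_trichotomy (q c) (q₂ c) with h | h | h
      · have := h₁.new.col_le c (Nat.succ_le_of_lt h)
        rw [Nat.succ_eq_add_one] at this
        omega
      · exact h
      · have := h₁.new.col_le c (Nat.succ_le_of_lt h)
        rw [Nat.succ_eq_add_one] at this
        omega
    rw [k3, ← hq] at k4
    omega
  · intro hxy
    by_contra hc
    push Not at hc
    have key : ∀ j, j ≤ c₂ + 1 → o j < o₂ j := by
      intro j
      induction j with
      | zero => intro _; rw [h₁.start, h₂.start]; exact hxy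
      | succ j ih => intro hj; exact h₁.lt_next h₂ (by omega) (by omega) (ih (by omega))
    have h3 := key (c₂ + 1) le_rfl
    rw [h₂.last_eq_zero] at h3
    omega

/-! ### Entries of tableaux -/

/-- The entry in column `j` and row `r`, or `d` outside the shape. -/
def entry {α : Type} (d : α) (T : List (List α)) (j r : ℕ) : α := (T.getD j []).getD r d

/-- No column is empty and no entry is the default value `d`. -/
def Proper {α : Type} (d : α) (T : List (List α)) : Prop := ∀ C ∈ T, C ≠ [] ∧ d ∉ C

section Entries

variable {α : Type} {d : α}

theorem entry_nil (j r : ℕ) : entry d [] j r = d := by simp [entry]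

theorem entry_cons_zero (C : List α) (R : List (List α)) (r : ℕ) :
    entry d (C :: R) 0 r = C.getD r d := by simp [entry]

theorem entry_cons_succ (C : List α) (R : List (List α)) (j r : ℕ) :
    entry d (C :: R) (j + 1) r = entry d R j r := by simp [entry]

theorem getD_ne_iff {C : List α} (h : d ∉ C) (r : ℕ) : C.getD r d ≠ d ↔ r < C.length := by
  constructor
  · intro hr
    by_contra hcon
    exact hr (List.getD_eq_default _ _ (not_lt.1 hcon))
  · intro hr he
    rw [List.getD_eq_getElem _ _ hr] at he
    exact h (he ▸ List.getElem_mem hr)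

theorem getD_ext {C D : List α} (hC : d ∉ C) (hD : d ∉ D) (h : ∀ r, C.getD r d = D.getD r d) :
    C = D := by
  have hl : ∀ r, r < C.length ↔ r < D.length := fun r => by
    rw [← getD_ne_iff hC, ← getD_ne_iff hD, h]
  have hlen : C.length = D.length := le_antisymm
    (by by_contra hc; exact absurd ((hl D.length).1 (not_le.1 hc)) (lt_irrefl _))
    (by by_contra hc; exact absurd ((hl C.length).2 (not_le.1 hc)) (lt_irrefl _))
  refine List.ext_getElem hlen fun i h1 h2 => ?_
  have := h i
  rwa [List.getD_eq_getElem _ _ h1, List.getD_eq_getElem _ _ h2] at this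

theorem Proper.of_cons {C : List α} {R : List (List α)} (h : Proper d (C :: R)) : Proper d R :=
  fun D hD => h D (List.mem_cons_of_mem _ hD)

/-- A tableau is determined by its entries. -/
theorem Proper.ext {T T' : List (List α)} (h : Proper d T) (h' : Proper d T')
    (he : entry d T = entry d T') : T = T' := by
  induction T generalizing T' with
  | nil =>
    cases T' with
    | nil => rfl
    | cons C R =>
      have h1 := h' C (by simp)
      have h2 := congrFun (congrFun he 0) 0
      rw [entry_nil, entry_cons_zero] at h2
      exact absurd h2.symm ((getD_ne_iff h1.2 0).2 (List.length_pos_iff.2 h1.1))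
  | cons C R ih =>
    cases T' with
    | nil =>
      have h1 := h C (by simp)
      have h2 := congrFun (congrFun he 0) 0
      rw [entry_nil, entry_cons_zero] at h2
      exact absurd h2 ((getD_ne_iff h1.2 0).2 (List.length_pos_iff.2 h1.1))
    | cons C' R' =>
      congr 1
      · refine getD_ext (h C (by simp)).2 (h' C' (by simp)).2 fun r => ?_
        have := congrFun (congrFun he 0) r
        rwa [entry_cons_zero, entry_cons_zero] at this
      · refine ih h.of_cons h'.of_cons ?_
        funext j r
        have := congrFun (congrFun he (j + 1)) r
        rwa [entry_cons_succ, entry_cons_succ] at this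

theorem getD_notMem {T : List (List α)} (h : Proper d T) (j : ℕ) : d ∉ T.getD j [] := by
  by_cases hj : j < T.length
  · rw [List.getD_eq_getElem _ _ hj]; exact (h _ (List.getElem_mem hj)).2
  · rw [List.getD_eq_default _ _ (not_lt.1 hj)]; simp

theorem Proper.entry_ne_iff {T : List (List α)} (h : Proper d T) (j r : ℕ) :
    entry d T j r ≠ d ↔ r < (T.getD j []).length :=
  getD_ne_iff (getD_notMem h j) r

theorem Proper.lt_length_iff {T : List (List α)} (h : Proper d T) (j : ℕ) :
    j < T.length ↔ entry d T j 0 ≠ d := by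
  rw [h.entry_ne_iff]
  constructor
  · intro hj
    rw [List.getD_eq_getElem _ _ hj]
    exact List.length_pos_iff.2 (h _ (List.getElem_mem hj)).1
  · intro hr
    by_contra hcon
    rw [List.getD_eq_default _ _ (not_lt.1 hcon)] at hr
    simp at hr

theorem Proper.lt_length {T : List (List α)} {j r : ℕ} (hne : entry d T j r ≠ d) :
    j < T.length := by
  by_contra hcon
  refine hne ?_
  simp [entry, List.getElem?_eq_none (not_lt.1 hcon)]

theorem mem_of_entry_ne {T : List (List α)} {j r : ℕ} (hne : entry d T j r ≠ d) :
    ∃ C ∈ T, entry d T j r ∈ C := by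
  have hj := Proper.lt_length hne
  refine ⟨T[j], List.getElem_mem hj, ?_⟩
  have hC : T.getD j [] = T[j] := List.getD_eq_getElem _ _ hj
  unfold entry at hne ⊢
  rw [hC] at hne ⊢
  have hr : r < T[j].length := by
    by_contra hcon
    exact hne (List.getD_eq_default _ _ (not_lt.1 hcon))
  rw [List.getD_eq_getElem _ _ hr]
  exact List.getElem_mem hr

theorem Proper.exists_entry {T : List (List α)} (h : Proper d T) {C : List α} (hC : C ∈ T) {x : α}
    (hx : x ∈ C) : ∃ j r, entry d T j r = x ∧ entry d T j r ≠ d := by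
  obtain ⟨j, hj, rfl⟩ := List.getElem_of_mem hC
  obtain ⟨r, hr, rfl⟩ := List.getElem_of_mem hx
  have he : entry d T j r = T[j][r] := by
    unfold entry
    rw [List.getD_eq_getElem _ _ hj, List.getD_eq_getElem _ _ hr]
  exact ⟨j, r, he, fun h1 => (h _ hC).2 (h1 ▸ he ▸ hx)⟩

/-- Tableaux in terms of their entries. -/
theorem isTableau_iff {ok : α → Prop} {row col : α → α → Prop} (hd : ¬ ok d) (T : List (List α)) :
    IsTableau ok row col T ↔ (∀ C ∈ T, C ≠ [] ∧ ∀ x ∈ C, ok x) ∧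
      (∀ j r, entry d T (j + 1) r ≠ d →
        entry d T j r ≠ d ∧ row (entry d T j r) (entry d T (j + 1) r)) ∧
      (∀ j r, entry d T j (r + 1) ≠ d → col (entry d T j r) (entry d T j (r + 1))) := by
  by_cases hok : ∀ C ∈ T, C ≠ [] ∧ ∀ x ∈ C, ok x
  swap
  · constructor
    · exact fun h => absurd (fun C hC => ⟨(h.1 C hC).1, (h.1 C hC).2.1⟩) hok
    · exact fun h => absurd h.1 hok
  have hp : Proper d T := fun C hC => ⟨(hok C hC).1, fun h => hd ((hok C hC).2 d h)⟩
  unfold IsTableau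
  have hcol : (∀ C ∈ T, C ≠ [] ∧ (∀ x ∈ C, ok x) ∧ C.IsChain col) ↔
      ∀ j r, entry d T j (r + 1) ≠ d → col (entry d T j r) (entry d T j (r + 1)) := by
    constructor
    · intro h j r hne
      have hj := Proper.lt_length hne
      have hlt := (hp.entry_ne_iff _ _).1 hne
      have hch := List.isChain_iff_getElem.1 (h _ (List.getElem_mem hj)).2.2
      unfold entry
      rw [List.getD_eq_getElem _ _ hj] at hlt ⊢
      rw [List.getD_eq_getElem _ _ hlt, List.getD_eq_getElem _ _ (by omega)]
      exact hch r hlt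
    · intro h C hC
      refine ⟨(hok C hC).1, (hok C hC).2, List.isChain_iff_getElem.2 fun r hr => ?_⟩
      obtain ⟨j, hj, rfl⟩ := List.getElem_of_mem hC
      have := h j r ((hp.entry_ne_iff _ _).2 (by rwa [List.getD_eq_getElem _ _ hj]))
      unfold entry at this
      rwa [List.getD_eq_getElem _ _ hj, List.getD_eq_getElem _ _ hr,
        List.getD_eq_getElem _ _ (by omega)] at this
  have hrow : T.IsChain (fun C D => D.length ≤ C.length ∧ List.Forall₂ row (C.take D.length) D) ↔
      ∀ j r, entry d T (j + 1) r ≠ d →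
        entry d T j r ≠ d ∧ row (entry d T j r) (entry d T (j + 1) r) := by
    rw [List.isChain_iff_getElem]
    constructor
    · intro h j r hne
      have hj := Proper.lt_length hne
      have hlt := (hp.entry_ne_iff _ _).1 hne
      obtain ⟨h1, h2⟩ := h j hj
      rw [List.getD_eq_getElem _ _ hj] at hlt
      have hlt' : r < T[j].length := by omega
      refine ⟨(hp.entry_ne_iff _ _).2 (by rw [List.getD_eq_getElem _ _ (by omega)]; exact hlt'), ?_⟩
      have := (List.forall₂_iff_get.1 h2).2 r (by simp; omega) hlt
      unfold entry
      rw [List.getD_eq_getElem _ _ hj, List.getD_eq_getElem T _ (show j < T.length by omega),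
        List.getD_eq_getElem _ _ hlt, List.getD_eq_getElem _ _ hlt']
      simpa using this
    · intro h j hj
      have hlen : T[j + 1].length ≤ T[j].length := by
        by_contra hcon
        have := (h j T[j].length ((hp.entry_ne_iff _ _).2 (by
          rw [List.getD_eq_getElem _ _ hj]; omega))).1
        rw [hp.entry_ne_iff, List.getD_eq_getElem T _ (show j < T.length by omega)] at this
        omega
      refine ⟨hlen, List.forall₂_iff_get.2 ⟨by simp [hlen], fun r h1 h2 => ?_⟩⟩
      have := (h j r ((hp.entry_ne_iff _ _).2 (by rwa [List.getD_eq_getElem _ _ hj]))).2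
      unfold entry at this
      rw [List.getD_eq_getElem _ _ hj, List.getD_eq_getElem T _ (show j < T.length by omega),
        List.getD_eq_getElem _ _ h2, List.getD_eq_getElem _ _ (by omega)] at this
      simpa using this
  rw [hcol, hrow]
  exact ⟨fun h => ⟨hok, h.2, h.1⟩, fun h => ⟨h.2.2, h.2.1⟩⟩

theorem entry_append_cons (L : List (List α)) (C : List α) (R : List (List α)) (j r : ℕ) :
    entry d (L ++ C :: R) j r = if j < L.length then entry d L j r else
      if j = L.length then C.getD r d else entry d R (j - L.length - 1) r := by
  unfold entry
  split_ifs with h1 h2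
  · rw [List.getD_append _ _ _ _ h1]
  · rw [List.getD_append_right _ _ _ _ (by omega), h2]; simp
  · rw [List.getD_append_right _ _ _ _ (by omega)]
    obtain ⟨m, hm⟩ : ∃ m, j - L.length = m + 1 := ⟨j - L.length - 1, by omega⟩
    simp [hm]

theorem entry_append_cons_self (L : List (List α)) (C : List α) (R : List (List α)) (r : ℕ) :
    entry d (L ++ C :: R) L.length r = C.getD r d := by
  simp [entry_append_cons]

theorem entry_append_cons_eq_setFill (L : List (List α)) {C C' : List α} (R : List (List α))
    {s : ℕ} {v : α} (h : ∀ r, C'.getD r d = if r = s then v else C.getD r d) :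
    entry d (L ++ C' :: R) = setFill (entry d (L ++ C :: R)) L.length s v := by
  funext j r
  simp only [setFill, entry_append_cons]
  split_ifs with h1 h2 h3 h4 h5
  · omega
  · rfl
  · rw [h, if_pos h4.2]
  · rw [h, if_neg (fun hr => h4 ⟨h3, hr⟩)]
  · omega
  · rfl

theorem entry_append_singleton (L : List (List α)) (v : α) :
    entry d (L ++ [[v]]) = setFill (entry d L) L.length 0 v := by
  funext j r
  simp only [setFill, entry_append_cons]
  split_ifs with h1 h2 h3 h4 h5
  · omega
  · rfl
  · rw [h4.2]; simp
  · unfold entry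
    rw [List.getD_eq_default L _ h3.ge]
    rcases r with _ | r
    · exact absurd ⟨h3, rfl⟩ h4
    · simp
  · omega
  · rw [entry_nil]
    unfold entry
    rw [List.getD_eq_default L _ (by omega)]; simp

theorem getD_append_singleton (C : List α) (v : α) (r : ℕ) :
    (C ++ [v]).getD r d = if r = C.length then v else C.getD r d := by
  split_ifs with h
  · rw [List.getD_append_right _ _ _ _ h.ge, h]; simp
  · rcases Nat.lt_or_gt_of_ne h with h | h
    · rw [List.getD_append _ _ _ _ h]
    · rw [List.getD_append_right _ _ _ _ h.le, List.getD_eq_default C _ h.le,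
        List.getD_eq_default _ _ (by simp; omega)]

theorem exists_append_cons {T : List (List α)} {k : ℕ} (h : k < T.length) :
    ∃ L C R, T = L ++ C :: R ∧ L.length = k ∧ C = T.getD k [] := by
  refine ⟨T.take k, T[k], T.drop (k + 1), ?_, by simp; omega, (List.getD_eq_getElem _ _ h).symm⟩
  rw [← List.drop_eq_getElem_cons h, List.take_append_drop]

theorem modify_append_cons (L : List (List α)) (C : List α) (R : List (List α))
    (f : List α → List α) : (L ++ C :: R).modify L.length f = L ++ f C :: R := by
  induction L with
  | nil => simp
  | cons D L ih => simp [ih]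

theorem Proper.append_cons_iff {L R : List (List α)} {C : List α} :
    Proper d (L ++ C :: R) ↔ Proper d L ∧ (C ≠ [] ∧ d ∉ C) ∧ Proper d R := by
  unfold Proper
  simp only [List.mem_append, List.mem_cons]
  exact ⟨fun h => ⟨fun D hD => h D (Or.inl hD), h C (Or.inr (Or.inl rfl)),
    fun D hD => h D (Or.inr (Or.inr hD))⟩, fun h D hD => by
      rcases hD with hD | rfl | hD
      · exact h.1 D hD
      · exact h.2.1
      · exact h.2.2 D hD⟩

/-- Removing the box at the bottom of column `c`, at the end of its row. -/
theorem Proper.removeBox {T : List (List α)} (h : Proper d T) {c r : ℕ} (hr : entry d T c r ≠ d)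
    (hb : entry d T c (r + 1) = d) (hc : entry d T (c + 1) r = d) :
    Proper d (removeBox T c) ∧ entry d (HeckeRSK.removeBox T c) = setFill (entry d T) c r d := by
  obtain ⟨L, C, R, rfl, rfl, -⟩ := exists_append_cons (Proper.lt_length hr)
  obtain ⟨hL, hC, hR⟩ := Proper.append_cons_iff.1 h
  rw [entry_append_cons_self] at hr hb
  have hlen : C.length = r + 1 := by
    have h1 := (getD_ne_iff hC.2 r).1 hr
    have h2 := mt (getD_ne_iff hC.2 (r + 1)).2 (by simpa using hb)
    omega
  have hfil : ∀ {M : List (List α)}, Proper d M → M.filter (fun C => !C.isEmpty) = M := by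
    intro M hM
    rw [List.filter_eq_self]
    intro D hD
    simpa using (hM D hD).1
  have hent : entry d (L ++ C.dropLast :: R) = setFill (entry d (L ++ C :: R)) L.length r d := by
    refine entry_append_cons_eq_setFill L R fun s => ?_
    rw [List.getD_eq_getElem?_getD, List.getElem?_dropLast, List.getD_eq_getElem?_getD, hlen]
    split_ifs with h1 h2 h2
    · omega
    · rfl
    · simp
    · rw [List.getElem?_eq_none (by omega)]
  unfold HeckeRSK.removeBox
  rw [modify_append_cons, List.filter_append, hfil hL]
  -- A column that becomes empty is dropped. It is the last one, because the removed box is at the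
  -- end of row `0`.
  by_cases hemp : C.dropLast = []
  · have hr0 : r = 0 := by
      have := congrArg List.length hemp
      simp at this; omega
    have hR0 : R = [] := by
      rw [← List.length_eq_zero_iff]
      by_contra hcon
      have h1 := (h.lt_length_iff (L.length + 1)).1 (by simp; omega)
      rw [hr0] at hc
      exact h1 hc
    rw [hemp] at hent
    subst hR0
    rw [hemp]
    refine ⟨by simpa using hL, ?_⟩
    rw [← hent]
    funext j s
    rw [entry_append_cons]
    split_ifs with h1 h2
    · simp
    · simp [entry, h2]
    · rw [entry_nil]
      simp [entry, List.getElem?_eq_none (show L.length ≤ j by omega)]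
  · have h2 : Proper d (C.dropLast :: R) := fun D hD => by
      rcases List.mem_cons.1 hD with rfl | hD
      · exact ⟨hemp, fun hm => hC.2 (List.mem_of_mem_dropLast hm)⟩
      · exact hR D hD
    rw [hfil h2]
    refine ⟨Proper.append_cons_iff.2 ⟨hL, h2 _ (by simp), hR⟩, hent⟩

end Entries

/-! ### Decreasing tableaux as decreasing fillings. -/

theorem IsDecreasing.proper {P : List (List ℕ)} (h : IsDecreasing P) : Proper 0 P :=
  fun C hC => ⟨(h.1 C hC).1, fun h0 => lt_irrefl _ ((h.1 C hC).2.1 0 h0)⟩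

theorem isDecreasing_iff {P : List (List ℕ)} (h : Proper 0 P) :
    IsDecreasing P ↔ IsDecFill (entry 0 P) := by
  unfold IsDecreasing
  rw [isTableau_iff (d := 0) (lt_irrefl 0)]
  constructor
  · rintro ⟨-, h1, h2⟩
    refine ⟨fun j r => ?_, fun j r => ?_⟩
    · have := h1 j r; omega
    · have := h2 j r; omega
  · intro hd
    refine ⟨fun C hC => ⟨(h C hC).1, fun x hx => Nat.pos_of_ne_zero fun h0 =>
      (h C hC).2 (h0 ▸ hx)⟩, fun j r hne => ?_, fun j r hne => ?_⟩
    · have := hd.row j r; omega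
    · have := hd.col j r; omega

theorem IsDecreasing.isDecFill {P : List (List ℕ)} (h : IsDecreasing P) : IsDecFill (entry 0 P) :=
  (isDecreasing_iff h.proper).1 h

/-- The columns meeting row `r` form an initial segment, so their number tells where the row ends.
-/
theorem lt_rowLength_iff {T : List (List ℕ)} (h : Proper 0 T) {r : ℕ}
    (hrow : ∀ j, 0 < entry 0 T (j + 1) r → 0 < entry 0 T j r) (j : ℕ) :
    j < rowLength T r ↔ 0 < entry 0 T j r := by
  induction T generalizing j with
  | nil => simp [rowLength, entry_nil]
  | cons C T ih =>
    have hp := h.of_cons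
    have ih' := ih hp (fun j => by simpa [entry_cons_succ] using hrow (j + 1))
    have hC : 0 < entry 0 (C :: T) 0 r ↔ r < C.length := by
      rw [entry_cons_zero, Nat.pos_iff_ne_zero, getD_ne_iff (h C (by simp)).2]
    have hrl : rowLength (C :: T) r = rowLength T r + if r < C.length then 1 else 0 := by
      simp [rowLength, List.countP_cons]
    rw [hrl]
    by_cases hr : r < C.length
    · cases j with
      | zero => rw [hC]; simp [hr]
      | succ j => rw [entry_cons_succ, ← ih']; simp [hr]
    · have hz : ∀ j, ¬ 0 < entry 0 (C :: T) j r := by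
        intro j
        induction j with
        | zero => rw [hC]; exact hr
        | succ j ihj => exact fun h1 => ihj (hrow j h1)
      have : rowLength T r = 0 := by
        by_contra hne
        have := (ih' 0).1 (by omega)
        rw [← entry_cons_succ C] at this
        exact hz 1 this
      simp [this, hr, hz j]

/-! ### Replacing an entry of a column -/

/-- A strictly decreasing column has no repeated entries, so replacing a value affects a single row.
-/
theorem replaceEntry_getD {C : List ℕ} (hC : C.IsChain (fun x y => y < x)) {s y x : ℕ}
    (hs : s < C.length) (hy : C.getD s 0 = y) (r : ℕ) :
    (replaceEntry C y x).getD r 0 = if r = s then x else C.getD r 0 := by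
  have hnd : C.Pairwise (fun x y => y < x) := List.isChain_iff_pairwise.1 hC
  unfold replaceEntry
  by_cases hr : r < C.length
  · rw [List.getD_eq_getElem _ _ (by simpa using hr), List.getElem_map,
      List.getD_eq_getElem _ _ hr]
    rw [List.getD_eq_getElem _ _ hs] at hy
    rw [List.pairwise_iff_getElem] at hnd
    rcases lt_trichotomy r s with h | h | h
    · have := hnd r s hr hs h
      rw [if_neg (by omega), if_neg (by omega)]
    · subst h; rw [if_pos hy, if_pos rfl]
    · have := hnd s r hs hr h
      rw [if_neg (by omega), if_neg (by omega)]
  · rw [List.getD_eq_default _ _ (by simpa using hr), List.getD_eq_default _ _ (by simpa using hr),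
      if_neg (by omega)]

theorem replaceEntry_proper {C : List ℕ} {x y : ℕ} (hx : 0 < x) (h : C ≠ [] ∧ 0 ∉ C) :
    replaceEntry C y x ≠ [] ∧ 0 ∉ replaceEntry C y x := by
  unfold replaceEntry
  refine ⟨by simpa using h.1, ?_⟩
  simp only [List.mem_map, not_exists, not_and]
  intro z hz
  split_ifs
  · omega
  · rintro rfl; exact h.2 hz

/-! ### Insertions and their traces -/

/-- Induction on the untreated columns, carrying the partial trace of those in `done`. Absent
entries count as `0`, so that appending `x` is the replacement of a `0`. -/
theorem insertFrom_trace {T : ℕ → ℕ → ℕ} {x₀ : ℕ} (rest : List (List ℕ)) :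
    ∀ (done : List (List ℕ)) (x : ℕ) (q o : ℕ → ℕ), IsDecreasing (done ++ rest) →
      FwdTrace T (entry 0 (done ++ rest)) x₀ q o done.length → o done.length = x → 0 < x →
      ∃ q o c, IsDecreasing (insertFrom done rest x).1 ∧
        Trace T (entry 0 (insertFrom done rest x).1) x₀ q o c ∧
        (insertFrom done rest x).2.1 = (q c, c) ∧
        ((insertFrom done rest x).2.2 = true ↔
          Replaces T (entry 0 (insertFrom done rest x).1) q o c) := by
  induction rest with
  | nil =>
    intro done x q o hdec htr ho hx
    simp only [List.append_nil] at hdec htr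
    have hz : entry 0 done done.length 0 = 0 := by
      by_contra hne; exact lt_irrefl _ (Proper.lt_length hne)
    have hprop : Proper 0 (done ++ [[x]]) :=
      Proper.append_cons_iff.2 ⟨hdec.proper, ⟨by simp, by simpa using hx.ne⟩, by simp [Proper]⟩
    have hd : IsDecFill (setFill (entry 0 done) done.length 0 (o done.length)) := by
      -- Nothing can block in row `0` of the empty column: `FwdTrace.keep` would produce a row above
      -- it.
      by_contra hn
      obtain ⟨q', o', -, -, -, h4⟩ := htr.keep (by omega) (by simp) hn
      omega
    obtain ⟨q', o', h1, h2, h3, h4⟩ := htr.replace (by omega) hd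
    have he : entry 0 (done ++ [[x]]) = setFill (entry 0 done) done.length 0 (o done.length) := by
      rw [entry_append_singleton, ho]
    rw [← he] at h1 h3 hd
    refine ⟨q', o', done.length, (isDecreasing_iff hprop).2 hd, ?_, ?_, ?_⟩
    · exact h1.finish_replace (by rw [h2, hz]) h3
    · simp [insertFrom, h4]
    · simpa [insertFrom] using h3
  | cons C rest ih =>
    intro done x q o hdec htr ho hx
    obtain ⟨hpd, hpC, hpr⟩ := Proper.append_cons_iff.1 hdec.proper
    have hch : C.IsChain (fun x y => y < x) := (hdec.1 C (by simp)).2.2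
    cases hmax : (C.filter (fun z => z < x)).max? with
    | none =>
      have hall : ∀ z ∈ C, x ≤ z := by
        rw [List.max?_eq_none_iff] at hmax
        simpa using hmax
      have hz : entry 0 (done ++ C :: rest) done.length C.length = 0 := by
        rw [entry_append_cons_self, List.getD_eq_default _ _ le_rfl]
      have habove : ∀ r < C.length, o done.length ≤ entry 0 (done ++ C :: rest) done.length r := by
        intro r hr
        rw [entry_append_cons_self, List.getD_eq_getElem _ _ hr, ho]
        exact hall _ (List.getElem_mem hr)
      have hprop : Proper 0 (done ++ (C ++ [x]) :: rest) :=
        Proper.append_cons_iff.2 ⟨hpd, ⟨by simp, by simpa using ⟨hpC.2, hx.ne⟩⟩, hpr⟩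
      have he : entry 0 (done ++ (C ++ [x]) :: rest) =
          setFill (entry 0 (done ++ C :: rest)) done.length C.length (o done.length) := by
        rw [ho]; exact entry_append_cons_eq_setFill _ _ (getD_append_singleton C x)
      by_cases hD : IsDecreasing (done ++ (C ++ [x]) :: rest)
      · obtain ⟨q', o', h1, h2, h3, h4⟩ := htr.replace (by rw [hz]; omega) (he ▸ hD.isDecFill)
        rw [← he] at h1 h3
        refine ⟨q', o', done.length, ?_, ?_, ?_, ?_⟩
        · simp [insertFrom, hmax, hD]
        · simpa [insertFrom, hmax, hD] using h1.finish_replace (by rw [h2, hz]) h3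
        · simp [insertFrom, hmax, hD, h4]
        · simpa [insertFrom, hmax, hD] using h3
      · obtain ⟨q', o', h1, h2, h3, h4⟩ := htr.keep (by rw [hz]; omega) habove
          (fun h => hD ((isDecreasing_iff hprop).2 (he ▸ h)))
        have hrl := lt_rowLength_iff hdec.proper (r := C.length - 1) (fun j hj => by
          have := hdec.isDecFill.row j (C.length - 1); omega)
        have hk : 0 < entry 0 (done ++ C :: rest) done.length (C.length - 1) := by
          have := habove (C.length - 1) (by omega); omega
        have hk' := (hrl _).2 hk
        have hq : q' done.length = C.length - 1 := by omega
        set c := rowLength (done ++ C :: rest) (C.length - 1) - 1 with hc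
        have ht := h1.finish_keep (by rw [h2, hz]) h3 (show done.length ≤ c by omega)
          (by rw [hq]; exact (hrl c).1 (by omega))
          (by
            rw [hq]
            have := mt (hrl (c + 1)).2 (by omega)
            omega)
        refine ⟨fun j => if j ≤ done.length then q' j else q' done.length,
          fun j => if j ≤ done.length + 1 then o' j else 0, c, ?_, ?_, ?_, ?_⟩
        · simpa [insertFrom, hmax, hD] using hdec
        · simpa only [insertFrom, hmax, hD, if_false] using ht
        · simp only [insertFrom, hmax, hD, if_false]
          rw [← hc]
          congr 1
          split_ifs with h5
          · rw [show c = done.length by omega, hq]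
          · exact hq.symm
        · have hz' : ∀ r, entry 0 (done ++ C :: rest) c r = T c r := by
            intro r
            rcases (show done.length ≤ c by omega).eq_or_lt with h5 | h5
            · rw [← h5]; exact h3.1 r
            · exact h1.beyond c (by omega) r
          simp only [insertFrom, hmax, hD, if_false]
          refine ⟨fun h => by simp at h, fun h => ?_⟩
          have := h.1
          rw [hz'] at this
          exact absurd this (lt_irrefl _)
    | some y =>
      have hy : y ∈ C ∧ y < x ∧ ∀ z ∈ C, z < x → z ≤ y := by
        rw [List.max?_eq_some_iff] at hmax
        simpa [and_assoc] using hmax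
      obtain ⟨hyC, hyx, hymax⟩ := hy
      obtain ⟨s, hs, hsy⟩ := List.getElem_of_mem hyC
      have hsD : C.getD s 0 = y := by rw [List.getD_eq_getElem _ _ hs, hsy]
      have hy0 : 0 < y := Nat.pos_of_ne_zero fun h => hpC.2 (h ▸ hyC)
      have hUs : entry 0 (done ++ C :: rest) done.length s = y := by
        rw [entry_append_cons_self, hsD]
      have habove : ∀ r < s, o done.length ≤ entry 0 (done ++ C :: rest) done.length r := by
        intro r hr
        have hr' : r < C.length := by omega
        have h1 := hdec.isDecFill.col_lt done.length hr
        rw [hUs] at h1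
        rw [entry_append_cons_self, List.getD_eq_getElem _ _ hr'] at h1 ⊢
        by_contra hcon
        have := hymax _ (List.getElem_mem hr') (by omega)
        omega
      have hprop : Proper 0 (done ++ replaceEntry C y x :: rest) :=
        Proper.append_cons_iff.2 ⟨hpd, replaceEntry_proper hx hpC, hpr⟩
      have he : entry 0 (done ++ replaceEntry C y x :: rest) =
          setFill (entry 0 (done ++ C :: rest)) done.length s (o done.length) := by
        rw [ho]; exact entry_append_cons_eq_setFill _ _ (replaceEntry_getD hch hs hsD)
      by_cases hD : IsDecreasing (done ++ replaceEntry C y x :: rest)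
      · obtain ⟨q', o', h1, h2, -, -⟩ := htr.replace (by rw [hUs, ho]; exact hyx)
          (he ▸ hD.isDecFill)
        rw [← he] at h1
        simp only [insertFrom, hmax, hD, if_true]
        exact ih (done ++ [replaceEntry C y x]) y q' o' (by simpa using hD) (by simpa using h1)
          (by simpa [hUs] using h2) hy0
      · obtain ⟨q', o', h1, h2, -, -⟩ := htr.keep (by rw [hUs, ho]; exact hyx) habove
          (fun h => hD ((isDecreasing_iff hprop).2 (he ▸ h)))
        simp only [insertFrom, hmax, hD, if_false]
        exact ih (done ++ [C]) y q' o' (by simpa using hdec) (by simpa using h1)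
          (by simpa [hUs] using h2) hy0

theorem heckeInsert_trace {P : List (List ℕ)} {x : ℕ} (hP : IsDecreasing P) (hx : 0 < x) :
    ∃ q o c, IsDecreasing (heckeInsert P x).1 ∧
      Trace (entry 0 P) (entry 0 (heckeInsert P x).1) x q o c ∧
      (heckeInsert P x).2.1 = (q c, c) ∧
      ((heckeInsert P x).2.2 = true ↔
        Replaces (entry 0 P) (entry 0 (heckeInsert P x).1) q o c) := by
  refine insertFrom_trace P [] x (fun _ => 0) (fun _ => x) (by simpa using hP) ?_ rfl hx
  exact ⟨hP.isDecFill, hP.isDecFill, rfl, fun h => by simp at h, fun j hj => by simp at hj,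
    fun j hj => by simp at hj, fun _ _ _ => rfl⟩

/-- Columns to the left of `k` are still those of `T'`, so the number travelling to the left can
always be named as an entry `T' k (q k)`. -/
theorem revInsertFrom_trace {T' : ℕ → ℕ → ℕ} {c : ℕ} (k : ℕ) :
    ∀ (P : List (List ℕ)) (q o : ℕ → ℕ), IsDecreasing P → RevTrace (entry 0 P) T' q o k c →
      ∃ q' o', IsDecreasing (revInsertFrom k P (T' k (q k))).1 ∧
        Trace (entry 0 (revInsertFrom k P (T' k (q k))).1) T'
          (revInsertFrom k P (T' k (q k))).2 q' o' c ∧ q' c = q c ∧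
        (Replaces (entry 0 P) T' q o c ↔
          Replaces (entry 0 (revInsertFrom k P (T' k (q k))).1) T' q' o' c) := by
  induction k with
  | zero =>
    intro P q o hP htr
    refine ⟨q, _, by simpa [revInsertFrom] using hP, by simpa [revInsertFrom] using htr.finish, rfl, ?_⟩
    simp only [revInsertFrom]
    exact ⟨fun h => h.congr (fun _ => rfl) (fun _ => rfl) rfl (Function.update_of_ne (by omega) _ _),
      fun h => h.congr (fun _ => rfl) (fun _ => rfl) rfl (Function.update_of_ne (by omega) _ _).symm⟩
  | succ k ih =>
    intro P q o hP htr
    set y := T' (k + 1) (q (k + 1)) with hy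
    have hypos : 0 < y := by
      rcases htr.step (k + 1) le_rfl htr.le with hr | hr
      · have := hr.1; omega
      · rw [hy, hr.1]; exact hr.2.1
    -- The left neighbour of `y` is greater than `y`, so the search in column `k` succeeds.
    have hlt : y < entry 0 P k (q (k + 1)) := by
      have h1 := htr.new.row k (q (k + 1))
      have h2 := htr.before k (by omega) (q (k + 1))
      omega
    obtain ⟨L, C, R, rfl, rfl, -⟩ := exists_append_cons (Proper.lt_length
      (d := 0) (T := P) (j := k) (r := q (k + 1)) (by omega))
    obtain ⟨hpL, hpC, hpR⟩ := Proper.append_cons_iff.1 hP.proper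
    have hch : C.IsChain (fun x y => y < x) := (hP.1 C (by simp)).2.2
    have hget : (L ++ C :: R).getD L.length [] = C := by simp
    have hmem : ∃ z ∈ C, y < z := by
      rw [entry_append_cons_self] at hlt
      have hr : q (L.length + 1) < C.length := (getD_ne_iff hpC.2 _).1 (by omega)
      rw [List.getD_eq_getElem _ _ hr] at hlt
      exact ⟨_, List.getElem_mem hr, hlt⟩
    cases hmin : (C.filter (fun z => y < z)).min? with
    | none =>
      obtain ⟨z, hz, hyz⟩ := hmem
      rw [List.min?_eq_none_iff] at hmin
      have : ∀ z ∈ C, z ≤ y := by simpa using hmin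
      exact absurd (this z hz) (by omega)
    | some w =>
      have hw : w ∈ C ∧ y < w ∧ ∀ z ∈ C, y < z → w ≤ z := by
        rw [List.min?_eq_some_iff] at hmin
        simpa [and_assoc] using hmin
      obtain ⟨hwC, hyw, hwmin⟩ := hw
      obtain ⟨s, hs, hsw⟩ := List.getElem_of_mem hwC
      have hsD : C.getD s 0 = w := by rw [List.getD_eq_getElem _ _ hs, hsw]
      have hUs : entry 0 (L ++ C :: R) L.length s = w := by
        rw [entry_append_cons_self, hsD]
      have hbelow : entry 0 (L ++ C :: R) L.length (s + 1) ≤ y := by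
        have h1 := hP.isDecFill.col L.length s
        rw [hUs] at h1
        by_contra hcon
        rw [entry_append_cons_self] at h1 hcon
        have hr : s + 1 < C.length := (getD_ne_iff hpC.2 _).1 (by omega)
        rw [List.getD_eq_getElem _ _ hr] at h1 hcon
        have := hwmin _ (List.getElem_mem hr) (by omega)
        omega
      have hprop : Proper 0 (L ++ replaceEntry C w y :: R) :=
        Proper.append_cons_iff.2 ⟨hpL, replaceEntry_proper hypos hpC, hpR⟩
      have he : entry 0 (L ++ replaceEntry C w y :: R) =
          setFill (entry 0 (L ++ C :: R)) L.length s y :=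
        entry_append_cons_eq_setFill _ _ (replaceEntry_getD hch hs hsD)
      have hwT : w = T' L.length s := by
        rw [← hUs]; exact htr.before _ (by omega) _
      simp only [revInsertFrom, hget, hmin, modify_append_cons]
      by_cases hD : IsDecreasing (L ++ replaceEntry C w y :: R)
      · obtain ⟨q', o', h1, h2, h3, h4⟩ := htr.replace (by rw [hUs]; exact hyw)
          (he ▸ hD.isDecFill)
        rw [← hy, ← he] at h1 h4
        obtain ⟨q'', o'', g1, g2, g3, g4⟩ := ih _ q' o' hD h1
        rw [h2, ← hwT] at g1 g2 g4
        simp only [hD, if_true]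
        exact ⟨q'', o'', g1, g2, g3.trans h3, h4.trans g4⟩
      · obtain ⟨q', o', h1, h2, h3, h4⟩ := htr.keep (by rw [hUs]; exact hyw) hbelow
          (fun h => hD ((isDecreasing_iff hprop).2 (he ▸ h)))
        obtain ⟨q'', o'', g1, g2, g3, g4⟩ := ih _ q' o' hP h1
        rw [h2, ← hwT] at g1 g2 g4
        simp only [hD, if_false]
        exact ⟨q'', o'', g1, g2, g3.trans h3, h4.trans g4⟩

theorem heckeRevInsert_trace {P : List (List ℕ)} (hP : IsDecreasing P) {r c : ℕ} (α : Bool)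
    (hr : 0 < entry 0 P c r) (hb : entry 0 P c (r + 1) = 0) (hc : entry 0 P (c + 1) r = 0) :
    ∃ q o, IsDecreasing (heckeRevInsert P r c α).1 ∧
      Trace (entry 0 (heckeRevInsert P r c α).1) (entry 0 P) (heckeRevInsert P r c α).2 q o c ∧
      q c = r ∧ (α = true ↔ Replaces (entry 0 (heckeRevInsert P r c α).1) (entry 0 P) q o c) := by
  have hy : (P.getD c []).getD r 0 = entry 0 P c r := rfl
  cases α with
  | true =>
    have h0 := RevTrace.init_replace hP.isDecFill hr hc hb
    obtain ⟨h1, h2⟩ := hP.proper.removeBox (by omega) hb hc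
    rw [← h2] at h0
    obtain ⟨q, o, g1, g2, g3, g4⟩ := revInsertFrom_trace c (removeBox P c) _ _
      ((isDecreasing_iff h1).2 h0.old) h0
    refine ⟨q, o, ?_, ?_, ?_⟩
    · simpa only [heckeRevInsert, hy, if_true] using g1
    · simpa only [heckeRevInsert, hy, if_true] using g2
    · refine ⟨g3, ?_⟩
      simp only [heckeRevInsert, hy, if_true, true_iff]
      refine g4.1 ?_
      rcases h0.step c le_rfl le_rfl with h5 | h5
      · exact h5
      · have := h5.2.1
        rw [h2, setFill_self] at this
        exact absurd this (lt_irrefl _)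
  | false =>
    have h0 := RevTrace.init_keep hP.isDecFill hr hc hb
    obtain ⟨q, o, g1, g2, g3, g4⟩ := revInsertFrom_trace c P _ _ hP h0
    refine ⟨q, o, ?_, ?_, ?_⟩
    · simpa only [heckeRevInsert, hy, Bool.false_eq_true, if_false] using g1
    · simpa only [heckeRevInsert, hy, Bool.false_eq_true, if_false] using g2
    · refine ⟨g3, ?_⟩
      simp only [heckeRevInsert, hy, Bool.false_eq_true, if_false, false_iff]
      exact fun h => absurd (g4.2 h).1 (lt_irrefl _)

/-! ### Recording tableaux -/

theorem IsRSVT.proper {Q : List (List (Finset ℕ))} (h : IsRSVT Q) : Proper ∅ Q :=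
  fun C hC => ⟨(h.1 C hC).1, fun h0 => Finset.not_nonempty_empty ((h.1 C hC).2.1 ∅ h0).1⟩

/-- That every box has a left neighbour must be demanded; that it has a neighbour above is
automatic, since columns are lists. -/
theorem isRSVT_iff {Q : List (List (Finset ℕ))} (h : Proper ∅ Q) :
    IsRSVT Q ↔ (∀ j r, ∀ x ∈ entry ∅ Q j r, 0 < x) ∧
      (∀ j r, entry ∅ Q (j + 1) r ≠ ∅ → entry ∅ Q j r ≠ ∅) ∧
      (∀ j r, ∀ x ∈ entry ∅ Q j r, ∀ y ∈ entry ∅ Q (j + 1) r, y ≤ x) ∧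
      (∀ j r, ∀ x ∈ entry ∅ Q j r, ∀ y ∈ entry ∅ Q j (r + 1), y < x) := by
  unfold IsRSVT
  rw [isTableau_iff (d := ∅) (by simp)]
  have hne : ∀ {S : Finset ℕ} {y : ℕ}, y ∈ S → S ≠ ∅ := fun hy => Finset.ne_empty_of_mem hy
  constructor
  · rintro ⟨h0, h1, h2⟩
    refine ⟨fun j r x hx => ?_, fun j r hr => (h1 j r hr).1,
      fun j r x hx y hy => (h1 j r (hne hy)).2 x hx y hy,
      fun j r x hx y hy => h2 j r (hne hy) x hx y hy⟩
    obtain ⟨C, hC, hm⟩ := mem_of_entry_ne (hne hx)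
    exact ((h0 C hC).2 _ hm).2 x hx
  · rintro ⟨h0, h1, h2, h3⟩
    refine ⟨fun C hC => ⟨(h C hC).1, fun S hS => ⟨?_, fun x hx => ?_⟩⟩,
      fun j r hr => ⟨h1 j r hr, h2 j r⟩, fun j r _ => h3 j r⟩
    · exact Finset.nonempty_iff_ne_empty.2 fun he => (h C hC).2 (he ▸ hS)
    · obtain ⟨j, r, rfl, -⟩ := h.exists_entry hC hS
      exact h0 j r x hx

/-! ### Shapes, and recording tableaux under a change of one box. -/

theorem length_getD_eq_shape {α : Type} (T : List (List α)) (j : ℕ) :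
    (T.getD j []).length = (shape T).getD j 0 := by
  unfold shape
  by_cases h : j < T.length
  · rw [List.getD_eq_getElem _ _ h, List.getD_eq_getElem _ _ (by simpa using h)]; simp
  · rw [List.getD_eq_default _ _ (not_lt.1 h), List.getD_eq_default _ _ (by simpa using h)]; simp

theorem shape_eq_iff {α β : Type} {d : α} {e : β} {T : List (List α)} {U : List (List β)}
    (hT : Proper d T) (hU : Proper e U) :
    shape T = shape U ↔ ∀ j r, entry d T j r ≠ d ↔ entry e U j r ≠ e := by
  constructor
  · intro h j r
    rw [hT.entry_ne_iff, hU.entry_ne_iff, length_getD_eq_shape, length_getD_eq_shape, h]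
  · intro h
    have hl : ∀ j, j < T.length ↔ j < U.length := fun j => by
      rw [hT.lt_length_iff, hU.lt_length_iff, h]
    have hlen : T.length = U.length := le_antisymm
      (by by_contra hc; exact absurd ((hl U.length).1 (not_le.1 hc)) (lt_irrefl _))
      (by by_contra hc; exact absurd ((hl T.length).2 (not_le.1 hc)) (lt_irrefl _))
    refine List.ext_getElem (by simpa [shape] using hlen) fun j h1 h2 => ?_
    have hc : ∀ r, r < (T.getD j []).length ↔ r < (U.getD j []).length := fun r => by
      rw [← hT.entry_ne_iff, ← hU.entry_ne_iff, h]
    have : (T.getD j []).length = (U.getD j []).length := le_antisymm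
      (by by_contra hc'; exact absurd ((hc _).1 (not_le.1 hc')) (lt_irrefl _))
      (by by_contra hc'; exact absurd ((hc _).2 (not_le.1 hc')) (lt_irrefl _))
    rwa [length_getD_eq_shape, length_getD_eq_shape, List.getD_eq_getElem _ _ h1,
      List.getD_eq_getElem _ _ h2] at this

theorem size_append_cons (L : List (List (Finset ℕ))) (C : List (Finset ℕ))
    (R : List (List (Finset ℕ))) :
    size (L ++ C :: R) = size L + (C.map Finset.card).sum + size R := by
  simp [size, add_assoc]

theorem getD_modify {α : Type} {d : α} (C : List α) (r : ℕ) (f : α → α) (hr : r < C.length)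
    (s : ℕ) : (C.modify r f).getD s d = if s = r then f (C.getD r d) else C.getD s d := by
  rw [List.getD_eq_getElem?_getD, List.getElem?_modify]
  split_ifs with h1 h2 h2
  · subst h1
    rw [List.getElem?_eq_getElem hr, List.getD_eq_getElem _ _ hr]; rfl
  · exact absurd h1.symm h2
  · exact absurd h2.symm h1
  · simp

/-- The entries of a recording tableau after adding a number in a new box. -/
theorem Proper.appendBox {Q : List (List (Finset ℕ))} (h : Proper ∅ Q) {c r : ℕ} (y : ℕ)
    (hr : entry ∅ Q c r = ∅) (habove : ∀ s < r, entry ∅ Q c s ≠ ∅)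
    (hleft : ∀ b < c, entry ∅ Q b r ≠ ∅) :
    Proper ∅ (appendBox Q c y) ∧ entry ∅ (HeckeRSK.appendBox Q c y) = setFill (entry ∅ Q) c r {y} ∧
      size (HeckeRSK.appendBox Q c y) = size Q + 1 := by
  unfold HeckeRSK.appendBox
  split_ifs with hc
  · obtain ⟨L, C, R, rfl, rfl, -⟩ := exists_append_cons hc
    obtain ⟨hL, hC, hR⟩ := Proper.append_cons_iff.1 h
    simp only [entry_append_cons_self] at hr habove
    have hlen : C.length = r := by
      rcases lt_trichotomy C.length r with h1 | h1 | h1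
      · exact absurd (List.getD_eq_default _ _ le_rfl) (habove _ h1)
      · exact h1
      · exact absurd hr ((getD_ne_iff hC.2 r).2 h1)
    rw [modify_append_cons]
    refine ⟨Proper.append_cons_iff.2 ⟨hL, ⟨by simp, ?_⟩, hR⟩, ?_, ?_⟩
    · simp only [List.mem_append, List.mem_singleton, not_or]
      exact ⟨hC.2, (Finset.singleton_ne_empty y).symm⟩
    · exact entry_append_cons_eq_setFill _ _ fun s => by rw [getD_append_singleton, hlen]
    · simp [size_append_cons]; omega
  · have hcl : c = Q.length := by
      by_contra hne
      have := Proper.lt_length (hleft (c - 1) (by omega))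
      omega
    have hr0 : r = 0 := by
      by_contra hne
      have := Proper.lt_length (habove 0 (by omega))
      omega
    subst hr0 hcl
    refine ⟨Proper.append_cons_iff.2 ⟨h, ⟨by simp, ?_⟩, by simp [Proper]⟩,
      entry_append_singleton Q _, ?_⟩
    · simp
    · simp [size]

/-- The entries of a recording tableau after a change of one of its entries. -/
theorem Proper.modifyEntry {Q : List (List (Finset ℕ))} (h : Proper ∅ Q) {c r : ℕ}
    {f : Finset ℕ → Finset ℕ} (hr : entry ∅ Q c r ≠ ∅) (hf : f (entry ∅ Q c r) ≠ ∅) :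
    Proper ∅ (modifyEntry Q r c f) ∧
      entry ∅ (HeckeRSK.modifyEntry Q r c f) = setFill (entry ∅ Q) c r (f (entry ∅ Q c r)) ∧
      size (HeckeRSK.modifyEntry Q r c f) + (entry ∅ Q c r).card =
        size Q + (f (entry ∅ Q c r)).card := by
  obtain ⟨L, C, R, rfl, rfl, -⟩ := exists_append_cons (Proper.lt_length hr)
  obtain ⟨hL, hC, hR⟩ := Proper.append_cons_iff.1 h
  rw [entry_append_cons_self] at *
  have hlt := (getD_ne_iff hC.2 r).1 hr
  unfold HeckeRSK.modifyEntry
  rw [modify_append_cons]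
  have hget := fun s => getD_modify (d := ∅) C r f hlt s
  refine ⟨Proper.append_cons_iff.2 ⟨hL, ⟨?_, ?_⟩, hR⟩, entry_append_cons_eq_setFill _ _ hget, ?_⟩
  · rw [← List.length_pos_iff, List.length_modify]; omega
  · intro hm
    obtain ⟨s, hs, he⟩ := List.getElem_of_mem hm
    have h1 := hget s
    rw [List.getD_eq_getElem _ _ hs, he] at h1
    split_ifs at h1 with h2
    · exact hf h1.symm
    · exact (getD_ne_iff hC.2 s).2 (by simpa using hs) h1.symm
  · rw [size_append_cons, size_append_cons]
    have hsum : ((C.modify r f).map Finset.card).sum + (C.getD r ∅).card =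
        (C.map Finset.card).sum + (f (C.getD r ∅)).card := by
      clear hget hf hC hR hL h hr
      induction C generalizing r with
      | nil => simp at hlt
      | cons S C ih =>
        cases r with
        | zero => simp; omega
        | succ r =>
          have := ih (r := r) (by simpa using hlt)
          simp only [List.modify_succ_cons, List.map_cons, List.sum_cons, List.getD_cons_succ]
          omega
    omega

/-! ### The smallest number and its rightmost box. -/

theorem mem_foldr_union {l : List (Finset ℕ)} {x : ℕ} :
    x ∈ l.foldr (fun S U => S ∪ U) ∅ ↔ ∃ S ∈ l, x ∈ S := by
  induction l with
  | nil => simp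
  | cons S l ih => simp [ih]

theorem mem_entries_iff {Q : List (List (Finset ℕ))} (h : Proper ∅ Q) {x : ℕ} :
    x ∈ Q.flatten.foldr (fun S U => S ∪ U) ∅ ↔ ∃ j r, x ∈ entry ∅ Q j r := by
  rw [mem_foldr_union]
  constructor
  · rintro ⟨S, hS, hx⟩
    obtain ⟨C, hC, hSC⟩ := List.mem_flatten.1 hS
    obtain ⟨j, r, he, -⟩ := h.exists_entry hC hSC
    exact ⟨j, r, he ▸ hx⟩
  · rintro ⟨j, r, hx⟩
    obtain ⟨C, hC, hm⟩ := mem_of_entry_ne (Finset.ne_empty_of_mem hx)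
    exact ⟨_, List.mem_flatten.2 ⟨C, hC, hm⟩, hx⟩

theorem minNumber_eq {Q : List (List (Finset ℕ))} (h : Proper ∅ Q) {y c r : ℕ}
    (hy : y ∈ entry ∅ Q c r) (hle : ∀ j s, ∀ z ∈ entry ∅ Q j s, y ≤ z) : minNumber Q = y := by
  unfold minNumber
  have : (Q.flatten.foldr (fun S U => S ∪ U) ∅).min = (y : WithTop ℕ) := by
    refine le_antisymm (Finset.min_le ((mem_entries_iff h).2 ⟨c, r, hy⟩)) ?_
    refine Finset.le_min fun z hz => ?_
    obtain ⟨j, s, hz⟩ := (mem_entries_iff h).1 hz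
    exact WithTop.coe_le_coe.2 (hle j s z hz)
  rw [this]; rfl

/-- `boxesWith` runs through the columns from left to right and through each column from top to
bottom, so its last member lies in the rightmost column containing `y`, at the bottom. -/
theorem getLast?_boxesWith {Q : List (List (Finset ℕ))} (h : Proper ∅ Q) {y c r : ℕ}
    (hy : y ∈ entry ∅ Q c r) (hbot : entry ∅ Q c (r + 1) = ∅)
    (hcol : ∀ j s, y ∈ entry ∅ Q j s → j ≤ c) : (boxesWith Q y).getLast? = some (r, c) := by
  have hc := Proper.lt_length (Finset.ne_empty_of_mem hy)
  have hr : r < (Q.getD c []).length := (h.entry_ne_iff c r).1 (Finset.ne_empty_of_mem hy)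
  have hr' : ¬ r + 1 < (Q.getD c []).length := fun h1 => (h.entry_ne_iff c (r + 1)).2 h1 hbot
  obtain ⟨m, hm⟩ : ∃ m, Q.length = c + 1 + m := ⟨Q.length - (c + 1), by omega⟩
  unfold boxesWith
  rw [hm, List.range_add, List.flatMap_append, List.range_succ, List.flatMap_append]
  have h1 : ((List.range m).map (fun x => c + 1 + x)).flatMap (fun c =>
      ((List.range (Q.getD c []).length).filter (fun r => y ∈ (Q.getD c []).getD r ∅)).map
        (fun r => (r, c))) = [] := by
    rw [List.flatMap_eq_nil_iff]
    intro j hj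
    obtain ⟨i, -, rfl⟩ := List.mem_map.1 hj
    rw [List.map_eq_nil_iff, List.filter_eq_nil_iff]
    intro s _ hs
    have := hcol (c + 1 + i) s (of_decide_eq_true hs)
    omega
  have hlen : (Q.getD c []).length = r + 1 := by omega
  have hy' : y ∈ (Q.getD c []).getD r ∅ := hy
  rw [h1, List.append_nil, List.flatMap_singleton, hlen, List.range_succ, List.filter_append,
    List.map_append, ← List.append_assoc]
  simp only [List.filter_cons, hy', decide_true, if_true, List.filter_nil, List.map_cons,
    List.map_nil, List.getLast?_concat]

/-! ### Single steps of `Insert` and `RevInsert` -/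

/-- An entry replaced before the last column is positive, because it is the number read backwards
from the next column. So only a replacement in the last column creates a box. -/
theorem Trace.eq_zero_iff {T T' : ℕ → ℕ → ℕ} {x : ℕ} {q o : ℕ → ℕ} {c : ℕ}
    (h : Trace T T' x q o c) (j r : ℕ) :
    T j r = 0 ↔ T' j r = 0 ∨ (j = c ∧ r = q c ∧ Replaces T T' q o c) := by
  by_cases hj : j ≤ c
  · rcases h.step j hj with hs | hs
    · by_cases hr : r = q j
      · subst hr
        have h1 := hs.2.2
        have h2 := hs.1
        rcases hj.eq_or_lt with rfl | hlt
        · have := h.last_eq_zero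
          constructor
          · exact fun _ => Or.inr ⟨rfl, rfl, hs⟩
          · intro _; omega
        · have h3 := h.pos (j := j + 1) (by omega)
          rcases h.link j hlt with h4 | h4
          · constructor
            · intro _; omega
            · rintro (h5 | h5)
              · omega
              · omega
          · have := h4.1.1 (q j); omega
      · rw [hs.2.1 r hr]
        constructor
        · exact Or.inl
        · rintro (h1 | ⟨rfl, h1, -⟩)
          · exact h1
          · exact absurd h1 hr
    · rw [hs.1 r]
      constructor
      · exact Or.inl
      · rintro (h1 | ⟨rfl, rfl, h1⟩)
        · exact h1
        · have := h1.1; have := hs.1 (q j); omega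
  · rw [h.beyond j (by omega)]
    constructor
    · exact Or.inl
    · rintro (h1 | h1)
      · exact h1
      · omega

/-- `y` may be added to the recording tableau when `x` is inserted: it is at most every number there,
and if it occurs, then only to the left of the final box of the insertion. -/
structure Addable (PQ : List (List ℕ) × List (List (Finset ℕ))) (x y : ℕ) : Prop where
  mem : PQ ∈ tableauPairs
  x_pos : 0 < x
  y_pos : 0 < y
  le : ∀ j r, ∀ z ∈ entry ∅ PQ.2 j r, y ≤ z
  col_lt : ∀ j r, y ∈ entry ∅ PQ.2 j r → j < (heckeInsert PQ.1 x).2.1.2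

theorem tableauPairs_entry {PQ : List (List ℕ) × List (List (Finset ℕ))} (h : PQ ∈ tableauPairs)
    (j r : ℕ) : entry 0 PQ.1 j r = 0 ↔ entry ∅ PQ.2 j r = ∅ :=
  not_iff_not.1 ((shape_eq_iff h.1.proper h.2.1.proper).1 h.2.2 j r)

/-- The result of a step of `Insert`. -/
structure StepResult (PQ PQ' : List (List ℕ) × List (List (Finset ℕ))) (x y : ℕ) (q o : ℕ → ℕ)
    (c : ℕ) : Prop where
  mem : PQ' ∈ tableauPairs
  trace : Trace (entry 0 PQ.1) (entry 0 PQ'.1) x q o c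
  box : (heckeInsert PQ.1 x).2.1 = (q c, c)
  fst : PQ'.1 = (heckeInsert PQ.1 x).1
  entry_eq : entry ∅ PQ'.2 = setFill (entry ∅ PQ.2) c (q c) (insert y (entry ∅ PQ.2 c (q c)))
  size_eq : size PQ'.2 = size PQ.2 + 1
  replaces_iff : Replaces (entry 0 PQ.1) (entry 0 PQ'.1) q o c ↔ entry ∅ PQ.2 c (q c) = ∅

/-- The final box is at the end of its row and of its column, and `y` is at most every number
recorded so far. The strict inequality down the column holds because earlier occurrences of `y` are
in columns further left. -/
theorem Addable.insertStep_result {PQ : List (List ℕ) × List (List (Finset ℕ))} {x y : ℕ}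
    (h : Addable PQ x y) : ∃ q o c, StepResult PQ (insertStep PQ (x, y)) x y q o c := by
  obtain ⟨P, Q⟩ := PQ
  obtain ⟨⟨hP, hQ, hsh⟩, hx, hy, hle, hcol⟩ := h
  dsimp only at hP hQ hsh hle hcol
  obtain ⟨q, o, c, hP', htr, hbox, hα⟩ := heckeInsert_trace hP hx
  refine ⟨q, o, c, ?_⟩
  have hent : ∀ j r, entry 0 P j r = 0 ↔ entry ∅ Q j r = ∅ :=
    tableauPairs_entry (PQ := (P, Q)) ⟨hP, hQ, hsh⟩
  rw [hbox] at hcol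
  dsimp only at hcol
  have hrep : Replaces (entry 0 P) (entry 0 (heckeInsert P x).1) q o c ↔ entry ∅ Q c (q c) = ∅ := by
    rw [← hent, htr.eq_zero_iff]
    have := htr.pos le_rfl
    constructor
    · exact fun h => Or.inr ⟨rfl, rfl, h⟩
    · rintro (h | h)
      · omega
      · exact h.2.2
  have hfst : (insertStep (P, Q) (x, y)).1 = (heckeInsert P x).1 := by
    unfold insertStep
    rcases hh : heckeInsert P x with ⟨P', ⟨r', c'⟩, _ | _⟩ <;> simp
  have hnew : ∀ j r, entry 0 (heckeInsert P x).1 j r = 0 ↔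
      setFill (entry ∅ Q) c (q c) (insert y (entry ∅ Q c (q c))) j r = ∅ := by
    intro j r
    by_cases hjr : j = c ∧ r = q c
    · rw [hjr.1, hjr.2, setFill_self]
      have := htr.pos le_rfl
      simp only [Finset.insert_ne_empty, iff_false]
      omega
    · rw [setFill_of_ne _ _ (by omega), ← hent, htr.eq_zero_iff]
      constructor
      · exact Or.inl
      · rintro (h | h)
        · exact h
        · exact absurd ⟨h.1, h.2.1⟩ hjr
  have hsnd : Proper ∅ (insertStep (P, Q) (x, y)).2 ∧
      entry ∅ (insertStep (P, Q) (x, y)).2 =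
        setFill (entry ∅ Q) c (q c) (insert y (entry ∅ Q c (q c))) ∧
      size (insertStep (P, Q) (x, y)).2 = size Q + 1 := by
    rcases hh : heckeInsert P x with ⟨P', ⟨r', c'⟩, α⟩
    rw [hh] at hα hbox hrep htr
    dsimp only at hα hbox hrep htr
    obtain ⟨rfl, rfl⟩ := Prod.mk.inj hbox
    cases α with
    | true =>
      have hz := hrep.1 (hα.1 rfl)
      have hs := hα.1 rfl
      have h1 := hQ.proper.appendBox y hz (fun s hs' => by
          rw [Ne, ← hent, htr.eq_zero_iff]
          have := htr.new.col_le c' hs'.le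
          have := htr.pos le_rfl
          omega)
        (fun b hb => by
          rw [Ne, ← hent, htr.eq_zero_iff]
          have := htr.new.row_le (q c') hb.le
          have := htr.pos le_rfl
          omega)
      simpa [insertStep, hh, hz] using h1
    | false =>
      have hz : entry ∅ Q c' (q c') ≠ ∅ := fun hz => by simpa using hα.2 (hrep.2 hz)
      have h1 := hQ.proper.modifyEntry (f := fun S => insert y S) hz (Finset.insert_ne_empty _ _)
      have hny : y ∉ entry ∅ Q c' (q c') := fun hm => lt_irrefl _ (hcol _ _ hm)
      rw [Finset.card_insert_of_notMem hny] at h1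
      refine ⟨by simpa [insertStep, hh] using h1.1,
        by simpa [insertStep, hh] using h1.2.1, ?_⟩
      have := h1.2.2
      simp only [insertStep, hh]
      omega
  obtain ⟨h1, h2, h3⟩ := hsnd
  obtain ⟨p1, p2, p3, p4⟩ := (isRSVT_iff hQ.proper).1 hQ
  have hcorner : entry ∅ Q (c + 1) (q c) = ∅ := by
    have := (hnew (c + 1) (q c)).1 htr.corner
    rwa [setFill_of_ne _ _ (by omega)] at this
  have hbottom : entry ∅ Q c (q c + 1) = ∅ := by
    have := (hnew c (q c + 1)).1 htr.bottom
    rwa [setFill_of_ne _ _ (by omega)] at this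
  refine ⟨⟨hfst ▸ hP', (isRSVT_iff h1).2 ?_, (shape_eq_iff (hfst ▸ hP').proper h1).2
    fun j r => ?_⟩, hfst ▸ htr, hbox, hfst, h2, h3, hfst ▸ hrep⟩
  · rw [h2]
    refine ⟨fun j r z hz => ?_, fun j r => ?_, fun j r z hz w hw => ?_, fun j r z hz w hw => ?_⟩
    · by_cases hjr : j = c ∧ r = q c
      · rw [hjr.1, hjr.2, setFill_self, Finset.mem_insert] at hz
        rcases hz with rfl | hz
        · exact hy
        · exact p1 _ _ _ hz
      · rw [setFill_of_ne _ _ (by omega)] at hz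
        exact p1 _ _ _ hz
    · rw [Ne, Ne, ← hnew, ← hnew]
      have := htr.new.row_le r (Nat.le_succ j)
      rw [Nat.succ_eq_add_one] at this
      omega
    · by_cases hjr : j = c ∧ r = q c
      · rw [setFill_of_ne _ _ (by omega), hjr.1, hjr.2, hcorner] at hw
        simp at hw
      · rw [setFill_of_ne _ _ (by omega)] at hz
        by_cases hjr' : j + 1 = c ∧ r = q c
        · rw [hjr'.1, hjr'.2, setFill_self, Finset.mem_insert] at hw
          rcases hw with rfl | hw
          · exact hle _ _ _ hz
          · exact p3 _ _ _ hz _ (by rw [hjr'.1, hjr'.2]; exact hw)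
        · rw [setFill_of_ne _ _ (by omega)] at hw
          exact p3 _ _ _ hz _ hw
    · by_cases hjr : j = c ∧ r = q c
      · rw [setFill_of_ne _ _ (by omega), hjr.1, hjr.2, hbottom] at hw
        simp at hw
      · rw [setFill_of_ne _ _ (by omega)] at hz
        by_cases hjr' : j = c ∧ r + 1 = q c
        · rw [hjr'.1, hjr'.2, setFill_self, Finset.mem_insert] at hw
          rcases hw with rfl | hw
          · refine lt_of_le_of_ne (hle _ _ _ hz) ?_
            rintro rfl
            have := hcol _ _ hz
            omega
          · exact p4 _ _ _ hz _ (by rw [hjr'.1, hjr'.2]; exact hw)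
        · rw [setFill_of_ne _ _ (by omega)] at hw
          exact p4 _ _ _ hz _ hw
  · rw [h2, hfst, Ne, Ne, hnew]

theorem setFill_eq_self {α : Type} {T : ℕ → ℕ → α} {c r : ℕ} (v w : α) (h : w = T c r) :
    setFill (setFill T c r v) c r w = T := by
  funext j s
  by_cases hjs : j = c ∧ s = r
  · rw [hjs.1, hjs.2, setFill_self, h]
  · rw [setFill_of_ne _ _ (by omega), setFill_of_ne _ _ (by omega)]

/-- `RevInsert` undoes a step of `Insert`. -/
theorem Addable.revInsertAux_insertStep {PQ : List (List ℕ) × List (List (Finset ℕ))} {x y : ℕ}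
    (h : Addable PQ x y) (n : ℕ) :
    revInsertAux (n + 1) (insertStep PQ (x, y)) =
      ((revInsertAux n PQ).1 ++ [x], (revInsertAux n PQ).2 ++ [y]) := by
  obtain ⟨q, o, c, hres⟩ := h.insertStep_result
  obtain ⟨P, Q⟩ := PQ
  rcases hPQ : insertStep (P, Q) (x, y) with ⟨P', Q'⟩
  rw [hPQ] at hres
  obtain ⟨hmem', htr, hbox, hfst, hent, -, hrep⟩ := hres
  obtain ⟨⟨hP, hQ, hsh⟩, hx, hy, hle, hcol⟩ := h
  dsimp only at *
  obtain ⟨hP', hQ', hsh'⟩ := hmem'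
  dsimp only at *
  rw [hbox] at hcol
  dsimp only at hcol
  have hny : y ∉ entry ∅ Q c (q c) := fun hm => lt_irrefl _ (hcol _ _ hm)
  have hy' : y ∈ entry ∅ Q' c (q c) := by rw [hent, setFill_self]; simp
  have hempty := tableauPairs_entry (PQ := (P', Q')) ⟨hP', hQ', hsh'⟩
  have hb : entry ∅ Q' c (q c + 1) = ∅ := (hempty _ _).1 htr.bottom
  have hc : entry ∅ Q' (c + 1) (q c) = ∅ := (hempty _ _).1 htr.corner
  have hmin : minNumber Q' = y := by
    refine minNumber_eq hQ'.proper hy' fun j s z hz => ?_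
    rw [hent] at hz
    by_cases hjs : j = c ∧ s = q c
    · rw [hjs.1, hjs.2, setFill_self, Finset.mem_insert] at hz
      rcases hz with rfl | hz
      · exact le_rfl
      · exact hle _ _ _ hz
    · rw [setFill_of_ne _ _ (by omega)] at hz
      exact hle _ _ _ hz
  have hlast := getLast?_boxesWith hQ'.proper hy' hb (fun j s hz => by
    by_contra hcon
    rw [hent, setFill_of_ne _ _ (by omega)] at hz
    have := hcol _ _ hz
    omega)
  -- The test performed by `RevInsert` recovers `α`: as `y` was not in this box before, the box
  -- contains `y` alone exactly if it is new.
  have hdec : (Q'.getD c []).getD (q c) ∅ = {y} ↔ Replaces (entry 0 P) (entry 0 P') q o c := by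
    have h1 : (Q'.getD c []).getD (q c) ∅ = insert y (entry ∅ Q c (q c)) := by
      rw [← setFill_self (entry ∅ Q) c (q c) (insert y (entry ∅ Q c (q c))), ← hent]; rfl
    rw [h1, hrep]
    constructor
    · intro he
      rw [Finset.eq_empty_iff_forall_notMem]
      intro z hz
      have : z ∈ ({y} : Finset ℕ) := he ▸ Finset.mem_insert_of_mem hz
      rw [Finset.mem_singleton] at this
      exact hny (this ▸ hz)
    · intro he; rw [he]; rfl
  have hrev : heckeRevInsert P' (q c) c (decide ((Q'.getD c []).getD (q c) ∅ = {y})) = (P, x) := by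
    obtain ⟨q', o', g1, g2, g3, g4⟩ := heckeRevInsert_trace hP'
      (decide ((Q'.getD c []).getD (q c) ∅ = {y})) (htr.pos le_rfl) htr.bottom htr.corner
    obtain ⟨e1, e2⟩ := g2.unique_reverse htr g3 (g4.symm.trans (decide_eq_true_iff.trans hdec))
    exact Prod.ext (g1.proper.ext hP.proper e1) e2
  have hQ2 : (if (decide ((Q'.getD c []).getD (q c) ∅ = {y})) = true then removeBox Q' c else
      modifyEntry Q' (q c) c (fun S => S.erase y)) = Q := by
    split_ifs with h1
    · have hz := hrep.1 (hdec.1 (of_decide_eq_true h1))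
      obtain ⟨g1, g2⟩ := hQ'.proper.removeBox (Finset.ne_empty_of_mem hy') hb hc
      refine g1.ext hQ.proper ?_
      rw [g2, hent]
      exact setFill_eq_self _ _ hz.symm
    · have hz : entry ∅ Q c (q c) ≠ ∅ := fun hz => h1 (decide_eq_true (hdec.2 (hrep.2 hz)))
      have he : (entry ∅ Q' c (q c)).erase y = entry ∅ Q c (q c) := by
        rw [hent, setFill_self, Finset.erase_insert hny]
      obtain ⟨g1, g2, -⟩ := hQ'.proper.modifyEntry (f := fun S => S.erase y)
        (Finset.ne_empty_of_mem hy') (by rw [he]; exact hz)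
      refine g1.ext hQ.proper ?_
      rw [g2, hent]
      exact setFill_eq_self _ _ (by rw [setFill_self, Finset.erase_insert hny])
  simp only [revInsertAux, hmin, hlast]
  rw [hQ2, hrev]

/-- Every pair of nonempty tableaux is the result of a step of `Insert`. -/
theorem exists_addable {PQ' : List (List ℕ) × List (List (Finset ℕ))} (h : PQ' ∈ tableauPairs)
    (hne : PQ'.2 ≠ []) : ∃ PQ x y, Addable PQ x y ∧ insertStep PQ (x, y) = PQ' := by
  obtain ⟨P', Q'⟩ := PQ'
  obtain ⟨hP', hQ', hsh'⟩ := h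
  dsimp only at hP' hQ' hsh' hne
  obtain ⟨p1, p2, p3, p4⟩ := (isRSVT_iff hQ'.proper).1 hQ'
  have hempty := tableauPairs_entry (PQ := (P', Q')) ⟨hP', hQ', hsh'⟩
  dsimp only at hempty
  have hex : ∃ y j r, y ∈ entry ∅ Q' j r := by
    have h0 := (hQ'.proper.lt_length_iff 0).1 (List.length_pos_iff.2 hne)
    obtain ⟨y, hy⟩ := Finset.nonempty_iff_ne_empty.2 h0
    exact ⟨y, 0, 0, hy⟩
  classical
  obtain ⟨y, ⟨hyex, hymin⟩⟩ : ∃ y, (∃ j r, y ∈ entry ∅ Q' j r) ∧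
      ∀ z, (∃ j r, z ∈ entry ∅ Q' j r) → y ≤ z :=
    ⟨Nat.find hex, Nat.find_spec hex, fun z hz => Nat.find_min' hex hz⟩
  obtain ⟨c, ⟨r, hyc⟩, hcmax⟩ : ∃ c, (∃ r, y ∈ entry ∅ Q' c r) ∧
      ∀ j, (∃ r, y ∈ entry ∅ Q' j r) → j ≤ c := by
    have hb : ∀ j, (∃ r, y ∈ entry ∅ Q' j r) → j ≤ Q'.length := fun j ⟨r, hr⟩ =>
      (Proper.lt_length (Finset.ne_empty_of_mem hr)).le
    obtain ⟨j, hj⟩ := hyex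
    exact ⟨Nat.findGreatest (fun j => ∃ r, y ∈ entry ∅ Q' j r) Q'.length,
      Nat.findGreatest_spec (P := fun j => ∃ r, y ∈ entry ∅ Q' j r) (hb j hj) hj,
      fun i hi => Nat.le_findGreatest (hb i hi) hi⟩
  -- The rightmost box with the smallest number is a corner: numbers below it would be smaller than
  -- `y`, and a number on its right would again be `y`.
  have hb : entry ∅ Q' c (r + 1) = ∅ := by
    rw [Finset.eq_empty_iff_forall_notMem]
    intro z hz
    have h1 := p4 _ _ _ hyc _ hz
    have h2 := hymin z ⟨_, _, hz⟩
    omega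
  have hc : entry ∅ Q' (c + 1) r = ∅ := by
    rw [Finset.eq_empty_iff_forall_notMem]
    intro z hz
    have h1 := p3 _ _ _ hyc _ hz
    have h2 := hymin z ⟨_, _, hz⟩
    obtain rfl : z = y := le_antisymm h1 h2
    have := hcmax _ ⟨_, hz⟩
    omega
  have hyne := Finset.ne_empty_of_mem hyc
  set α : Bool := decide (entry ∅ Q' c r = {y}) with hα
  obtain ⟨q, o, g1, g2, g3, g4⟩ := heckeRevInsert_trace hP' α
    (Nat.pos_of_ne_zero fun h0 => hyne ((hempty c r).1 h0)) ((hempty _ _).2 hb) ((hempty _ _).2 hc)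
  set P := (heckeRevInsert P' r c α).1 with hPdef
  set x := (heckeRevInsert P' r c α).2 with hxdef
  have hx : 0 < x := by rw [g2.start_eq]; exact g2.pos (Nat.zero_le c)
  have hrep : Replaces (entry 0 P) (entry 0 P') q o c ↔ entry ∅ Q' c r = {y} := by
    rw [← g4, hα, decide_eq_true_iff]
  obtain ⟨Q, hQ, hQe⟩ : ∃ Q, Proper ∅ Q ∧
      entry ∅ Q = setFill (entry ∅ Q') c r ((entry ∅ Q' c r).erase y) := by
    by_cases h1 : entry ∅ Q' c r = {y}
    · obtain ⟨e1, e2⟩ := hQ'.proper.removeBox hyne hb hc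
      exact ⟨_, e1, by rw [e2, h1]; simp⟩
    · obtain ⟨e1, e2, -⟩ := hQ'.proper.modifyEntry (f := fun S => S.erase y) hyne (fun h2 => h1 (by
        rw [← Finset.insert_erase hyc, h2]; rfl))
      exact ⟨_, e1, e2⟩
  have hsub : ∀ j s, entry ∅ Q j s ⊆ entry ∅ Q' j s := by
    intro j s
    rw [hQe]
    by_cases hjs : j = c ∧ s = r
    · rw [hjs.1, hjs.2, setFill_self]; exact Finset.erase_subset _ _
    · rw [setFill_of_ne _ _ (by omega)]
  have hent : ∀ j s, entry 0 P j s = 0 ↔ entry ∅ Q j s = ∅ := by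
    intro j s
    rw [g2.eq_zero_iff, hrep, g3, hempty, hQe]
    by_cases hjs : j = c ∧ s = r
    · obtain ⟨rfl, rfl⟩ := hjs
      rw [setFill_self]
      simp only [true_and, hyne, false_or]
      constructor
      · intro h1; rw [h1]; simp
      · intro h1; rw [← Finset.insert_erase hyc, h1]; rfl
    · rw [setFill_of_ne _ _ (by omega)]
      constructor
      · rintro (h1 | h1)
        · exact h1
        · exact absurd ⟨h1.1, h1.2.1⟩ hjs
      · exact Or.inl
  obtain ⟨q2, o2, c2, k1, k2, k3, k4⟩ := heckeInsert_trace g1 hx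
  -- The trace left by the reverse insertion is also a trace of inserting `x` into `P`, so it
  -- describes the actual insertion.
  obtain ⟨e1, e2, e3⟩ := k2.unique_forward g2
  subst e2
  have hbox : (heckeInsert P x).2.1 = (r, c2) := by rw [k3, e3, g3]
  have hadd : Addable (P, Q) x y := by
    refine ⟨⟨g1, (isRSVT_iff hQ).2 ⟨fun j s z hz => p1 _ _ _ (hsub _ _ hz), fun j s => ?_,
      fun j s z hz w hw => p3 _ _ _ (hsub _ _ hz) _ (hsub _ _ hw),
      fun j s z hz w hw => p4 _ _ _ (hsub _ _ hz) _ (hsub _ _ hw)⟩,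
      (shape_eq_iff g1.proper hQ).2 fun j s => not_congr (hent j s)⟩, hx, p1 _ _ _ hyc,
      fun j s z hz => hymin z ⟨j, s, hsub _ _ hz⟩, fun j s hz => ?_⟩
    · rw [Ne, Ne, ← hent, ← hent]
      have := g2.old.row_le s (Nat.le_succ j)
      rw [Nat.succ_eq_add_one] at this
      omega
    · dsimp only at hz ⊢
      rw [hbox]
      refine lt_of_le_of_ne (hcmax j ⟨s, hsub _ _ hz⟩) ?_
      rintro rfl
      have hz' := hsub _ _ hz
      -- Another occurrence of `y` in the same column is impossible: in row `r` it has been erased,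
      -- and from any higher row the entries strictly decrease on the way to row `r`.
      by_cases hs : s = r
      · rw [hs, hQe, setFill_self] at hz
        simp at hz
      · have hcolne := fun a b : ℕ => (hQ'.proper.entry_ne_iff (d := ∅) j a)
        have hs1 := (hQ'.proper.entry_ne_iff j s).1 (Finset.ne_empty_of_mem hz')
        have hr1 : ¬ r + 1 < (Q'.getD j []).length := fun h => (hQ'.proper.entry_ne_iff j _).2 h hb
        have hlt : s + 1 ≤ r := by omega
        have hdesc : ∀ t, s + 1 ≤ t → t ≤ r → ∀ z ∈ entry ∅ Q' j t, z < y := by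
          intro t ht
          induction t, ht using Nat.le_induction with
          | base => exact fun _ z hz => p4 _ _ _ hz' _ hz
          | succ t ht ih =>
            intro htr z hz
            have hr2 := (hQ'.proper.entry_ne_iff j r).1 hyne
            obtain ⟨w, hw⟩ := Finset.nonempty_iff_ne_empty.2
              ((hQ'.proper.entry_ne_iff j t).2 (by omega))
            exact (p4 _ _ _ hw _ hz).trans (ih (by omega) w hw)
        exact absurd (hdesc r hlt le_rfl y hyc) (lt_irrefl _)
  refine ⟨(P, Q), x, y, hadd, ?_⟩
  obtain ⟨q3, o3, c3, hres⟩ := hadd.insertStep_result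
  have hb3 := hres.box
  dsimp only at hb3
  rw [hbox] at hb3
  obtain ⟨hq3, rfl⟩ := Prod.mk.inj hb3
  refine Prod.ext ?_ ?_
  · rw [hres.fst]
    exact k1.proper.ext hP'.proper e1
  · refine hres.mem.2.1.proper.ext hQ'.proper ?_
    rw [hres.entry_eq, ← hq3, hQe]
    exact setFill_eq_self _ _ (by rw [setFill_self, Finset.insert_erase hyc])

/-! ### The bijection between compatible pairs and pairs of tableaux -/

theorem insert_concat {a i : List ℕ} (h : a.length = i.length) (x y : ℕ) :
    Insert (a ++ [x], i ++ [y]) = insertStep (Insert (a, i)) (x, y) := by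
  simp [Insert, List.zip_append h, List.foldl_append]

theorem compatiblePairs_concat_iff {a i : List ℕ} {x y : ℕ} (h : a.length = i.length) :
    (a ++ [x], i ++ [y]) ∈ compatiblePairs ↔ (a, i) ∈ compatiblePairs ∧ 0 < x ∧ 0 < y ∧
      ∀ p ∈ (a.zip i).getLast?, y ≤ p.2 ∧ (p.2 = y → p.1 < x) := by
  simp only [compatiblePairs, Set.mem_ofPred_eq, List.length_append, h, List.zip_append h,
    List.isChain_append, List.mem_append]
  simp only [List.zip_cons_cons, List.zip_nil_left, List.length_cons, List.length_nil,
    List.mem_singleton, List.isChain_singleton, List.head?_cons, Option.mem_def, Option.some.injEq,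
    true_and]
  constructor
  · rintro ⟨h1, h2, h3, h4⟩
    exact ⟨⟨fun z hz => h1 z (Or.inl hz), fun z hz => h2 z (Or.inl hz), h3⟩, h1 x (Or.inr rfl),
      h2 y (Or.inr rfl), fun p hp => h4 p hp _ rfl⟩
  · rintro ⟨⟨h1, h2, h3⟩, h4, h5, h6⟩
    refine ⟨fun z hz => ?_, fun z hz => ?_, h3, fun p hp r hr => hr ▸ h6 p hp⟩
    · rcases hz with hz | rfl
      · exact h1 z hz
      · exact h4
    · rcases hz with hz | rfl
      · exact h2 z hz
      · exact h5

theorem getLast?_zip_concat {a i : List ℕ} (h : a.length = i.length) (x y : ℕ) :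
    ((a ++ [x]).zip (i ++ [y])).getLast? = some (x, y) := by
  simp [List.zip_append h]

/-- Pairs of words of the same length, from left to right. -/
@[elab_as_elim]
theorem zip_induction {p : ∀ a i : List ℕ, a.length = i.length → Prop} (nil : p [] [] rfl)
    (concat : ∀ a i x y (h : a.length = i.length), p a i h →
      p (a ++ [x]) (i ++ [y]) (by simp [h]))
    (a i : List ℕ) (h : a.length = i.length) : p a i h := by
  induction a using List.reverseRecOn generalizing i with
  | nil =>
    obtain rfl : i = [] := List.length_eq_zero_iff.1 h.symm
    exact nil
  | append_singleton a x ih =>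
    rcases List.eq_nil_or_concat i with rfl | ⟨i, y, hi⟩
    · simp at h
    · rw [List.concat_eq_append] at hi
      subst hi
      have h' : a.length = i.length := by simpa using h
      exact concat a i x y h' (ih i h')

/-- The relation between two consecutive steps. -/
theorem Addable.lt_iff {PQ : List (List ℕ) × List (List (Finset ℕ))} {x y x' : ℕ}
    (h : Addable PQ x y) (hx' : 0 < x') :
    (heckeInsert PQ.1 x).2.1.2 < (heckeInsert (insertStep PQ (x, y)).1 x').2.1.2 ↔ x < x' := by
  obtain ⟨q, o, c, hr⟩ := h.insertStep_result
  obtain ⟨q', o', c', -, h2, h3, -⟩ := heckeInsert_trace hr.mem.1 hx'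
  rw [h3, hr.box]
  exact hr.trace.lt_iff h2

theorem Addable.mem_insertStep {PQ : List (List ℕ) × List (List (Finset ℕ))} {x y : ℕ}
    (h : Addable PQ x y) {j r z : ℕ} :
    z ∈ entry ∅ (insertStep PQ (x, y)).2 j r ↔ z ∈ entry ∅ PQ.2 j r ∨
      (z = y ∧ (r, j) = (heckeInsert PQ.1 x).2.1) := by
  obtain ⟨q, o, c, hr⟩ := h.insertStep_result
  rw [hr.entry_eq, hr.box, Prod.mk.injEq]
  by_cases hj : j = c ∧ r = q c
  · rw [hj.1, hj.2, setFill_self, Finset.mem_insert]; tauto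
  · rw [setFill_of_ne _ _ (by omega)]; tauto

/-- A step after another one. -/
theorem Addable.next_iff {PQ : List (List ℕ) × List (List (Finset ℕ))} {x y x' y' : ℕ}
    (h : Addable PQ x y) :
    Addable (insertStep PQ (x, y)) x' y' ↔ 0 < x' ∧ 0 < y' ∧ y' ≤ y ∧ (y = y' → x < x') := by
  obtain ⟨q, o, c, hr⟩ := h.insertStep_result
  constructor
  · intro h'
    have hm : y ∈ entry ∅ (insertStep PQ (x, y)).2 (heckeInsert PQ.1 x).2.1.2
        (heckeInsert PQ.1 x).2.1.1 := h.mem_insertStep.2 (Or.inr ⟨rfl, rfl⟩)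
    refine ⟨h'.x_pos, h'.y_pos, h'.le _ _ _ hm, ?_⟩
    rintro rfl
    exact (h.lt_iff h'.x_pos).1 (h'.col_lt _ _ hm)
  · rintro ⟨hx', hy', hle, hlt⟩
    refine ⟨hr.mem, hx', hy', fun j r z hz => ?_, fun j r hz => ?_⟩
    · rcases h.mem_insertStep.1 hz with hz | ⟨rfl, -⟩
      · exact hle.trans (h.le _ _ _ hz)
      · exact hle
    · rcases h.mem_insertStep.1 hz with hz | ⟨rfl, he⟩
      -- An older occurrence of `y'` is at least `y`, hence `y' = y`. The previous box is further
      -- right than this occurrence, and the next box is further right still.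
      · obtain rfl : y = y' := le_antisymm (h.le _ _ _ hz) hle
        exact (h.col_lt _ _ hz).trans ((h.lt_iff hx').2 (hlt rfl))
      · have : j = (heckeInsert PQ.1 x).2.1.2 := congrArg Prod.snd he
        rw [this]
        exact (h.lt_iff hx').2 (hlt rfl)

theorem nil_mem_tableauPairs : (([], []) : List (List ℕ) × List (List (Finset ℕ))) ∈ tableauPairs := by
  refine ⟨?_, ?_, rfl⟩ <;> simp [IsDecreasing, IsRSVT, IsTableau]

theorem addable_nil {x y : ℕ} (hx : 0 < x) (hy : 0 < y) : Addable ([], []) x y :=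
  ⟨nil_mem_tableauPairs, hx, hy, fun j r z hz => by simp [entry_nil] at hz,
    fun j r hz => by simp [entry_nil] at hz⟩

/-- The steps of `Insert` on a compatible pair. -/
theorem insert_compatible {a i : List ℕ} (hl : a.length = i.length)
    (h : (a, i) ∈ compatiblePairs) : Insert (a, i) ∈ tableauPairs ∧
      size (Insert (a, i)).2 = a.length ∧ revInsertAux a.length (Insert (a, i)) = (a, i) ∧
      ∀ x y, (a ++ [x], i ++ [y]) ∈ compatiblePairs ↔ Addable (Insert (a, i)) x y := by
  induction a, i, hl using zip_induction with
  | nil =>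
    refine ⟨nil_mem_tableauPairs, rfl, rfl, fun x y => ?_⟩
    rw [compatiblePairs_concat_iff rfl]
    exact ⟨fun h => addable_nil h.2.1 h.2.2.1, fun h' => ⟨h, h'.x_pos, h'.y_pos, by simp⟩⟩
  | concat a i x y hl ih =>
    have h0 := (compatiblePairs_concat_iff hl).1 h
    obtain ⟨h1, h2, h3, h4⟩ := ih h0.1
    have hadd := (h4 x y).1 h
    obtain ⟨q, o, c, hr⟩ := hadd.insertStep_result
    rw [insert_concat hl]
    refine ⟨hr.mem, by rw [hr.size_eq, h2]; simp, ?_, fun x' y' => ?_⟩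
    · rw [List.length_append, List.length_singleton, hadd.revInsertAux_insertStep, h3]
    · rw [compatiblePairs_concat_iff (by simp [hl]), getLast?_zip_concat hl, hadd.next_iff]
      simp only [h, true_and, Option.mem_def, Option.some.injEq, forall_eq']

/-- Induction on the size. A nonempty pair is the result of an `Insert` step, which `revInsertAux`
undoes, and the compatibility of the lengthened words is read off from `Addable`. -/
theorem revInsert_tableauPairs {n : ℕ} : ∀ {PQ : List (List ℕ) × List (List (Finset ℕ))},
    PQ ∈ tableauPairs → size PQ.2 = n →
      revInsertAux n PQ ∈ compatiblePairs ∧ Insert (revInsertAux n PQ) = PQ := by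
  have hsize : ∀ Q : List (List (Finset ℕ)), IsRSVT Q → Q ≠ [] → size Q ≠ 0 := by
    intro Q hQ hne h0
    cases Q with
    | nil => exact hne rfl
    | cons C R =>
      have hC := hQ.1 C (by simp)
      cases C with
      | nil => exact hC.1 rfl
      | cons S C =>
        have := (hC.2.1 S (by simp)).1.card_pos
        simp [size] at h0
        exact this.ne' (by rw [h0.1.1]; rfl)
  induction n with
  | zero =>
    rintro ⟨P, Q⟩ h h0
    have hQ : Q = [] := by
      by_contra hne; exact hsize Q h.2.1 hne h0
    subst hQ
    have hP : P = [] := by simpa [shape] using h.2.2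
    subst hP
    exact ⟨by simp [compatiblePairs, revInsertAux], rfl⟩
  | succ n ih =>
    intro PQ h hn
    obtain ⟨PQ, x, y, hadd, rfl⟩ := exists_addable h (by rintro h0; rw [h0] at hn; simp [size] at hn)
    obtain ⟨q, o, c, hr⟩ := hadd.insertStep_result
    have hs : size PQ.2 = n := by have := hr.size_eq; omega
    obtain ⟨h1, h2⟩ := ih hadd.mem hs
    rw [hadd.revInsertAux_insertStep]
    rcases hai : revInsertAux n PQ with ⟨a, i⟩
    rw [hai] at h1 h2
    have hl : a.length = i.length := h1.1
    dsimp only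
    refine ⟨((insert_compatible hl h1).2.2.2 x y).2 (h2 ▸ hadd), ?_⟩
    rw [insert_concat hl, h2]

theorem bijOn_of_invOn {α β : Type} {f : α → β} {g : β → α} {s : Set α} {t : Set β}
    (hf : Set.MapsTo f s t) (hg : Set.MapsTo g t s) (h : Set.InvOn g f s t) :
    Set.BijOn f s t ∧ Set.BijOn g t s :=
  ⟨h.bijOn hf hg, h.symm.bijOn hg hf⟩

theorem insert_mapsTo : Set.MapsTo Insert compatiblePairs tableauPairs :=
  fun ai h => (insert_compatible (a := ai.1) (i := ai.2) h.1 h).1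

theorem revInsert_mapsTo : Set.MapsTo RevInsert tableauPairs compatiblePairs :=
  fun _ h => (revInsert_tableauPairs h rfl).1

theorem insert_invOn : Set.InvOn RevInsert Insert compatiblePairs tableauPairs := by
  refine ⟨fun ai h => ?_, fun PQ h => (revInsert_tableauPairs h rfl).2⟩
  obtain ⟨-, h2, h3, -⟩ := insert_compatible (a := ai.1) (i := ai.2) h.1 h
  unfold RevInsert
  rw [show ai = (ai.1, ai.2) from rfl, h2, h3]

theorem insert_fst {a i : List ℕ} (h : a.length = i.length) :
    (Insert (a, i)).1 = insertionTableau a := by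
  induction a, i, h using zip_induction with
  | nil => rfl
  | concat a i x y hl ih =>
    rw [insert_concat hl]
    have : insertionTableau (a ++ [x]) = (heckeInsert (insertionTableau a) x).1 := by
      simp [insertionTableau]
    rw [this, ← ih]
    rcases Insert (a, i) with ⟨P, Q⟩
    unfold insertStep
    dsimp only
    rcases heckeInsert P x with ⟨P', ⟨r', c'⟩, _ | _⟩ <;> rfl

/-! ### The operation `⋆` -/

theorem star_of_forall_lt {S : Finset ℕ} {m : ℕ} (h : ∀ s ∈ S, s < m) : star S m = insert m S := by
  unfold star
  rw [dif_neg]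
  rintro ⟨s, hs⟩
  rw [Finset.mem_filter] at hs
  have := h s hs.1
  omega

theorem star_of_mem {S : Finset ℕ} {m s : ℕ} (hs : s ∈ S) (hm : m ≤ s)
    (hmin : ∀ t ∈ S, m ≤ t → s ≤ t) : star S m = insert m (S.erase s) := by
  unfold star
  have hne : (S.filter (fun x => m ≤ x)).Nonempty := ⟨s, by simp [hs, hm]⟩
  rw [dif_pos hne]
  have : (S.filter (fun x => m ≤ x)).min' hne = s := by
    refine le_antisymm (Finset.min'_le _ _ (by simp [hs, hm])) (Finset.le_min' _ _ _ fun t ht => ?_)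
    rw [Finset.mem_filter] at ht
    exact hmin t ht.1 ht.2
  rw [this]

theorem star_cases (S : Finset ℕ) (m : ℕ) : (∀ s ∈ S, s < m) ∨
    ∃ s ∈ S, m ≤ s ∧ ∀ t ∈ S, m ≤ t → s ≤ t := by
  by_cases h : ∃ s, s ∈ S ∧ m ≤ s
  · classical
    exact Or.inr ⟨Nat.find h, (Nat.find_spec h).1, (Nat.find_spec h).2,
      fun t ht hmt => Nat.find_min' h ⟨ht, hmt⟩⟩
  · left
    intro s hs
    by_contra hcon
    exact h ⟨s, hs, not_lt.1 hcon⟩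

/-- Avoids the choice of a minimum, so that identities between iterated operations can be checked
elementwise. -/
theorem mem_star {S : Finset ℕ} {m x : ℕ} :
    x ∈ star S m ↔ x = m ∨ (x ∈ S ∧ (x < m ∨ ∃ s ∈ S, m ≤ s ∧ s < x)) := by
  rcases star_cases S m with h | ⟨s, hs, hm, hmin⟩
  · rw [star_of_forall_lt h, Finset.mem_insert]
    constructor
    · rintro (h1 | h1)
      · exact Or.inl h1
      · exact Or.inr ⟨h1, Or.inl (h x h1)⟩
    · rintro (h1 | h1)
      · exact Or.inl h1
      · exact Or.inr h1.1
  · rw [star_of_mem hs hm hmin, Finset.mem_insert, Finset.mem_erase]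
    constructor
    · rintro (h1 | ⟨h1, h2⟩)
      · exact Or.inl h1
      · refine Or.inr ⟨h2, ?_⟩
        rcases lt_or_ge x m with h3 | h3
        · exact Or.inl h3
        · exact Or.inr ⟨s, hs, hm, lt_of_le_of_ne (hmin x h2 h3) (Ne.symm h1)⟩
    · rintro (h1 | ⟨h1, h2 | ⟨t, ht, h3, h4⟩⟩)
      · exact Or.inl h1
      · exact Or.inr ⟨by omega, h1⟩
      · have := hmin t ht h3
        exact Or.inr ⟨by omega, h1⟩

theorem star_eq_self {S : Finset ℕ} {m : ℕ} (h : m ∈ S) : star S m = S := by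
  rw [star_of_mem h le_rfl (fun _ _ h => h), Finset.insert_erase h]

theorem self_mem_star (S : Finset ℕ) (m : ℕ) : m ∈ star S m := mem_star.2 (Or.inl rfl)

theorem star_mono {S T : Finset ℕ} (h : S ⊆ T) (hm : ℕ) : star S hm ⊆ star T hm := by
  intro x hx
  rw [mem_star] at *
  grind

/-- The letters do not interfere: `a` replaces an element at most `s`, while `c` acts above `s`. -/
theorem star_comm_of_mem {S : Finset ℕ} {a c s : ℕ} (hs : s ∈ S) (has : a ≤ s) (hsc : s < c) :
    star (star S a) c = star (star S c) a := by
  obtain ⟨t, ht, hat, htm⟩ := (star_cases S a).resolve_left (fun h => by have := h s hs; omega)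
  ext x
  simp only [mem_star]
  grind

/-- A Knuth relation. If an element of `S` lies in `[a, c)`, the letters `a` and `c` commute.
Otherwise `c` is itself replaced, by `a` on the left side and by `b` on the right side, and leaves
nothing behind. -/
theorem star_star_star_eq {S : Finset ℕ} {a b c : ℕ} (hab : a < b) (hbc : b < c) :
    star (star (star S c) a) b = star (star (star S a) c) b := by
  by_cases h : ∃ s ∈ S, a ≤ s ∧ s < c
  · obtain ⟨s, hs, h1, h2⟩ := h
    rw [star_comm_of_mem hs h1 h2]
  · have h1 : star (star S c) a = insert a ((star S c).erase c) :=
      star_of_mem (self_mem_star S c) (by omega) fun t ht hat => by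
        rw [mem_star] at ht
        grind
    have h2 : star (star (star S a) c) b = insert b ((star (star S a) c).erase c) :=
      star_of_mem (self_mem_star _ c) (by omega) fun t ht hat => by
        rw [mem_star, mem_star] at ht
        grind
    rw [h1, h2]
    ext x
    rcases star_cases S c with h3 | ⟨s, hs, hcs, hmin⟩
    · have h4 : ∀ s ∈ S, s < a := fun s hs => by
        by_contra hcon; exact h ⟨s, hs, by omega, h3 s hs⟩
      rw [star_of_forall_lt h3, star_of_forall_lt h4]
      simp only [mem_star, Finset.mem_insert, Finset.mem_erase]
      grind
    · have hmin' : ∀ t ∈ S, a ≤ t → s ≤ t := fun t ht hat => hmin t ht (by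
        by_contra hcon; exact h ⟨t, ht, hat, by omega⟩)
      rw [star_of_mem hs hcs hmin, star_of_mem hs (by omega) hmin']
      simp only [mem_star, Finset.mem_insert, Finset.mem_erase]
      grind

/-- If an element of `S` lies in `[m, x)`, the two letters commute and a second `x` is idle. If not,
`m` replaces the first `x`. -/
theorem star_absorb {S : Finset ℕ} {m x : ℕ} (h : m ≤ x) :
    star (star (star S x) m) x = star (star S m) x := by
  rcases h.eq_or_lt with rfl | hlt
  · simp only [star_eq_self (self_mem_star S m)]
  by_cases h : ∃ s ∈ S, m ≤ s ∧ s < x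
  · obtain ⟨s, hs, h1, h2⟩ := h
    rw [star_comm_of_mem hs h1 h2, star_eq_self]
    exact mem_star.2 (Or.inr ⟨self_mem_star S x, Or.inr ⟨s, mem_star.2 (Or.inr ⟨hs, Or.inl h2⟩), h1, h2⟩⟩)
  · congr 1
    have h1 : star (star S x) m = insert m ((star S x).erase x) :=
      star_of_mem (self_mem_star S x) hlt.le fun t ht hat => by
        rw [mem_star] at ht
        grind
    rw [h1]
    ext y
    rcases star_cases S x with h3 | ⟨s, hs, hcs, hmin⟩
    · have h4 : ∀ s ∈ S, s < m := fun s hs => by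
        by_contra hcon; exact h ⟨s, hs, by omega, h3 s hs⟩
      rw [star_of_forall_lt h3, star_of_forall_lt h4]
      simp only [Finset.mem_insert, Finset.mem_erase]
      grind
    · have hmin' : ∀ t ∈ S, m ≤ t → s ≤ t := fun t ht hat => hmin t ht (by
        by_contra hcon; exact h ⟨t, ht, hat, by omega⟩)
      rw [star_of_mem hs hcs hmin, star_of_mem hs (by omega) hmin']
      simp only [Finset.mem_insert, Finset.mem_erase]
      grind

/-! #### Words -/

theorem foldl_star_mono {S T : Finset ℕ} (h : S ⊆ T) (w : List ℕ) :
    w.foldl star S ⊆ w.foldl star T := by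
  induction w generalizing S T with
  | nil => exact h
  | cons m w ih => exact ih (star_mono h m)

theorem mem_foldl_star_of_lt {S : Finset ℕ} {w : List ℕ} {x : ℕ} (hx : x ∈ S)
    (h : ∀ m ∈ w, x < m) : x ∈ w.foldl star S := by
  induction w generalizing S with
  | nil => exact hx
  | cons m w ih =>
    exact ih (mem_star.2 (Or.inr ⟨hx, Or.inl (h m (by simp))⟩)) fun n hn => h n (by simp [hn])

/-- The later letters of an increasing word are too large to replace an earlier one. -/
theorem mem_foldl_star_of_mem {S : Finset ℕ} {w : List ℕ} (hw : w.Pairwise (· < ·)) {x : ℕ}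
    (hx : x ∈ w) : x ∈ w.foldl star S := by
  induction w generalizing S with
  | nil => simp at hx
  | cons m w ih =>
    rw [List.pairwise_cons] at hw
    rcases List.mem_cons.1 hx with rfl | hx
    · exact mem_foldl_star_of_lt (S := star S x) (w := w) (self_mem_star S x) hw.1
    · exact ih hw.2 hx

theorem foldl_star_of_pairwise {S : Finset ℕ} {w : List ℕ} (hw : w.Pairwise (· < ·))
    (h : ∀ m ∈ w, ∀ s ∈ S, s < m) : w.foldl star S = S ∪ w.toFinset := by
  induction w generalizing S with
  | nil => simp
  | cons m w ih =>
    rw [List.pairwise_cons] at hw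
    rw [List.foldl_cons, star_of_forall_lt (h m (by simp)), ih hw.2]
    · ext x; simp
    · intro n hn s hs
      rcases Finset.mem_insert.1 hs with rfl | hs
      · exact hw.1 n hn
      · exact h n (by simp [hn]) s hs

theorem mem_of_mem_foldl_star {S : Finset ℕ} {w : List ℕ} {x : ℕ} (hx : x ∈ w.foldl star S) :
    x ∈ S ∨ x ∈ w := by
  induction w generalizing S with
  | nil => exact Or.inl hx
  | cons m w ih =>
    rcases ih hx with h | h
    · rcases mem_star.1 h with rfl | h
      · exact Or.inr (by simp)
      · exact Or.inl h.1
    · exact Or.inr (by simp [h])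

theorem exists_le_mem_foldl_star {S : Finset ℕ} {w : List ℕ} {x : ℕ}
    (h : x ∈ w ∨ ∃ s ∈ S, s ≤ x) : ∃ s ∈ w.foldl star S, s ≤ x := by
  induction w generalizing S with
  | nil => simpa using h
  | cons m w ih =>
    refine ih ?_
    rcases h with h | ⟨s, hs, hsx⟩
    · rcases List.mem_cons.1 h with rfl | h
      · exact Or.inr ⟨x, self_mem_star S x, le_rfl⟩
      · exact Or.inl h
    · right
      rcases lt_or_ge s m with h1 | h1
      · exact ⟨s, mem_star.2 (Or.inr ⟨hs, Or.inl h1⟩), hsx⟩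
      · exact ⟨m, self_mem_star S m, by omega⟩

/-- An inserted number passes the increasing word before the entry it replaces. -/
theorem foldl_star_pass {S : Finset ℕ} {w : List ℕ} {x y : ℕ} (hw : (w ++ [y]).Pairwise (· < ·))
    (hx : y < x) : (w ++ [y]).foldl star (star S x) = star (star (w.foldl star S) x) y := by
  induction w generalizing S with
  | nil => rfl
  | cons m w ih =>
    obtain ⟨n, v, hv⟩ : ∃ n v, w ++ [y] = n :: v := by
      cases w with
      | nil => exact ⟨_, _, rfl⟩
      | cons n v => exact ⟨_, _, rfl⟩
    rw [List.cons_append, List.pairwise_cons] at hw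
    have hmn : m < n := hw.1 n (by simp [hv])
    have hny : n ≤ y := by
      have h2 := hw.2
      have hy : y ∈ n :: v := by rw [← hv]; simp
      rw [hv, List.pairwise_cons] at h2
      rcases List.mem_cons.1 hy with h | h
      · exact h.ge
      · exact (h2.1 y h).le
    have key : (w ++ [y]).foldl star (star (star S x) m) =
        (w ++ [y]).foldl star (star (star S m) x) := by
      rw [hv, List.foldl_cons, List.foldl_cons, star_star_star_eq hmn (by omega)]
    rw [List.cons_append, List.foldl_cons, key, ih hw.2]
    rfl

/-- The output passes the increasing word after the entry that was replaced. -/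
theorem foldl_star_comm {S : Finset ℕ} {w : List ℕ} {x y : ℕ} (hx : x ∈ S) (hyx : y ≤ x)
    (hw : ∀ c ∈ w, x < c) : w.foldl star (star S y) = star (w.foldl star S) y := by
  induction w generalizing S with
  | nil => rfl
  | cons c w ih =>
    rw [List.foldl_cons, star_comm_of_mem hx hyx (hw c (by simp)), List.foldl_cons]
    exact ih (mem_star.2 (Or.inr ⟨hx, Or.inl (hw c (by simp))⟩)) fun d hd => hw d (by simp [hd])

/-- The column is read from the bottom: `x` travels past the letters below `y` by `foldl_star_pass`,
and then `y` leaves past the letters above by `foldl_star_comm`. -/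
theorem foldl_star_replace {S : Finset ℕ} {A B : List ℕ} {x y : ℕ}
    (h : (A ++ y :: B).Pairwise (fun a b => b < a)) (hyx : y < x) (hA : ∀ a ∈ A, x < a) :
    (A ++ y :: B).reverse.foldl star (star S x) = star ((A ++ x :: B).reverse.foldl star S) y := by
  have h1 : (B.reverse ++ [y]).Pairwise (· < ·) := by
    rw [← List.reverse_cons, List.pairwise_reverse]
    exact (List.pairwise_append.1 h).2.1
  have e1 : (A ++ y :: B).reverse = (B.reverse ++ [y]) ++ A.reverse := by simp
  have e2 : (A ++ x :: B).reverse = (B.reverse ++ [x]) ++ A.reverse := by simp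
  rw [e1, e2, List.foldl_append, foldl_star_pass h1 hyx,
    foldl_star_comm (self_mem_star _ x) hyx.le (by simpa using hA)]
  simp only [List.foldl_append, List.foldl_cons, List.foldl_nil]

theorem star_foldl_star_absorb {S : Finset ℕ} {w : List ℕ} {x : ℕ} (h : ∀ m ∈ w, m ≤ x) :
    star (w.foldl star (star S x)) x = star (w.foldl star S) x := by
  have aux : ∀ (w : List ℕ) (S T : Finset ℕ), (∀ m ∈ w, m ≤ x) → star S x = star T x →
      star (w.foldl star S) x = star (w.foldl star T) x := by
    intro w
    induction w with
    | nil => exact fun S T _ h => h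
    | cons m w ih =>
      intro S T hw hST
      refine ih _ _ (fun n hn => hw n (by simp [hn])) ?_
      rw [← star_absorb (hw m (by simp)), hST, star_absorb (hw m (by simp))]
  refine aux w _ _ h ?_
  rw [star_eq_self (self_mem_star S x)]

/-- The letters read before `x` in the column are smaller, so the `x` of the column absorbs the one
in front. -/
theorem foldl_star_absorb {S : Finset ℕ} {C : List ℕ} {x : ℕ}
    (h : C.Pairwise (fun a b => b < a)) (hx : x ∈ C) :
    C.reverse.foldl star (star S x) = C.reverse.foldl star S := by
  obtain ⟨A, B, rfl⟩ := List.append_of_mem hx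
  have hB := (List.pairwise_cons.1 (List.pairwise_append.1 h).2.1).1
  rw [show (A ++ x :: B).reverse = B.reverse ++ x :: A.reverse by simp, List.foldl_append,
    List.foldl_append, List.foldl_cons, List.foldl_cons,
    star_foldl_star_absorb (fun m hm => (hB m (by simpa using hm)).le)]

/-- The first letter of the column word is less than `x` and replaces it. -/
theorem foldl_star_empty {C : List ℕ} {x y : ℕ} (h : C.Pairwise (fun a b => b < a)) (hy : y ∈ C)
    (hyx : y < x) : C.reverse.foldl star (star ∅ x) = C.reverse.foldl star ∅ := by
  have h' : C.reverse.Pairwise (· < ·) := by rw [List.pairwise_reverse]; exact h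
  rw [← List.mem_reverse] at hy
  cases hC : C.reverse with
  | nil => simp [hC] at hy
  | cons m w =>
    rw [hC] at hy h'
    have hm : m < x := by
      rcases List.mem_cons.1 hy with rfl | hy
      · exact hyx
      · exact ((List.pairwise_cons.1 h').1 y hy).trans hyx
    rw [List.foldl_cons, List.foldl_cons]
    congr 1
    ext z
    simp only [mem_star, Finset.notMem_empty, false_and, or_false, exists_eq_left]
    omega

/-! #### Inserting a number in front of a word -/

/-- Two sets that differ by an extra element `z` still do so, or become equal, after a letter `m`.
Either `z` is left alone, or it is replaced instead of an element `s`, which becomes the extra one,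
or it is replaced where otherwise nothing would be. The set `R` follows along and keeps containing
all elements below the extra one. -/
theorem star_insert {R T : Finset ℕ} {m z : ℕ} (hz : z ∉ T)
    (hlt : ∀ t ∈ T, t < z → t ∈ R) : star (insert z T) m = star T m ∨
      ∃ z', z' ∉ star T m ∧ star (insert z T) m = insert z' (star T m) ∧
        ∀ t ∈ star T m, t < z' → t ∈ star R m := by
  by_cases h : z < m ∨ ∃ t ∈ T, m ≤ t ∧ t < z
  · right
    refine ⟨z, ?_, ?_, ?_⟩
    · rw [mem_star]; grind
    · ext y
      simp only [mem_star, Finset.mem_insert]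
      grind
    · intro t ht htz
      rw [mem_star] at *
      grind
  · push Not at h
    obtain ⟨hmz, hno⟩ := h
    have h1 : star (insert z T) m = insert m T := by
      rw [star_of_mem (Finset.mem_insert_self z T) hmz (fun t ht hmt => by
        rcases Finset.mem_insert.1 ht with rfl | ht
        · exact le_rfl
        · exact hno t ht hmt), Finset.erase_insert hz]
    rcases star_cases T m with h2 | ⟨s, hs, hms, hmin⟩
    · left
      rw [h1, star_of_forall_lt h2]
    · right
      have hsz : s ≠ z := fun he => hz (he ▸ hs)
      have hzs : z ≤ s := hno s hs hms
      refine ⟨s, ?_, ?_, fun t ht hts => ?_⟩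
      · rw [star_of_mem hs hms hmin, Finset.mem_insert, Finset.mem_erase]; omega
      · rw [h1, star_of_mem hs hms hmin, Finset.insert_comm, Finset.insert_erase hs]
      · rw [mem_star] at *
        rcases ht with ht | ⟨ht, -⟩
        · exact Or.inl ht
        · have : t < m := by
            by_contra hcon
            have := hmin t ht (not_lt.1 hcon)
            omega
          exact Or.inr ⟨hlt t ht (by omega), Or.inl this⟩

theorem foldl_star_insert {R T : Finset ℕ} {z : ℕ} (w : List ℕ) (hz : z ∉ T)
    (hlt : ∀ t ∈ T, t < z → t ∈ R) : w.foldl star (insert z T) = w.foldl star T ∨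
      ∃ z', z' ∉ w.foldl star T ∧ w.foldl star (insert z T) = insert z' (w.foldl star T) ∧
        ∀ t ∈ w.foldl star T, t < z' → t ∈ w.foldl star R := by
  induction w generalizing R T z with
  | nil => exact Or.inr ⟨z, hz, rfl, hlt⟩
  | cons m w ih =>
    rcases star_insert (m := m) hz hlt with h | ⟨z', h1, h2, h3⟩
    · left; rw [List.foldl_cons, h]; rfl
    · rw [List.foldl_cons, h2]
      exact ih h1 h3

/-! #### Numbers of entries -/

theorem card_star {S : Finset ℕ} {m s : ℕ} (hs : s ∈ S) (hm : m ≤ s) : (star S m).card = S.card := by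
  obtain ⟨t, ht, hmt, hmin⟩ := (star_cases S m).resolve_left fun h => by
    have := h s hs; omega
  rw [star_of_mem ht hmt hmin]
  by_cases hmS : m ∈ S
  · obtain rfl : t = m := le_antisymm (hmin m hmS le_rfl) hmt
    rw [Finset.insert_erase ht]
  · rw [Finset.card_insert_of_notMem (by simp [hmS]), Finset.card_erase_of_mem ht]
    have := Finset.card_pos.2 ⟨t, ht⟩
    omega

/-- The first components provide elements to be replaced: the letter `p.2` replaces an element at
most `p.1`, so the larger first components survive. -/
theorem card_foldl_star {S : Finset ℕ} {w : List (ℕ × ℕ)}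
    (hw : w.Pairwise (fun p q => p.1 < q.1)) (h : ∀ p ∈ w, p.1 ∈ S ∧ p.2 ≤ p.1) :
    ((w.map Prod.snd).foldl star S).card = S.card := by
  induction w generalizing S with
  | nil => rfl
  | cons p w ih =>
    rw [List.pairwise_cons] at hw
    obtain ⟨hp1, hp2⟩ := h p (by simp)
    rw [List.map_cons, List.foldl_cons, ih hw.2, card_star hp1 hp2]
    intro r hr
    obtain ⟨hr1, hr2⟩ := h r (by simp [hr])
    exact ⟨mem_star.2 (Or.inr ⟨hr1, Or.inr ⟨p.1, hp1, hp2, hw.1 r hr⟩⟩), hr2⟩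

theorem IsDecreasing.pairwise {P : List (List ℕ)} (h : IsDecreasing P) {C : List ℕ} (hC : C ∈ P) :
    C.Pairwise (fun a b => b < a) := List.isChain_iff_pairwise.1 (h.1 C hC).2.2

theorem IsDecreasing.of_cons {P : List (List ℕ)} {C : List ℕ} (h : IsDecreasing (C :: P)) :
    IsDecreasing P :=
  ⟨fun D hD => h.1 D (List.mem_cons_of_mem _ hD), h.2.of_cons⟩

theorem IsDecreasing.drop {P : List (List ℕ)} (h : IsDecreasing P) (j : ℕ) :
    IsDecreasing (P.drop j) :=
  ⟨fun D hD => h.1 D (List.mem_of_mem_drop hD), h.2.drop j⟩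

theorem word_cons (C : List ℕ) (P : List (List ℕ)) : word (C :: P) = C.reverse ++ word P := by
  simp [word]

theorem word_drop (P : List (List ℕ)) (j : ℕ) :
    word (P.drop j) = (P.getD j []).reverse ++ word (P.drop (j + 1)) := by
  by_cases h : j < P.length
  · rw [List.drop_eq_getElem_cons h, word_cons, List.getD_eq_getElem _ _ h]
  · rw [List.drop_eq_nil_of_le (not_lt.1 h), List.drop_eq_nil_of_le (by omega),
      List.getD_eq_default _ _ (not_lt.1 h)]; rfl

/-- Each entry of the next column is less than its left neighbour, which is still in the set, so
every letter replaces an element and none is added. Afterwards this column takes the place of `B`.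
-/
theorem card_foldl_star_word {B : List ℕ} {P : List (List ℕ)} (h : IsDecreasing (B :: P))
    {S : Finset ℕ} (hS : ∀ b ∈ B, b ∈ S) : ((word P).foldl star S).card = S.card := by
  induction P generalizing B S with
  | nil => rfl
  | cons C P ih =>
    have hpw := h.of_cons.pairwise (C := C) (by simp)
    rw [word_cons, List.foldl_append, ih h.of_cons (fun c hc =>
      mem_foldl_star_of_mem (by rw [List.pairwise_reverse]; exact hpw) (by simpa using hc))]
    have hrel := (List.isChain_cons_cons.1 h.2).1
    have hBp := h.pairwise (C := B) (by simp)
    have hmap : C.reverse = ((B.zip C).reverse).map Prod.snd := by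
      rw [List.map_reverse, List.map_snd_zip hrel.1]
    rw [hmap, card_foldl_star]
    · rw [List.pairwise_reverse, List.pairwise_iff_getElem]
      intro i j hi hj hij
      rw [List.pairwise_iff_getElem] at hBp
      simp only [List.length_zip] at hi hj
      simpa using hBp i j (by omega) (by omega) hij
    · intro p hp
      rw [List.mem_reverse] at hp
      refine ⟨hS _ (List.of_mem_zip hp).1, ?_⟩
      obtain ⟨i, hi, rfl⟩ := List.getElem_of_mem hp
      simp only [List.length_zip] at hi
      have := (List.forall₂_iff_get.1 hrel.2).2 i (by simp; omega) (by omega)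
      simp at this
      simpa using this.le

/-- The sizes of the columns of the right key. -/
theorem card_rightKey {P : List (List ℕ)} (h : IsDecreasing P) (j : ℕ) :
    ((word (P.drop j)).foldl star ∅).card = (P.getD j []).length := by
  by_cases hj : j < P.length
  · have hd := h.drop j
    rw [List.drop_eq_getElem_cons hj] at hd ⊢
    have hpw := hd.pairwise (C := P[j]) List.mem_cons_self
    have hpw' : P[j].reverse.Pairwise (· < ·) := by rw [List.pairwise_reverse]; exact hpw
    rw [word_cons, List.foldl_append, card_foldl_star_word hd, List.getD_eq_getElem _ _ hj,
      foldl_star_of_pairwise hpw' (by simp), Finset.empty_union, List.toFinset_reverse,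
      List.toFinset_card_of_nodup (hpw.imp (fun h => h.ne'))]
    exact fun b hb => mem_foldl_star_of_mem hpw' (by simpa using hb)
  · rw [List.drop_eq_nil_of_le (not_lt.1 hj), List.getD_eq_default _ _ (not_lt.1 hj)]; rfl

theorem foldl_star_word_drop_subset (P : List (List ℕ)) (j : ℕ) :
    (word (P.drop (j + 1))).foldl star ∅ ⊆ (word (P.drop j)).foldl star ∅ := by
  rw [word_drop P j, List.foldl_append]
  exact foldl_star_mono (Finset.empty_subset _) _

/-! #### The right key and Hecke insertion -/

/-- Once the number is `0` it stays `0`, and all further links are `KeepsTwo`. -/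
theorem Trace.eq_of_zero {T T' : ℕ → ℕ → ℕ} {x : ℕ} {q o : ℕ → ℕ} {c : ℕ} (h : Trace T T' x q o c)
    {k : ℕ} (hk : o k = 0) {i : ℕ} (hi : k ≤ i) (r : ℕ) : T' i r = T i r := by
  have hz : ∀ i, k ≤ i → i ≤ c → o i = 0 := by
    intro i hi
    induction i, hi using Nat.le_induction with
    | base => exact fun _ => hk
    | succ i hi ih =>
      intro hic
      have := h.next_lt (j := i) (by omega)
      have := ih (by omega)
      omega
  by_cases hic : i ≤ c
  · have h1 := hz i hi hic
    have h2 := h.pos hic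
    obtain ⟨i', rfl, h3⟩ := h.keepsTwo hic (by omega)
    exact h3.2.1.1 r
  · exact h.beyond i (by omega) r

theorem getD_eq_of_entry {P P' : List (List ℕ)} (hP : Proper 0 P) (hP' : Proper 0 P') {j : ℕ}
    (h : ∀ r, entry 0 P' j r = entry 0 P j r) : P'.getD j [] = P.getD j [] :=
  getD_ext (getD_notMem hP' j) (getD_notMem hP j) h

theorem word_drop_eq {P P' : List (List ℕ)} (hP : Proper 0 P) (hP' : Proper 0 P') {k : ℕ}
    (h : ∀ i, k ≤ i → ∀ r, entry 0 P' i r = entry 0 P i r) :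
    word (P'.drop k) = word (P.drop k) := by
  congr 1
  have hd : ∀ {M : List (List ℕ)}, Proper 0 M → Proper 0 (M.drop k) :=
    fun hM C hC => hM C (List.mem_of_mem_drop hC)
  refine (hd hP').ext (hd hP) ?_
  funext j r
  have := h (k + j) (by omega) r
  simpa [entry] using this

theorem mem_getD_of_entry {P : List (List ℕ)} {j r : ℕ} (h : 0 < entry 0 P j r) :
    entry 0 P j r ∈ P.getD j [] := by
  unfold entry at *
  by_cases hr : r < (P.getD j []).length
  · rw [List.getD_eq_getElem _ _ hr]; exact List.getElem_mem hr
  · rw [List.getD_eq_default _ _ (not_lt.1 hr)] at h; exact absurd h (lt_irrefl _)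

theorem IsDecreasing.pairwise_getD {P : List (List ℕ)} (h : IsDecreasing P) (j : ℕ) :
    (P.getD j []).Pairwise (fun a b => b < a) := by
  by_cases hj : j < P.length
  · rw [List.getD_eq_getElem _ _ hj]; exact h.pairwise (List.getElem_mem hj)
  · rw [List.getD_eq_default _ _ (not_lt.1 hj)]; simp

section Insertion

variable {P P' : List (List ℕ)} {x : ℕ} {q o : ℕ → ℕ} {c : ℕ}

/-- The effect of the insertion into a single column, for the operation `⋆`. -/
theorem Trace.foldl_star_column (hP : IsDecreasing P) (hP' : IsDecreasing P')
    (h : Trace (entry 0 P) (entry 0 P') x q o c) {j : ℕ} (hj : j ≤ c) (ho : 0 < o j) {S : Finset ℕ}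
    (hS : o j = entry 0 P' j (q j) ∨ o j ∈ S ∨ (S = ∅ ∧ 0 < o (j + 1))) :
    (P.getD j []).reverse.foldl star (star S (o j)) =
      if o (j + 1) = 0 then (P'.getD j []).reverse.foldl star S
      else star ((P'.getD j []).reverse.foldl star S) (o (j + 1)) := by
  have hpw := hP.pairwise_getD j
  have hpw' := hP'.pairwise_getD j
  have h0 := getD_notMem hP.proper j
  have h0' := getD_notMem hP'.proper j
  rcases h.step j hj with hr | hr
  · have e := h.eq_of_replaces hj hr
    have hget : ∀ r, (P'.getD j []).getD r 0 = if r = q j then o j else (P.getD j []).getD r 0 := by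
      intro r
      split_ifs with hrq
      · rw [hrq, e]; rfl
      · exact hr.2.1 r hrq
    split_ifs with hz
    · have hlen : (P.getD j []).length = q j := by
        have h1 := hr.2.2
        rw [hz] at h1
        have h2 := mt (getD_ne_iff h0 (q j)).2 (by simpa [entry] using h1.symm)
        refine le_antisymm (not_lt.1 h2) ?_
        by_contra hcon
        have h3 := (getD_ne_iff h0' (q j)).1 (by have := hget (q j); simp at this ⊢; omega)
        have h4 := (getD_ne_iff h0' ((P.getD j []).length)).2 (by omega)
        rw [hget, if_neg (by omega), List.getD_eq_default _ _ le_rfl] at h4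
        exact h4 rfl
      have : P'.getD j [] = P.getD j [] ++ [o j] := by
        refine getD_ext h0' (by simpa using ⟨by simpa using h0, ho.ne⟩) fun r => ?_
        rw [hget, getD_append_singleton, hlen]
      rw [this, List.reverse_append]
      rfl
    · have hq : q j < (P.getD j []).length := (getD_ne_iff h0 (q j)).1 (by
        rw [hr.2.2] at hz; exact hz)
      have hC : P.getD j [] = (P.getD j []).take (q j) ++ o (j + 1) :: (P.getD j []).drop (q j + 1) := by
        have : o (j + 1) = (P.getD j [])[q j] := by
          rw [hr.2.2]; exact List.getD_eq_getElem _ _ hq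
        rw [this, ← List.drop_eq_getElem_cons hq, List.take_append_drop]
      have hC' : P'.getD j [] = (P.getD j []).take (q j) ++ o j :: (P.getD j []).drop (q j + 1) := by
        rw [← List.set_eq_take_cons_drop _ hq]
        refine getD_ext h0' ?_ fun r => ?_
        · intro hm
          rcases List.mem_or_eq_of_mem_set hm with h1 | h1
          · exact h0 h1
          · omega
        · rw [hget, List.getD_eq_getElem?_getD (l := (P.getD j []).set _ _), List.getElem?_set]
          split_ifs with h1 h2 h2
          · rfl
          · exact absurd h1.symm h2
          · exact absurd h2.symm h1
          · rw [List.getD_eq_getElem?_getD]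
      rw [hC']
      rw [hC'] at hpw'
      nth_rw 1 [hC]
      rw [hC] at hpw
      refine foldl_star_replace (by simpa using hpw) ?_ ?_
      · rw [hr.2.2, e]; exact hr.1
      · intro a ha
        exact (List.pairwise_append.1 hpw').2.2 a ha (o j) (by simp)
  · have hC : P'.getD j [] = P.getD j [] := getD_eq_of_entry hP.proper hP'.proper hr.1
    rw [hC]
    -- In a kept column the input must be idle. The alternatives in `hS` are three reasons: it is an
    -- entry of the column, it is already in the set, or it meets an empty set and is replaced at
    -- once.
    have hx : (P.getD j []).reverse.foldl star (star S (o j)) = (P.getD j []).reverse.foldl star S := by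
      rcases hS with hS | hS | ⟨rfl, hS⟩
      · refine foldl_star_absorb hpw ?_
        rw [hS, ← hC]
        exact mem_getD_of_entry (h.pos hj)
      · rw [star_eq_self hS]
      · refine foldl_star_empty hpw (y := o (j + 1)) ?_ ?_
        · rw [hr.2.2]; exact mem_getD_of_entry (by rw [← hr.2.2]; exact hS)
        · have := h.next_lt hj; omega
    rw [hx]
    split_ifs with hz
    · rfl
    · rw [star_eq_self]
      refine mem_foldl_star_of_mem (by rw [List.pairwise_reverse]; exact hpw) ?_
      rw [List.mem_reverse, hr.2.2]
      exact mem_getD_of_entry (by rw [← hr.2.2]; omega)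

/-- The number is carried past one column at a time. After a `KeepsTwo` link the next number need
not be an entry of the next column, but it is an entry of the column just read and so belongs to the
current set, where it is idle. -/
theorem Trace.foldl_star_word (hP : IsDecreasing P) (hP' : IsDecreasing P')
    (h : Trace (entry 0 P) (entry 0 P') x q o c) (d : ℕ) : ∀ {j : ℕ}, c = j + d → 0 < o j →
      ∀ {S : Finset ℕ}, o j = entry 0 P' j (q j) ∨ o j ∈ S ∨ (S = ∅ ∧ 0 < o (j + 1)) →
      (word (P'.drop j)).foldl star S = (word (P.drop j)).foldl star (star S (o j)) := by
  induction d with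
  | zero =>
    intro j hj ho S hS
    have h1 := h.foldl_star_column hP hP' (j := j) (by omega) ho hS
    have hz : o (j + 1) = 0 := by rw [← h.last_eq_zero, hj]
    rw [if_pos hz] at h1
    rw [word_drop P, word_drop P', List.foldl_append, List.foldl_append, h1,
      word_drop_eq hP.proper hP'.proper fun i hi r => h.eq_of_zero hz hi r]
  | succ d ih =>
    intro j hj ho S hS
    have h1 := h.foldl_star_column hP hP' (j := j) (by omega) ho hS
    rw [word_drop P, word_drop P', List.foldl_append, List.foldl_append, h1]
    split_ifs with hz
    · rw [word_drop_eq hP.proper hP'.proper fun i hi r => h.eq_of_zero hz hi r]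
    · refine ih (by omega) (Nat.pos_of_ne_zero hz) ?_
      rcases h.link j (by omega) with h2 | ⟨h2, h3, h4, h5⟩
      · exact Or.inl h2
      · right; left
        refine mem_foldl_star_of_mem (by rw [List.pairwise_reverse]; exact hP'.pairwise_getD j) ?_
        rw [List.mem_reverse, h2.2.2, ← h2.1]
        exact mem_getD_of_entry (by rw [h2.1, ← h2.2.2]; omega)

/-- The columns of the right key before and after an insertion: a column changes at most by inserting
a number in front of its word. -/
theorem Trace.rightKey_column (hP : IsDecreasing P) (hP' : IsDecreasing P')
    (h : Trace (entry 0 P) (entry 0 P') x q o c) (j : ℕ) :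
    (word (P'.drop j)).foldl star ∅ = (word (P.drop j)).foldl star ∅ ∨
      j ≤ c ∧ (word (P'.drop j)).foldl star ∅ = (word (P.drop j)).foldl star {o j} := by
  have heq := fun k (hk : ∀ i, k ≤ i → ∀ r, entry 0 P' i r = entry 0 P i r) =>
    congrArg (fun w => List.foldl star ∅ w) (word_drop_eq hP.proper hP'.proper hk)
  by_cases hj : j ≤ c
  swap
  · exact Or.inl (heq j fun i hi r => h.beyond i (by omega) r)
  rcases Nat.eq_zero_or_pos (o j) with hz | hpos
  · exact Or.inl (heq j fun i hi r => h.eq_of_zero hz hi r)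
  by_cases hc : o j = entry 0 P' j (q j) ∨ 0 < o (j + 1)
  · refine Or.inr ⟨hj, ?_⟩
    rw [h.foldl_star_word hP hP' (c - j) (by omega) hpos (hc.imp id fun h => Or.inr ⟨rfl, h⟩)]
    rfl
  -- The input differs from the number read backwards and there is no output: the link is
  -- `KeepsTwo`, and nothing changes from this column on.
  · push Not at hc
    obtain ⟨i, rfl, hk⟩ := h.keepsTwo hj hc.1
    refine Or.inl (heq _ fun k hk' r => ?_)
    rcases hk'.eq_or_lt with rfl | hlt
    · exact hk.2.1.1 r
    · exact h.eq_of_zero (k := i + 1 + 1) (by omega) hlt r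

theorem Trace.rightKey_zero (hP : IsDecreasing P) (hP' : IsDecreasing P')
    (h : Trace (entry 0 P) (entry 0 P') x q o c) (hx : 0 < x) :
    (word P').foldl star ∅ = (word P).foldl star {x} := by
  have h0 : 0 < o 0 := by rw [h.start]; exact hx
  have := h.foldl_star_word hP hP' c (j := 0) (by omega) h0 (S := ∅)
    (Or.inl (h.start.trans h.start_eq))
  rw [h.start] at this
  exact this

/-- A column of the right key changes only if the length of the column changes. -/
theorem Trace.rightKey_eq (hP : IsDecreasing P) (hP' : IsDecreasing P')
    (h : Trace (entry 0 P) (entry 0 P') x q o c) {j : ℕ}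
    (hj : (P'.getD j []).length = (P.getD j []).length) :
    (word (P'.drop j)).foldl star ∅ = (word (P.drop j)).foldl star ∅ := by
  rcases h.rightKey_column hP hP' j with h1 | ⟨-, h1⟩
  · exact h1
  -- The letter in front is an extra element added to `∅`, so the two columns differ by at most one
  -- element; their sizes agree.
  · have h2 := foldl_star_insert (R := ∅) (T := ∅) (z := o j) (word (P.drop j))
      (by simp) (by simp)
    rw [insert_empty_eq, ← h1] at h2
    rcases h2 with h2 | ⟨z, hz, h2, -⟩
    · exact h2
    · have h3 := card_rightKey hP j
      have h4 := card_rightKey hP' j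
      rw [h2, Finset.card_insert_of_notMem hz] at h4
      omega

/-- The new column of the right key when a box is added. -/
theorem Trace.rightKey_insert (hP : IsDecreasing P) (hP' : IsDecreasing P')
    (h : Trace (entry 0 P) (entry 0 P') x q o c) (hr : Replaces (entry 0 P) (entry 0 P') q o c) :
    ∃ z, z ∉ (word (P.drop c)).foldl star ∅ ∧
      (word (P'.drop c)).foldl star ∅ = insert z ((word (P.drop c)).foldl star ∅) ∧
      ∀ t ∈ (word (P.drop c)).foldl star ∅, t < z → t ∈ (word (P.drop (c + 1))).foldl star ∅ := by
  have ho : o c = entry 0 P' c (q c) := h.eq_of_replaces le_rfl hr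
  have hpos : 0 < o c := by rw [ho]; exact h.pos le_rfl
  have h1 := h.foldl_star_word hP hP' 0 rfl hpos (S := ∅) (Or.inl ho)
  have hpw := hP.pairwise_getD c
  have hpw' : (P.getD c []).reverse.Pairwise (· < ·) := by rw [List.pairwise_reverse]; exact hpw
  have hall : ∀ a ∈ P.getD c [], o c < a := by
    intro a ha
    obtain ⟨r, hr', rfl⟩ := List.getElem_of_mem ha
    have e1 : (P.getD c [])[r] = entry 0 P c r := (List.getD_eq_getElem _ _ hr').symm
    have hne := (hP.proper.entry_ne_iff c r).2 hr'
    have h2 : entry 0 P c (q c) = 0 := by rw [← hr.2.2, h.last_eq_zero]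
    have h3 : r < q c := by
      by_contra hcon
      have := h.old.col_le c (not_lt.1 hcon)
      omega
    have h4 := h.new.col_lt c h3
    have h5 := hr.2.1 r h3.ne
    rw [e1]
    omega
  have h2 : (P.getD c []).reverse.foldl star (star ∅ (o c)) =
      insert (o c) ((P.getD c []).reverse.foldl star ∅) := by
    rw [foldl_star_of_pairwise (S := ∅) hpw' (by simp), foldl_star_of_pairwise hpw']
    · ext y; simp [star]
    · intro m hm s hs
      have : s = o c := by simpa [star] using hs
      rw [this]
      exact hall m (by simpa using hm)
  have hnot : o c ∉ (P.getD c []).reverse.foldl star ∅ := by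
    rw [foldl_star_of_pairwise hpw' (by simp)]
    intro hm
    have := hall (o c) (by simpa using hm)
    omega
  -- The new box is at the bottom of its column, so no element is less than `o c` and the
  -- accompanying set can start as `∅`. It ends as column `c + 1` of the right key.
  have h3 := foldl_star_insert (R := ∅) (word (P.drop (c + 1))) hnot (by
    intro t ht htc
    rw [foldl_star_of_pairwise hpw' (by simp)] at ht
    have := hall t (by simpa using ht)
    omega)
  rw [← h2, ← List.foldl_append, ← List.foldl_append, ← word_drop, ← h1] at h3
  rcases h3 with h3 | h3
  · exfalso
    have h4 := card_rightKey hP c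
    have h5 := card_rightKey hP' c
    rw [h3, h4] at h5
    have h6 := (hP.proper.entry_ne_iff c (q c)).2
    have h7 := (hP'.proper.entry_ne_iff c (q c)).1 (h.pos le_rfl).ne'
    have h8 : entry 0 P c (q c) = 0 := by rw [← hr.2.2, h.last_eq_zero]
    exact h6 (by omega) h8
  · exact h3

end Insertion

/-! ### The operation `◁` -/

/-- Remove the smallest element that is at least `a`, if there is one. -/
def park (S : Finset ℕ) (a : ℕ) : Finset ℕ :=
  S.filter (fun b => b < a ∨ ∃ s ∈ S, a ≤ s ∧ s < b)

theorem mem_park {S : Finset ℕ} {a x : ℕ} :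
    x ∈ park S a ↔ x ∈ S ∧ (x < a ∨ ∃ s ∈ S, a ≤ s ∧ s < x) := by
  rw [park, Finset.mem_filter]

theorem park_subset (S : Finset ℕ) (a : ℕ) : park S a ⊆ S := Finset.filter_subset _ _

theorem park_of_forall_lt {S : Finset ℕ} {a : ℕ} (h : ∀ s ∈ S, s < a) : park S a = S := by
  ext x; rw [mem_park]; grind

theorem park_of_mem {S : Finset ℕ} {a b : ℕ} (hb : b ∈ S) (hab : a ≤ b)
    (hmin : ∀ s ∈ S, a ≤ s → b ≤ s) : park S a = S.erase b := by
  ext x; rw [mem_park, Finset.mem_erase]; grind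

/-- As for parking functions, the occupied places do not depend on the order in which the requests
arrive. -/
theorem park_comm (S : Finset ℕ) (a b : ℕ) : park (park S a) b = park (park S b) a := by
  wlog hab : a ≤ b
  · exact (this S b a (le_of_not_ge hab)).symm
  rcases star_cases S a with h | ⟨s, hs, has, hmin⟩
  · have h' : ∀ s ∈ S, s < b := fun s hs => (h s hs).trans_le hab
    rw [park_of_forall_lt h, park_of_forall_lt h', park_of_forall_lt h]
  rcases star_cases S b with h' | ⟨t, ht, hbt, hmin'⟩
  · rw [park_of_forall_lt h', park_of_forall_lt fun s hs => h' s (park_subset _ _ hs)]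
  rw [park_of_mem hs has hmin, park_of_mem ht hbt hmin']
  by_cases hst : s = t
  · subst hst
    ext x
    simp only [mem_park, Finset.mem_erase]
    grind
  · rw [park_of_mem (b := t) (by simp [Ne.symm hst, ht]) hbt (by simp; grind),
      park_of_mem (b := s) (by simp [hst, hs]) has (by simp; grind), Finset.erase_right_comm]

theorem foldl_park_subset (S : Finset ℕ) (l : List ℕ) : l.foldl park S ⊆ S := by
  induction l generalizing S with
  | nil => exact subset_rfl
  | cons a l ih => exact (ih _).trans (park_subset S a)

theorem foldl_park_of_forall_lt {S : Finset ℕ} {l : List ℕ} (h : ∀ a ∈ l, ∀ s ∈ S, s < a) :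
    l.foldl park S = S := by
  induction l with
  | nil => rfl
  | cons a l ih =>
    rw [List.foldl_cons, park_of_forall_lt (h a (by simp)), ih fun b hb => h b (by simp [hb])]

theorem mem_foldl_park {S : Finset ℕ} {l : List ℕ} {x : ℕ} (hx : x ∈ S) (h : ∀ a ∈ l, x < a) :
    x ∈ l.foldl park S := by
  induction l generalizing S with
  | nil => exact hx
  | cons a l ih =>
    exact ih (mem_park.2 ⟨hx, Or.inl (h a (by simp))⟩) fun b hb => h b (by simp [hb])

/-- Since `l` increases, the elements that the greedy selection discards are below all later
requests. The set `F` may retain them, and what is selected is the set of occupied places. -/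
theorem selectAbove_eq {C F : Finset ℕ} {l : List ℕ} (hl : l.Pairwise (· < ·))
    (h : ∀ a ∈ l, ∀ x, a ≤ x → (x ∈ C ↔ x ∈ F)) : selectAbove C l = F \ l.foldl park F := by
  induction l generalizing C F with
  | nil => simp [selectAbove]
  | cons a l ih =>
    rw [List.pairwise_cons] at hl
    have ha := h a (by simp)
    unfold selectAbove
    split_ifs with hne
    · have hb := Finset.min'_mem _ hne
      have hmin : ∀ x ∈ C.filter (fun b => a ≤ b), (C.filter (fun b => a ≤ b)).min' hne ≤ x :=
        fun x hx => Finset.min'_le _ x hx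
      generalize (C.filter (fun b => a ≤ b)).min' hne = b at hb hmin
      simp only [Finset.mem_filter] at hb hmin
      have hbF := (ha b hb.2).1 hb.1
      rw [List.foldl_cons, park_of_mem hbF hb.2 fun s hs has => hmin s ⟨(ha s has).2 hs, has⟩,
        ih (F := F.erase b) hl.2]
      · have := foldl_park_subset (F.erase b) l
        ext x
        simp only [Finset.mem_insert, Finset.mem_sdiff, Finset.mem_erase]
        by_cases hxb : x = b
        · subst hxb
          have : x ∉ l.foldl park (F.erase x) := fun hx => by simpa using this hx
          tauto
        · tauto
      · intro a' ha' x hx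
        have h1 := hl.1 a' ha'
        have h2 := ha x (by omega)
        have h3 := hmin x
        simp only [Finset.mem_filter, Finset.mem_erase]
        constructor
        · rintro ⟨h4, h5⟩; exact ⟨by omega, h2.1 h4⟩
        · rintro ⟨h4, h5⟩
          have := h3 ⟨h2.2 h5, by omega⟩
          exact ⟨h2.2 h5, by omega⟩
    · rw [foldl_park_of_forall_lt, Finset.sdiff_self]
      intro a' ha' s hs
      by_contra hcon
      refine hne ⟨s, ?_⟩
      have : a ≤ s := by
        rcases List.mem_cons.1 ha' with rfl | ha'
        · omega
        · have := hl.1 a' ha'; omega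
      simp [this, (ha s this).2 hs]

theorem foldl_park_perm {l l' : List ℕ} (h : l.Perm l') (S : Finset ℕ) :
    l.foldl park S = l'.foldl park S :=
  haveI : RightCommutative park := ⟨park_comm⟩
  h.foldl_eq S

theorem tri_eq {C A : Finset ℕ} {l : List ℕ} (hl : l.Nodup) (hA : l.toFinset = A) :
    tri C A = C \ l.foldl park C := by
  unfold tri
  rw [selectAbove_eq (F := C) A.sortedLT_sort.pairwise fun _ _ _ _ => Iff.rfl]
  congr 1
  refine foldl_park_perm ?_ C
  refine List.perm_of_nodup_nodup_toFinset_eq (A.sort_nodup _) hl ?_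
  rw [Finset.sort_toFinset, hA]

theorem tri_subset (C A : Finset ℕ) : tri C A ⊆ C := by
  rw [tri_eq (A.nodup_toList) (Finset.toList_toFinset A)]
  exact Finset.sdiff_subset

/-- The requests in `A` may be served first. -/
theorem tri_union {C A B : Finset ℕ} (h : A ⊆ B) :
    tri C B = C \ (B \ A).toList.foldl park (C \ tri C A) := by
  rw [tri_eq (A.nodup_toList) (Finset.toList_toFinset A),
    tri_eq (C := C) (A := B) (l := A.toList ++ (B \ A).toList), List.foldl_append,
    Finset.sdiff_sdiff_eq_self (foldl_park_subset _ _)]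
  · rw [List.nodup_append]
    refine ⟨A.nodup_toList, Finset.nodup_toList _, fun a ha b hb => ?_⟩
    rintro rfl
    simp only [Finset.mem_toList, Finset.mem_sdiff] at ha hb
    exact hb.2 ha
  · rw [List.toFinset_append, Finset.toList_toFinset, Finset.toList_toFinset,
      Finset.union_sdiff_of_subset h]

theorem tri_mono {A B : Finset ℕ} (h : A ⊆ B) (C : Finset ℕ) : tri C A ⊆ tri C B := by
  rw [tri_union h]
  intro x hx
  refine Finset.mem_sdiff.2 ⟨tri_subset C A hx, fun h => ?_⟩
  exact (Finset.mem_sdiff.1 (foldl_park_subset _ _ h)).2 hx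

/-- Requests that are at least `d` never occupy a place less than `d`. -/
theorem mem_tri_of_lt {A B C : Finset ℕ} (h : A ⊆ B) {d : ℕ} (hd : ∀ b ∈ B, b ∉ A → d ≤ b) {v : ℕ}
    (hv : v ∈ tri C B) (hvd : v < d) : v ∈ tri C A := by
  by_contra hcon
  have hC := tri_subset C B hv
  rw [tri_union h, Finset.mem_sdiff] at hv
  refine hv.2 (mem_foldl_park (Finset.mem_sdiff.2 ⟨hC, hcon⟩) fun a ha => ?_)
  rw [Finset.mem_toList, Finset.mem_sdiff] at ha
  exact hvd.trans_le (hd a ha.1 ha.2)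

/-- The request `d` may be served last. It occupies the smallest free place that is at least `d`, if
there is one. -/
theorem tri_insert {A C : Finset ℕ} {d : ℕ} (hd : d ∉ A) : tri C (insert d A) = tri C A ∨
    ∃ d', d' ∉ tri C A ∧ d ≤ d' ∧ tri C (insert d A) = insert d' (tri C A) ∧
      ∀ v ∈ C, d ≤ v → v < d' → v ∈ tri C A := by
  have h1 : (insert d A \ A).toList = [d] := by
    rw [Finset.insert_sdiff_of_notMem _ hd, Finset.sdiff_self]; simp
  have hs := tri_subset C A
  rw [tri_union (Finset.subset_insert d A), h1, List.foldl_cons, List.foldl_nil]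
  rcases star_cases (C \ tri C A) d with h | ⟨b, hb, hdb, hmin⟩
  · left
    rw [park_of_forall_lt h, Finset.sdiff_sdiff_eq_self hs]
  · right
    rw [Finset.mem_sdiff] at hb
    refine ⟨b, hb.2, hdb, ?_, fun v hv hdv hvb => ?_⟩
    · rw [park_of_mem (Finset.mem_sdiff.2 hb) hdb hmin]
      ext x
      have := @hs x
      simp only [Finset.mem_sdiff, Finset.mem_erase, Finset.mem_insert]
      by_cases hxb : x = b
      · subst hxb; tauto
      · tauto
    · by_contra hcon
      have := hmin v (Finset.mem_sdiff.2 ⟨hv, hcon⟩) hdv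
      omega

theorem tri_insert_left {A C : Finset ℕ} {y : ℕ} (h : ∀ a ∈ A, y < a) :
    tri (insert y C) A = tri C A := by
  unfold tri
  rcases hl : A.sort (· ≤ ·) with _ | ⟨a, l⟩
  · rfl
  · have ha : y < a := h a (by rw [← Finset.mem_sort (· ≤ ·), hl]; simp)
    have : (insert y C).filter (fun b => a ≤ b) = C.filter (fun b => a ≤ b) := by
      rw [Finset.filter_insert, if_neg (by omega)]
    unfold selectAbove
    simp only [this]
    split_ifs with hne
    · have hb := Finset.min'_mem _ hne
      generalize (C.filter (fun b => a ≤ b)).min' hne = b at hb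
      rw [Finset.mem_filter] at hb
      rw [Finset.filter_insert, if_neg (by omega)]
    · rfl

/-- Every element of `D` is at most an element of `C`, in a strictly increasing way. -/
def Dominates (C D : Finset ℕ) : Prop :=
  ∃ f : ℕ → ℕ, StrictMonoOn f D ∧ ∀ a ∈ D, f a ∈ C ∧ a ≤ f a

/-- The greedy choices are at most the values of `f`, so a choice is always possible. -/
theorem card_selectAbove {C : Finset ℕ} {l : List ℕ} (hl : l.Pairwise (· < ·)) {f : ℕ → ℕ}
    (hf : ∀ a ∈ l, ∀ b ∈ l, a < b → f a < f b) (h : ∀ a ∈ l, f a ∈ C ∧ a ≤ f a) :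
    (selectAbove C l).card = l.length ∧ selectAbove C l ⊆ C := by
  induction l generalizing C with
  | nil => simp [selectAbove]
  | cons a l ih =>
    rw [List.pairwise_cons] at hl
    obtain ⟨h1, h2⟩ := h a (by simp)
    have hne : (C.filter (fun b => a ≤ b)).Nonempty := ⟨f a, by simp [h1, h2]⟩
    unfold selectAbove
    rw [dif_pos hne]
    have hb := Finset.min'_mem _ hne
    have hmin := Finset.min'_le (C.filter (fun b => a ≤ b)) (f a) (by simp [h1, h2])
    generalize (C.filter (fun b => a ≤ b)).min' hne = b at hb hmin
    rw [Finset.mem_filter] at hb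
    obtain ⟨h3, h4⟩ := ih (C := C.filter (fun x => b < x)) hl.2
      (fun x hx z hz => hf x (by simp [hx]) z (by simp [hz])) (fun x hx => by
        have := hf a (by simp) x (by simp [hx]) (hl.1 x hx)
        have := h x (by simp [hx])
        exact ⟨by simp [this]; omega, this.2⟩)
    refine ⟨?_, Finset.insert_subset hb.1 (h4.trans (Finset.filter_subset _ _))⟩
    rw [Finset.card_insert_of_notMem, h3, List.length_cons]
    intro hcon
    simpa using h4 hcon

theorem Dominates.card_tri {C D A : Finset ℕ} (h : Dominates C D) (hA : A ⊆ D) :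
    (tri C A).card = A.card := by
  obtain ⟨f, h1, h2⟩ := h
  have hm : ∀ a ∈ A.sort (· ≤ ·), a ∈ D := fun a ha => hA ((Finset.mem_sort _).1 ha)
  rw [tri, (card_selectAbove A.sortedLT_sort.pairwise
    (fun a ha b hb hab => h1 (hm a ha) (hm b hb) hab) fun a ha => h2 a (hm a ha)).1,
    Finset.length_sort]

/-! ### The columns of the left key -/

/-- `C₀ ◁ (C₁ ◁ (⋯ ◁ A))`, for the first `k` sets of a sequence of sets. -/
def triChain (C : ℕ → Finset ℕ) : ℕ → Finset ℕ → Finset ℕ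
  | 0, A => A
  | k + 1, A => triChain C k (tri (C k) A)

theorem triAll_concat (T : List (List ℕ)) (C : List ℕ) :
    triAll (T ++ [C]) = T.foldr (fun D A => tri D.toFinset A) C.toFinset := by
  induction T with
  | nil => rfl
  | cons D T ih =>
    rw [List.foldr_cons, ← ih]
    cases T <;> rfl

theorem triChain_eq_foldr (T : List (List ℕ)) {k : ℕ} (hk : k ≤ T.length) (A : Finset ℕ) :
    triChain (fun j => (T.getD j []).toFinset) k A =
      (T.take k).foldr (fun D A => tri D.toFinset A) A := by
  induction k generalizing A with
  | zero => simp [triChain]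
  | succ k ih =>
    rw [List.take_succ_eq_append_getElem (by omega), List.foldr_append]
    unfold triChain
    rw [ih (by omega), List.getD_eq_getElem _ _ (by omega)]
    rfl

theorem leftKey_eq (T : List (List ℕ)) : leftKey T = (List.range T.length).map (fun j =>
    triChain (fun j => (T.getD j []).toFinset) j (T.getD j []).toFinset) := by
  refine List.map_congr_left fun j hj => ?_
  rw [List.mem_range] at hj
  rw [List.take_succ_eq_append_getElem hj, triAll_concat, triChain_eq_foldr T hj.le,
    List.getD_eq_getElem _ _ hj]

section Chain

variable {C C' : ℕ → Finset ℕ}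

theorem triChain_mono {A B : Finset ℕ} (h : A ⊆ B) (k : ℕ) : triChain C k A ⊆ triChain C k B := by
  induction k generalizing A B with
  | zero => exact h
  | succ k ih => exact ih (tri_mono h _)

theorem triChain_succ_subset (k : ℕ) :
    triChain C (k + 1) (C (k + 1)) ⊆ triChain C k (C k) := triChain_mono (tri_subset _ _) k

theorem card_triChain (hC : ∀ k, Dominates (C k) (C (k + 1))) {A : Finset ℕ} {k : ℕ}
    (h : A ⊆ C k) : (triChain C k A).card = A.card := by
  induction k generalizing A with
  | zero => rfl
  | succ k ih => exact (ih (tri_subset _ _)).trans ((hC k).card_tri h)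

theorem triChain_congr {k : ℕ} (h : ∀ j < k, C' j = C j) (A : Finset ℕ) :
    triChain C' k A = triChain C k A := by
  induction k generalizing A with
  | zero => rfl
  | succ k ih =>
    unfold triChain
    rw [h k (by omega), ih fun j hj => h j (by omega)]

/-- The added element `y` is less than every request that reaches column `c` from the right, so it
is never occupied. -/
theorem triChain_eq_of_lt {c y : ℕ} (hc : C' c = insert y (C c)) (hne : ∀ j ≠ c, C' j = C j)
    (hy : ∀ a ∈ C (c + 1), y < a) {k : ℕ} (hk : c < k) {A : Finset ℕ} (hA : A ⊆ C k) :
    triChain C' k A = triChain C k A := by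
  induction k generalizing A with
  | zero => omega
  | succ k ih =>
    unfold triChain
    rcases (Nat.lt_succ_iff.1 hk).eq_or_lt with rfl | hlt
    · rw [hc, tri_insert_left fun a ha => hy a (hA ha), triChain_congr fun j hj => hne j hj.ne]
    · rw [hne k hlt.ne', ih hlt (tri_subset _ _)]

/-- The extra request is passed on from column to column. The places below the new extra one stay
occupied: those less than `d` because the requests in `B` outside `A` are too large to occupy them,
those from `d` on because the extra request found them occupied. -/
theorem triChain_insert {k : ℕ} {A B : Finset ℕ} {d y : ℕ} (hd : d ∉ A) (hyd : y ≤ d)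
    (hAB : A ⊆ B) (hB : ∀ v ∈ B, v < d → v ∈ A) : triChain C k (insert d A) = triChain C k A ∨
      ∃ d', d' ∉ triChain C k A ∧ y ≤ d' ∧ triChain C k (insert d A) = insert d' (triChain C k A) ∧
        ∀ v ∈ triChain C k B, v < d' → v ∈ triChain C k A := by
  induction k generalizing A B d with
  | zero => exact Or.inr ⟨d, hd, hyd, rfl, hB⟩
  | succ k ih =>
    unfold triChain
    rcases tri_insert (C := C k) hd with h | ⟨d', h1, h2, h3, h4⟩
    · exact Or.inl (by rw [h])
    · rw [h3]
      refine ih h1 (hyd.trans h2) (tri_mono hAB _) fun v hv hvd => ?_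
      rcases lt_or_ge v d with h5 | h5
      · refine mem_tri_of_lt hAB (d := d) (fun b hb hbA => ?_) hv h5
        by_contra hcon
        exact hbA (hB b hb (not_le.1 hcon))
      · exact h4 v (tri_subset _ _ hv) h5 hvd

/-- The new column of the left key when a minimal number is added to a column. -/
theorem triChain_column_insert {c y : ℕ} (hC : ∀ k, Dominates (C k) (C (k + 1)))
    (hC' : ∀ k, Dominates (C' k) (C' (k + 1))) (hc : C' c = insert y (C c)) (hyc : y ∉ C c)
    (hne : ∀ j ≠ c, C' j = C j) (hy : ∀ j, ∀ a ∈ C j, y ≤ a) :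
    ∃ d, d ∉ triChain C c (C c) ∧ y ≤ d ∧
      triChain C' c (C' c) = insert d (triChain C c (C c)) ∧
      (c = 0 → d = y) ∧ ∀ b, c = b + 1 → ∀ v ∈ triChain C b (C b), v < d → v ∈ triChain C c (C c) := by
  -- Comparison of sizes excludes that the extra request is lost on the way.
  have hcard : (triChain C' c (C' c)).card = (triChain C c (C c)).card + 1 := by
    rw [card_triChain hC subset_rfl, card_triChain hC' subset_rfl, hc,
      Finset.card_insert_of_notMem hyc]
  rw [triChain_congr fun j hj => hne j hj.ne, hc] at hcard ⊢
  cases c with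
  | zero => exact ⟨y, hyc, le_rfl, rfl, fun _ => rfl, fun b hb => by omega⟩
  | succ b =>
    rw [triChain, triChain] at hcard
    rw [triChain, triChain]
    rcases tri_insert (C := C b) hyc with h | ⟨d', h1, h2, h3, h4⟩
    · rw [h] at hcard; omega
    · rw [h3] at hcard ⊢
      -- As `y` is minimal, all elements of `C b` less than `d'` were found occupied by the request
      -- `y`, so `B = C b` is admissible.
      rcases triChain_insert (C := C) (k := b) h1 h2 (tri_subset _ _)
        (fun v hv hvd => h4 v hv (hy b v hv) hvd) with h | ⟨d, h5, h6, h7, h8⟩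
      · rw [h] at hcard; omega
      · refine ⟨d, h5, h6, h7, fun h => by omega, fun b' hb' => ?_⟩
        obtain rfl : b = b' := by omega
        exact h8

end Chain

/-! ### The columns of `L(Q)` -/

/-- The set of entries in column `j` of `L(Q)`. -/
def maxCol (Q : List (List (Finset ℕ))) (j : ℕ) : Finset ℕ :=
  (Finset.range (Q.getD j []).length).image (fun r => (entry ∅ Q j r).sup id)

theorem toFinset_maxTableau (Q : List (List (Finset ℕ))) (j : ℕ) :
    ((maxTableau Q).getD j []).toFinset = maxCol Q j := by
  have h : (maxTableau Q).getD j [] = (Q.getD j []).map (fun S => S.sup id) := by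
    simp only [maxTableau, List.getD_eq_getElem?_getD, List.getElem?_map]
    cases Q[j]? <;> rfl
  rw [h]
  ext a
  simp only [maxCol, List.mem_toFinset, List.mem_map, Finset.mem_image, Finset.mem_range, entry]
  constructor
  · rintro ⟨S, hS, rfl⟩
    obtain ⟨r, hr, rfl⟩ := List.getElem_of_mem hS
    exact ⟨r, hr, by rw [List.getD_eq_getElem _ _ hr]⟩
  · rintro ⟨r, hr, rfl⟩
    exact ⟨_, List.getElem_mem hr, by rw [List.getD_eq_getElem _ _ hr]⟩

theorem mem_maxCol {Q : List (List (Finset ℕ))} (h : Proper ∅ Q) {j a : ℕ} :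
    a ∈ maxCol Q j ↔ ∃ r, entry ∅ Q j r ≠ ∅ ∧ (entry ∅ Q j r).sup id = a := by
  simp only [maxCol, Finset.mem_image, Finset.mem_range, h.entry_ne_iff]

theorem sup_id_mem {S : Finset ℕ} (h : S ≠ ∅) : S.sup id ∈ S := by
  obtain ⟨x, hx, he⟩ := Finset.exists_mem_eq_sup S (Finset.nonempty_iff_ne_empty.2 h) id
  rw [he]; exact hx

theorem IsRSVT.sup_lt {Q : List (List (Finset ℕ))} (h : IsRSVT Q) {j r s : ℕ} (hrs : r < s)
    (hs : entry ∅ Q j s ≠ ∅) : (entry ∅ Q j s).sup id < (entry ∅ Q j r).sup id := by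
  have hlt := (h.proper.entry_ne_iff j s).1 hs
  have hstep : ∀ k, k + 1 ≤ s → (entry ∅ Q j (k + 1)).sup id < (entry ∅ Q j k).sup id := by
    intro k hk
    exact ((isRSVT_iff h.proper).1 h).2.2.2 j k _
      (sup_id_mem ((h.proper.entry_ne_iff j k).2 (by omega))) _
      (sup_id_mem ((h.proper.entry_ne_iff j (k + 1)).2 (by omega)))
  clear hs hlt
  induction s, hrs using Nat.le_induction with
  | base => exact hstep r le_rfl
  | succ s hs ih => exact (hstep s le_rfl).trans (ih fun k hk => hstep k (by omega))

theorem IsRSVT.card_maxCol {Q : List (List (Finset ℕ))} (h : IsRSVT Q) (j : ℕ) :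
    (maxCol Q j).card = (Q.getD j []).length := by
  rw [maxCol, Finset.card_image_of_injOn, Finset.card_range]
  intro r hr s hs he
  simp only [Finset.coe_range, Set.mem_Iio, ← h.proper.entry_ne_iff] at hr hs
  dsimp only at he
  rcases lt_trichotomy r s with h1 | h1 | h1
  · exact absurd he (h.sup_lt h1 hs).ne'
  · exact h1
  · exact absurd he (h.sup_lt h1 hr).ne

/-- The increasing map sends an entry of column `j + 1` of `L(Q)` to its left neighbour. -/
theorem IsRSVT.dominates {Q : List (List (Finset ℕ))} (h : IsRSVT Q) (j : ℕ) :
    Dominates (maxCol Q j) (maxCol Q (j + 1)) := by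
  have hex : ∀ a, ∃ r, a ∈ maxCol Q (j + 1) →
      entry ∅ Q (j + 1) r ≠ ∅ ∧ (entry ∅ Q (j + 1) r).sup id = a := by
    intro a
    by_cases ha : a ∈ maxCol Q (j + 1)
    · obtain ⟨r, hr⟩ := (mem_maxCol h.proper).1 ha
      exact ⟨r, fun _ => hr⟩
    · exact ⟨0, fun h => absurd h ha⟩
  choose row hrow using hex
  obtain ⟨-, h2, h3, -⟩ := (isRSVT_iff h.proper).1 h
  refine ⟨fun a => (entry ∅ Q j (row a)).sup id, fun a ha b hb hab => ?_, fun a ha => ⟨?_, ?_⟩⟩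
  · obtain ⟨ha1, ha2⟩ := hrow a ha
    obtain ⟨hb1, hb2⟩ := hrow b hb
    refine h.sup_lt ?_ (h2 j _ ha1)
    by_contra hcon
    rcases (not_lt.1 hcon).eq_or_lt with he | hlt
    · rw [he] at ha2; omega
    · have := h.sup_lt hlt hb1; omega
  · exact (mem_maxCol h.proper).2 ⟨_, h2 j _ (hrow a ha).1, rfl⟩
  · obtain ⟨ha1, ha2⟩ := hrow a ha
    have := h3 j _ _ (sup_id_mem (h2 j _ ha1)) _ (sup_id_mem ha1)
    rwa [ha2] at this

/-! ### The order on keys -/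

/-- The number of elements less than `t`. -/
def countLT (S : Finset ℕ) (t : ℕ) : ℕ := (S.filter (fun s => s < t)).card

theorem countLT_mono {S T : Finset ℕ} (h : S ⊆ T) (t : ℕ) : countLT S t ≤ countLT T t :=
  Finset.card_le_card (Finset.filter_subset_filter _ h)

theorem countLT_le_of_forall {S T : Finset ℕ} {t : ℕ} (h : ∀ s ∈ S, s < t → s ∈ T) :
    countLT S t ≤ countLT T t :=
  Finset.card_le_card fun s hs => by
    rw [Finset.mem_filter] at *
    exact ⟨h s hs.1 hs.2, hs.2⟩

theorem countLT_insert {S : Finset ℕ} {z : ℕ} (h : z ∉ S) (t : ℕ) :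
    countLT (insert z S) t = countLT S t + if z < t then 1 else 0 := by
  unfold countLT
  rw [Finset.filter_insert]
  split_ifs
  · rw [Finset.card_insert_of_notMem (by simp [h])]
  · rfl

theorem countLT_pos {S : Finset ℕ} {t : ℕ} : 0 < countLT S t ↔ ∃ s ∈ S, s < t := by
  rw [countLT, Finset.card_pos]
  simp [Finset.Nonempty]

/-- In an increasing list the `k`-th entry is less than `t` exactly if at least `k` entries are, so
entrywise comparison is comparison of counts. -/
theorem forall₂_le_iff {l m : List ℕ} (hl : l.Pairwise (· < ·)) (hm : m.Pairwise (· < ·)) :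
    List.Forall₂ (· ≤ ·) l m ↔ l.length = m.length ∧
      ∀ t, m.countP (fun s => s < t) ≤ l.countP (fun s => s < t) := by
  induction l generalizing m with
  | nil => cases m <;> simp
  | cons a l ih =>
    cases m with
    | nil => simp
    | cons b m =>
      have hl' := hl
      rw [List.pairwise_cons] at hl hm
      rw [List.forall₂_cons, ih hl.2 hm.2, List.length_cons, List.length_cons, Nat.add_right_cancel_iff]
      simp only [List.countP_cons, decide_eq_true_eq]
      constructor
      · rintro ⟨hab, hlen, h⟩
        refine ⟨hlen, fun t => ?_⟩
        have := h t
        split_ifs <;> omega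
      · rintro ⟨hlen, h⟩
        have hab : a ≤ b := by
          by_contra hcon
          have h1 := h (b + 1)
          have h2 : l.countP (fun s => s < b + 1) = 0 := by
            rw [List.countP_eq_zero]
            intro s hs
            have := hl.1 s hs
            simp; omega
          rw [h2, if_pos (by omega), if_neg (by omega)] at h1
          omega
        refine ⟨hab, hlen, fun t => ?_⟩
        rcases le_or_gt t b with htb | htb
        · have : m.countP (fun s => s < t) = 0 := by
            rw [List.countP_eq_zero]
            intro s hs
            have := hm.1 s hs
            simp; omega
          omega
        · have := h t
          rw [if_pos htb, if_pos (by omega)] at this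
          omega

theorem forall₂_sort_iff {S T : Finset ℕ} :
    List.Forall₂ (· ≤ ·) (S.sort (· ≤ ·)) (T.sort (· ≤ ·)) ↔
      S.card = T.card ∧ ∀ t, countLT T t ≤ countLT S t := by
  have hc : ∀ (S : Finset ℕ) t, (S.sort (· ≤ ·)).countP (fun s => s < t) = countLT S t := by
    intro S t
    rw [List.countP_eq_length_filter, countLT,
      ← List.toFinset_card_of_nodup ((S.sort_nodup _).filter _), List.toFinset_filter,
      Finset.sort_toFinset]
    simp
  rw [forall₂_le_iff S.sortedLT_sort.pairwise T.sortedLT_sort.pairwise]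
  simp only [Finset.length_sort, hc]

/-- Column `j` of the right key of `P`. -/
def rightCol (P : List (List ℕ)) (j : ℕ) : Finset ℕ := (word (P.drop j)).foldl star ∅

/-- Column `j` of the left key of `L(Q)`. -/
def leftCol (Q : List (List (Finset ℕ))) (j : ℕ) : Finset ℕ := triChain (maxCol Q) j (maxCol Q j)

/-- Corresponding columns of the keys have the same size, so only the counts matter. Beyond the
shape both columns are empty, which allows arbitrary `j`. -/
theorem boundedTableauPairs_iff {PQ : List (List ℕ) × List (List (Finset ℕ))}
    (h : PQ ∈ tableauPairs) : PQ ∈ boundedTableauPairs ↔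
      ∀ j t, countLT (rightCol PQ.1 j) t ≤ countLT (leftCol PQ.2 j) t := by
  obtain ⟨P, Q⟩ := PQ
  have hlen : Q.length = P.length := by
    have := congrArg List.length h.2.2
    simpa [shape] using this.symm
  have hlk : leftKey (maxTableau Q) = (List.range P.length).map (leftCol Q) := by
    rw [leftKey_eq]
    simp only [toFinset_maxTableau]
    rw [show (maxTableau Q).length = P.length by simp [maxTableau, hlen]]
    rfl
  have hcard : ∀ j, (leftCol Q j).card = (rightCol P j).card := fun j => by
    rw [leftCol, card_triChain h.2.1.dominates subset_rfl, h.2.1.card_maxCol, rightCol,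
      card_rightKey h.1, length_getD_eq_shape, length_getD_eq_shape, ← h.2.2]
  have hiff : (P, Q) ∈ boundedTableauPairs ↔ KeyLE (leftKey (maxTableau Q)) (rightKey P) :=
    ⟨fun h => h.2, fun h' => ⟨h, h'⟩⟩
  rw [hiff, KeyLE, hlk, show rightKey P = (List.range P.length).map (rightCol P) from rfl,
    List.forall₂_map_left_iff, List.forall₂_map_right_iff, List.forall₂_same]
  simp only [forall₂_sort_iff, hcard, true_and, List.mem_range]
  refine ⟨fun h' j => ?_, fun h' j _ => h' j⟩
  by_cases hj : j < P.length
  · exact h' j hj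
  · intro t
    rw [rightCol, List.drop_eq_nil_of_le (not_lt.1 hj)]
    simp [countLT, word]

theorem rightCol_succ_subset (P : List (List ℕ)) (j : ℕ) : rightCol P (j + 1) ⊆ rightCol P j :=
  foldl_star_word_drop_subset P j

theorem leftCol_succ_subset (Q : List (List (Finset ℕ))) (j : ℕ) :
    leftCol Q (j + 1) ⊆ leftCol Q j := triChain_succ_subset j

/-! ### Boundedness and single steps -/

/-- As `y` is at most all recorded numbers, it affects the maximum only in a new box. -/
theorem StepResult.maxCol_eq {PQ PQ' : List (List ℕ) × List (List (Finset ℕ))} {x y : ℕ}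
    {q o : ℕ → ℕ} {c : ℕ} (h : Addable PQ x y) (hr : StepResult PQ PQ' x y q o c) :
    (entry ∅ PQ.2 c (q c) ≠ ∅ ∧ ∀ j, maxCol PQ'.2 j = maxCol PQ.2 j) ∨
      (entry ∅ PQ.2 c (q c) = ∅ ∧ maxCol PQ'.2 c = insert y (maxCol PQ.2 c) ∧
        ∀ j ≠ c, maxCol PQ'.2 j = maxCol PQ.2 j) := by
  have hp := h.mem.2.1.proper
  have hp' := hr.mem.2.1.proper
  have hne : ∀ j ≠ c, maxCol PQ'.2 j = maxCol PQ.2 j := by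
    intro j hj
    ext a
    rw [mem_maxCol hp, mem_maxCol hp', hr.entry_eq]
    simp only [setFill_of_ne _ _ (Or.inl hj)]
  by_cases he : entry ∅ PQ.2 c (q c) = ∅
  · refine Or.inr ⟨he, ?_, hne⟩
    ext a
    rw [Finset.mem_insert, mem_maxCol hp, mem_maxCol hp', hr.entry_eq, he]
    constructor
    · rintro ⟨r, h1, h2⟩
      by_cases hrq : r = q c
      · subst hrq
        rw [setFill_self] at h2
        left; simpa using h2.symm
      · rw [setFill_of_ne _ _ (Or.inr hrq)] at h1 h2
        exact Or.inr ⟨r, h1, h2⟩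
    · rintro (rfl | ⟨r, h1, h2⟩)
      · exact ⟨q c, by simp [setFill_self], by simp [setFill_self]⟩
      · have hrq : r ≠ q c := by rintro rfl; exact h1 he
        exact ⟨r, by rwa [setFill_of_ne _ _ (Or.inr hrq)], by rwa [setFill_of_ne _ _ (Or.inr hrq)]⟩
  · refine Or.inl ⟨he, fun j => ?_⟩
    by_cases hj : j = c
    swap
    · exact hne j hj
    subst hj
    have hsup : (insert y (entry ∅ PQ.2 j (q j))).sup id = (entry ∅ PQ.2 j (q j)).sup id := by
      rw [Finset.sup_insert]
      exact sup_eq_right.2 (h.le _ _ _ (sup_id_mem he))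
    ext a
    rw [mem_maxCol hp, mem_maxCol hp', hr.entry_eq]
    refine exists_congr fun r => ?_
    by_cases hrq : r = q j
    · rw [hrq, setFill_self, hsup]
      simp [he]
    · rw [setFill_of_ne _ _ (Or.inr hrq)]

theorem Addable.le_of_mem_maxCol {PQ : List (List ℕ) × List (List (Finset ℕ))} {x y : ℕ}
    (h : Addable PQ x y) {j a : ℕ} (ha : a ∈ maxCol PQ.2 j) : y ≤ a := by
  obtain ⟨r, h1, rfl⟩ := (mem_maxCol h.mem.2.1.proper).1 ha
  exact h.le _ _ _ (sup_id_mem h1)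

theorem le_of_countLT_le {S K : Finset ℕ} {y l : ℕ} (h : ∀ t, countLT S t ≤ countLT K t)
    (hK : ∀ a ∈ K, y ≤ a) (hl : ∃ s ∈ S, s ≤ l) : y ≤ l := by
  obtain ⟨s, hs, hsl⟩ := hl
  obtain ⟨a, ha, hlt⟩ := countLT_pos.1 ((countLT_pos.2 ⟨s, hs, Nat.lt_succ_self s⟩).trans_le (h (s + 1)))
  have := hK a ha
  omega

/-- A step of `Insert` preserves and reflects boundedness. -/
theorem Addable.bounded_iff {PQ : List (List ℕ) × List (List (Finset ℕ))} {x y : ℕ}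
    (h : Addable PQ x y) : insertStep PQ (x, y) ∈ boundedTableauPairs ↔
      PQ ∈ boundedTableauPairs ∧ y ≤ x := by
  obtain ⟨q, o, c, hr⟩ := h.insertStep_result
  generalize insertStep PQ (x, y) = PQ' at hr
  rw [boundedTableauPairs_iff hr.mem, boundedTableauPairs_iff h.mem]
  have hP := h.mem.1
  have hP' := hr.mem.1
  have hcol0 : ∀ a ∈ leftCol PQ.2 0, y ≤ a := fun a ha => h.le_of_mem_maxCol ha
  have hR0 : rightCol PQ'.1 0 = (word PQ.1).foldl star {x} := hr.trace.rightKey_zero hP hP' h.x_pos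
  have hx : ∃ s ∈ rightCol PQ'.1 0, s ≤ x := by
    rw [hR0]
    exact exists_le_mem_foldl_star (Or.inr ⟨x, by simp, le_rfl⟩)
  have hdom := h.mem.2.1.dominates
  have hdom' := hr.mem.2.1.dominates
  rcases StepResult.maxCol_eq h hr with ⟨he, hcol⟩ | ⟨he, hc, hne⟩
  -- Without a new box neither key changes, and `y ≤ x` follows from the first columns: on the left
  -- all elements are at least `y`, on the right some element is at most `x`.
  · have hL : ∀ j, leftCol PQ'.2 j = leftCol PQ.2 j := fun j => by
      unfold leftCol; rw [hcol j]; exact triChain_congr (fun i _ => hcol i) _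
    have hR : ∀ j, rightCol PQ'.1 j = rightCol PQ.1 j := fun j => by
      refine hr.trace.rightKey_eq hP hP' ?_
      have := congrArg Finset.card (hcol j)
      rw [hr.mem.2.1.card_maxCol, h.mem.2.1.card_maxCol, length_getD_eq_shape,
        length_getD_eq_shape, ← h.mem.2.2, ← hr.mem.2.2] at this
      rwa [length_getD_eq_shape, length_getD_eq_shape]
    simp only [hL, hR]
    refine ⟨fun h' => ⟨h', le_of_countLT_le (h' 0) hcol0 ?_⟩, fun h' => h'.1⟩
    rwa [hR] at hx
  · have hlen : ∀ j ≠ c, (PQ'.1.getD j []).length = (PQ.1.getD j []).length := fun j hj => by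
      have := congrArg Finset.card (hne j hj)
      rw [hr.mem.2.1.card_maxCol, h.mem.2.1.card_maxCol, length_getD_eq_shape,
        length_getD_eq_shape, ← h.mem.2.2, ← hr.mem.2.2] at this
      rwa [length_getD_eq_shape, length_getD_eq_shape]
    have hRne : ∀ j ≠ c, rightCol PQ'.1 j = rightCol PQ.1 j := fun j hj =>
      hr.trace.rightKey_eq hP hP' (hlen j hj)
    obtain ⟨z, hz, hRz, hRlt⟩ := hr.trace.rightKey_insert hP hP' (hr.replaces_iff.2 he)
    change z ∉ rightCol PQ.1 c at hz
    change rightCol PQ'.1 c = insert z (rightCol PQ.1 c) at hRz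
    change ∀ t ∈ rightCol PQ.1 c, t < z → t ∈ rightCol PQ.1 (c + 1) at hRlt
    have hnot : ∀ j, c ≤ j → y ∉ maxCol PQ.2 j := by
      intro j hj hy
      obtain ⟨r, h1, h2⟩ := (mem_maxCol h.mem.2.1.proper).1 hy
      have := h.col_lt j r (h2 ▸ sup_id_mem h1)
      rw [hr.box] at this
      dsimp only at this
      omega
    have hLne : ∀ j ≠ c, leftCol PQ'.2 j = leftCol PQ.2 j := by
      intro j hj
      unfold leftCol
      rw [hne j hj]
      rcases lt_or_gt_of_ne hj with hlt | hgt
      · exact triChain_congr (fun i hi => hne i (by omega)) _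
      · refine triChain_eq_of_lt hc hne (fun a ha => ?_) hgt subset_rfl
        have := h.le_of_mem_maxCol ha
        rcases this.eq_or_lt with rfl | hlt
        · exact absurd ha (hnot _ (by omega))
        · exact hlt
    obtain ⟨d, hd, hyd, hLd, hd0, hLlt⟩ := triChain_column_insert hdom hdom' hc (hnot c le_rfl) hne
      fun j a ha => h.le_of_mem_maxCol ha
    change d ∉ leftCol PQ.2 c at hd
    change leftCol PQ'.2 c = insert d (leftCol PQ.2 c) at hLd
    have hLlt' : ∀ b, c = b + 1 → ∀ v ∈ leftCol PQ.2 b, v < d → v ∈ leftCol PQ.2 c := hLlt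
    constructor
    · intro h'
      have hle : y ≤ x := by
        refine le_of_countLT_le (h' 0) (fun a ha => ?_) hx
        by_cases hc0 : c = 0
        · subst hc0
          rw [hLd] at ha
          rcases Finset.mem_insert.1 ha with rfl | ha
          · exact hyd
          · exact hcol0 a ha
        · rw [hLne 0 (Ne.symm hc0)] at ha
          exact hcol0 a ha
      refine ⟨fun j t => ?_, hle⟩
      by_cases hj : j = c
      swap
      · rw [← hLne j hj, ← hRne j hj]; exact h' j t
      subst hj
      -- Up to `z` the old right column is contained in its right neighbour, where nothing has
      -- changed. Beyond `z` the right count has grown by one and the left count by at most one.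
      rcases le_or_gt t z with htz | htz
      · calc countLT (rightCol PQ.1 j) t ≤ countLT (rightCol PQ.1 (j + 1)) t :=
              countLT_le_of_forall fun s hs hst => hRlt s hs (by omega)
          _ ≤ countLT (leftCol PQ.2 (j + 1)) t := by
              rw [← hLne (j + 1) (by omega), ← hRne (j + 1) (by omega)]; exact h' _ t
          _ ≤ countLT (leftCol PQ.2 j) t := countLT_mono (leftCol_succ_subset _ _) t
      · have := h' j t
        rw [hRz, hLd, countLT_insert hz, countLT_insert hd, if_pos htz] at this
        split_ifs at this <;> omega
    · rintro ⟨h', hle⟩ j t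
      by_cases hj : j = c
      swap
      · rw [hLne j hj, hRne j hj]; exact h' j t
      subst hj
      -- Up to `d` the left neighbours of the columns are used instead; beyond `d` the left count
      -- has grown by one and the right count by at most one.
      rcases le_or_gt t d with htd | htd
      · cases j with
        | zero =>
          -- The elements of this column are `x` or entries of `P`. The latter are at least the
          -- minimum of the old right column, which is at least `y` by boundedness; and `d = y` in
          -- the first column.
          have h0 : countLT (rightCol PQ'.1 0) t = 0 := by
            by_contra hcon
            obtain ⟨s, hs, hst⟩ := countLT_pos.1 (Nat.pos_of_ne_zero hcon)
            have hdy := hd0 rfl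
            have hys : y ≤ s := by
              rw [hR0] at hs
              rcases mem_of_mem_foldl_star hs with hs | hs
              · rw [Finset.mem_singleton.1 hs]; exact hle
              · exact le_of_countLT_le (h' 0) hcol0 (exists_le_mem_foldl_star (Or.inl hs))
            omega
          omega
        | succ b =>
          have hsub : rightCol PQ'.1 (b + 1) ⊆ rightCol PQ.1 b := by
            rw [← hRne b (by omega)]; exact rightCol_succ_subset _ _
          calc countLT (rightCol PQ'.1 (b + 1)) t ≤ countLT (rightCol PQ.1 b) t :=
                countLT_mono hsub t
            _ ≤ countLT (leftCol PQ.2 b) t := h' b t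
            _ ≤ countLT (leftCol PQ.2 (b + 1)) t :=
                countLT_le_of_forall fun s hs hst => hLlt' b rfl s hs (by omega)
            _ ≤ countLT (leftCol PQ'.2 (b + 1)) t := by
                rw [hLd]; exact countLT_mono (Finset.subset_insert _ _) t
      · have := h' j t
        rw [hRz, hLd, countLT_insert hz, countLT_insert hd, if_pos htd]
        split_ifs <;> omega

/-! ### Bounded words and the restricted bijections. -/

theorem bounded_insert_iff {a i : List ℕ} (hl : a.length = i.length)
    (h : (a, i) ∈ compatiblePairs) :
    (a, i) ∈ boundedPairs ↔ Insert (a, i) ∈ boundedTableauPairs := by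
  have hb : ∀ ai, ai ∈ compatiblePairs → (ai ∈ boundedPairs ↔ ∀ p ∈ ai.1.zip ai.2, p.2 ≤ p.1) :=
    fun ai h => ⟨fun h' => h'.2, fun h' => ⟨h, h'⟩⟩
  rw [hb _ h]
  induction a, i, hl using zip_induction with
  | nil =>
    refine ⟨fun _ => ⟨nil_mem_tableauPairs, ?_⟩, fun _ => by simp⟩
    simp [KeyLE, leftKey, rightKey, maxTableau, Insert]
  | concat a i x y hl ih =>
    have h0 := ((compatiblePairs_concat_iff hl).1 h).1
    have hadd := ((insert_compatible hl h0).2.2.2 x y).1 h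
    rw [insert_concat hl, hadd.bounded_iff, ← (show _ ↔ _ from ih h0)]
    dsimp only
    rw [List.zip_append hl]
    simp only [List.mem_append, List.zip_cons_cons, List.zip_nil_left, List.mem_singleton]
    constructor
    · exact fun h => ⟨fun p hp => h p (Or.inl hp), h _ (Or.inr rfl)⟩
    · rintro ⟨h1, h2⟩ p (hp | rfl)
      · exact h1 p hp
      · exact h2

theorem mem_boundedPairs_iff {ai : List ℕ × List ℕ} (h : ai ∈ compatiblePairs) :
    ai ∈ boundedPairs ↔ Insert ai ∈ boundedTableauPairs :=
  bounded_insert_iff (a := ai.1) (i := ai.2) h.1 h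

theorem bijOn_bounded : Set.BijOn Insert boundedPairs boundedTableauPairs := by
  have hinv : Set.InvOn RevInsert Insert boundedPairs boundedTableauPairs :=
    insert_invOn.mono (fun _ h => h.1) (fun _ h => h.1)
  refine hinv.bijOn (fun ai h => (mem_boundedPairs_iff h.1).1 h) fun PQ h => ?_
  rw [mem_boundedPairs_iff (revInsert_mapsTo h.1), insert_invOn.2 h.1]
  exact h

theorem bijOn_of_insertionTableau (P : List (List ℕ)) :
    Set.BijOn Insert (boundedPairsOf P) (boundedTableauPairsOf P) ∧
      Set.BijOn RevInsert (boundedTableauPairsOf P) (boundedPairsOf P) ∧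
      Set.InvOn RevInsert Insert (boundedPairsOf P) (boundedTableauPairsOf P) := by
  have hinv : Set.InvOn RevInsert Insert (boundedPairsOf P) (boundedTableauPairsOf P) :=
    insert_invOn.mono (fun _ h => h.1.1) (fun _ h => h.1.1)
  have hfst : ∀ ai ∈ compatiblePairs, (Insert ai).1 = insertionTableau ai.1 :=
    fun ai h => insert_fst (a := ai.1) (i := ai.2) h.1
  have h1 : Set.MapsTo Insert (boundedPairsOf P) (boundedTableauPairsOf P) :=
    fun ai h => ⟨bijOn_bounded.mapsTo h.1, (hfst ai h.1.1).trans h.2⟩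
  have h2 : Set.MapsTo RevInsert (boundedTableauPairsOf P) (boundedPairsOf P) := by
    intro PQ h
    have hc := revInsert_mapsTo h.1.1
    have he := insert_invOn.2 h.1.1
    refine ⟨(mem_boundedPairs_iff hc).2 (by rw [he]; exact h.1), ?_⟩
    rw [← hfst _ hc, he]
    exact h.2
  obtain ⟨h3, h4⟩ := bijOn_of_invOn h1 h2 hinv
  exact ⟨h3, h4, hinv⟩

end HeckeRSK

theorem theorem1p3 :
    (Set.BijOn HeckeRSK.Insert HeckeRSK.compatiblePairs HeckeRSK.tableauPairs ∧
      Set.BijOn HeckeRSK.RevInsert HeckeRSK.tableauPairs HeckeRSK.compatiblePairs ∧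
      Set.InvOn HeckeRSK.RevInsert HeckeRSK.Insert
        HeckeRSK.compatiblePairs HeckeRSK.tableauPairs) ∧
    Set.BijOn HeckeRSK.Insert HeckeRSK.boundedPairs HeckeRSK.boundedTableauPairs ∧
    ∀ P : List (List ℕ), HeckeRSK.IsDecreasing P →
      Set.BijOn HeckeRSK.Insert
        (HeckeRSK.boundedPairsOf P) (HeckeRSK.boundedTableauPairsOf P) ∧
      Set.BijOn HeckeRSK.RevInsert
        (HeckeRSK.boundedTableauPairsOf P) (HeckeRSK.boundedPairsOf P) ∧
      Set.InvOn HeckeRSK.RevInsert HeckeRSK.Insert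
        (HeckeRSK.boundedPairsOf P) (HeckeRSK.boundedTableauPairsOf P) := by
  obtain ⟨h1, h2⟩ := HeckeRSK.bijOn_of_invOn HeckeRSK.insert_mapsTo HeckeRSK.revInsert_mapsTo
    HeckeRSK.insert_invOn
  exact ⟨⟨h1, h2, HeckeRSK.insert_invOn⟩, HeckeRSK.bijOn_bounded, fun P _ =>
    HeckeRSK.bijOn_of_insertionTableau P⟩
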